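/- Consider a tabular constrained Markov decision process with finite state set $\mathcal S$ ($S=|\mathcal S|$), finite action set $\mathcal A$ ($A=|\mathcal A|$), transition probabilities $\mathcal P(\cdot|s,a)$, initial state distribution $\rho$, discount factor $\gamma\in[0,1)$, reward $r:\mathcal S\times\mathcal A\to[0,1]$, constraint reward $c:\mathcal S\times\mathcal A\to[0,1]$ and threshold $b\ge 0$. For a policy $\pi:\mathcal S\to\Delta_{\mathcal A}$ and $f\in\{r,c\}$ let $V_f^\pi(s)=\mathbb E_{\pi,\mathcal P}[\sum_{k\ge0}\gamma^k f(s_k,a_k)\mid s_0=s]$ and $V_f^\pi(\rho)=\sum_s\rho(s)V_f^\pi(s)$. Assume that $\zeta:=\max_\pi V_c^\pi(\rho)-b>0$, let $\pi^*$ maximize $V_r^\pi(\rho)$ subject to $V_c^\pi(\rho)\ge b$, and put $U=\frac{2}{\zeta(1-\gamma)}$. Fix $T,m\ge1$, $\delta\in(0,1)$, an initial policy $\pi_0$ and $\lambda_0\in[0,U]$, put $w_0=0$, and run the following algorithm. In iteration $t=0,1,\dots$, draw, independently given the past, $m$ independent trajectories from each state-action pair $(s,a)$, each following $\pi_t$ after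 its first state-action pair $(s,a)$. Let $\hat Q_r^t(s,a)$ and $\hat Q_c^t(s,a)$ be the averages over these $m$ trajectories of the discounted sums of $r$ and of $c$. With $[x]_+=\max\{x,0\}$, let $\hat L_t=\hat Q_r^t+\lambda_t\hat Q_c^t$, $$\hat A_t(s,a)=\tfrac{1-\gamma}{1+U}\Big[\hat L_t(s,a)-\sum_{a'}\pi_t(a'|s)\hat L_t(s,a')\Big],\qquad \tilde A_t(s,a)=\begin{cases}\hat A_t(s,a)&\text{if } w_t(s,a)>0,\\ [\hat A_t(s,a)]_+&\text{if } w_t(s,a)\le0.\end{cases}$$ The primal update is $$w_{t+1}(s,a)=\frac{\sum_{i=0}^t\tilde A_i(s,a)}{(t+1)+T/2}\Big(1+\sum_{i=0}^t\tilde A_i(s,a)w_i(s,a)\Big),\qquad \pi_{t+1}(a|s)=\frac{\pi_0(a|s)[w_{t+1}(s,a)]_+}{\sum_{a'}\pi_0(a'|s)[w_{t+1}(s,a')]_+},$$ with $\pi_{t+1}(\cdot|s)=\pi_0(\cdot|s)$ if the last denominator is $0$. With $g_t=\sum_s\rho(s)\sum_a\pi_t(a|s)\hat Q_c^t(s,a)-b$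 and $\sigma(x)=1/(1+e^{-x})$, the dual update, projected onto $[0,U]$ by $\mathbb P_{[0,U]}$, is $$\lambda_{t+1}=\mathbb P_{[0,U]}\Big[\lambda_0-\beta_t\Big(\tfrac1{1-\gamma}-\sum_{i=0}^t(\lambda_i-\lambda_0)g_i\Big)\Big],\qquad \beta_t=(1-\gamma)\Big(2\sigma\Big(\frac{2\sum_{i=0}^tg_i}{\frac1{1-\gamma}+\sum_{i=0}^t|g_i|}\Big)-1\Big).$$ Let $\nu(s)=(1-\gamma)\sum_{k\ge0}\gamma^k\Pr(s_k=s)$ be the discounted state occupation measure of $\pi^*$ started from $\rho$, and let $\mathrm{KL}=\sum_s\nu(s)\,\mathrm{KL}(\pi^*(\cdot|s)\,\|\,\pi_0(\cdot|s))$, which is assumed to be finite. Put $\varepsilon_s=\frac1{1-\gamma}\sqrt{\frac{\log(2SA/\delta)}{2m}}$ and $\Psi=4U\sqrt{\log((T+1)U)}+1$. Then, with probability at least $1-\delta$, both of the following bounds hold: $$\frac1T\sum_{t=0}^{T-1}\big[V_r^{\pi^*}(\rho)-V_r^{\pi_t}(\rho)\big]\le\frac{\frac{3(1+U)\sqrt{1+\mathrm{KL}}}{1-\gamma}+\Psi}{(1-\gamma)\sqrt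 T}+\frac{\varepsilon_s(1+2U)}{1-\gamma},$$ $$\frac1T\Big[\sum_{t=0}^{T-1}\big(b-V_c^{\pi_t}(\rho)\big)\Big]_+\le\frac{\zeta\Big(\frac{3(1+U)\sqrt{1+\mathrm{KL}}}{1-\gamma}+\Psi\Big)}{\sqrt T}+\zeta\,\varepsilon_s(1+2U).$$ -/

import Mathlib

open MeasureTheory ProbabilityTheory
open scoped ENNReal

set_option linter.unusedSectionVars false

noncomputable section

/-- A tabular constrained Markov decision process with finitely many states and actions:
transition probabilities, reward and constraint reward with values in `[0, 1]`, constraint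
threshold `b`, initial state distribution `ρ` and discount factor `γ ∈ [0, 1)`. -/
structure CMDP (S A : Type*) [Fintype S] [Fintype A] where
  P : S → A → stdSimplex ℝ S
  r : S → A → ℝ
  r_mem : ∀ s a, r s a ∈ Set.Icc (0 : ℝ) 1
  c : S → A → ℝ
  c_mem : ∀ s a, c s a ∈ Set.Icc (0 : ℝ) 1
  b : ℝ
  ρ : stdSimplex ℝ S
  γ : ℝ
  γ_nonneg : 0 ≤ γ
  γ_lt_one : γ < 1

/-- Memoryless randomized policies: `π s a` is the probability of action `a` in state `s`. -/
abbrev Policy (S A : Type*) [Fintype A] := S → stdSimplex ℝ A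

/-- Infinite state-action trajectories. -/
abbrev Trajectory (S A : Type*) := ℕ → S × A

/-- The data of one iteration: `m` trajectories for every state-action pair. -/
abbrev Batch (S A : Type*) (m : ℕ) := S × A × Fin m → Trajectory S A

/-- Estimates of the reward and of the constraint action-value function. -/
abbrev Estimate (S A : Type*) := (S → A → ℝ) × (S → A → ℝ)

/-- The probability measure on a finite type with the given weights. -/
def simplexMeasure {X : Type*} [Fintype X] [MeasurableSpace X] (p : stdSimplex ℝ X) :
    Measure X :=
  ∑ x, ENNReal.ofReal (p x) • Measure.dirac x

theorem simplex_sum_ofReal {X : Type*} [Fintype X] (p : stdSimplex ℝ X) :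
    ∑ x, ENNReal.ofReal (p x) = 1 := by
  rw [← ENNReal.ofReal_sum_of_nonneg (fun x _ => stdSimplex.zero_le p x),
    stdSimplex.sum_eq_one, ENNReal.ofReal_one]

theorem measurable_simplex_apply {X : Type*} [Fintype X] (x : X) :
    Measurable fun p : stdSimplex ℝ X => p x :=
  (measurable_pi_apply x).comp measurable_subtype_coe

namespace CMDP

variable {S A : Type*} [Fintype S] [Fintype A]

/-! ### Laws of trajectories -/

section Laws

variable [MeasurableSpace S] [MeasurableSpace A]

/-- The law of `(s, a)` with `a ∼ π(·|s)`. -/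
def stateLaw (π : Policy S A) (s : S) : Measure (S × A) :=
  ∑ a, ENNReal.ofReal (π s a) • Measure.dirac (s, a)

/-- The law of `(s, a)` with `s ∼ p` and `a ∼ π(·|s)`. -/
def pairLaw (π : Policy S A) (p : stdSimplex ℝ S) : Measure (S × A) :=
  ∑ s, ENNReal.ofReal (p s) • stateLaw π s

instance (π : Policy S A) (s : S) : IsProbabilityMeasure (stateLaw π s) := by
  constructor
  simp [stateLaw, simplex_sum_ofReal]

instance (π : Policy S A) (p : stdSimplex ℝ S) : IsProbabilityMeasure (pairLaw π p) := by
  constructor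
  simp [pairLaw, simplex_sum_ofReal]

variable [DiscreteMeasurableSpace S] [DiscreteMeasurableSpace A] (M : CMDP S A)

/-- One step of the state-action chain under `π`: `s' ∼ P(·|s, a)`, then `a' ∼ π(·|s')`. -/
def stepKernel (π : Policy S A) : Kernel (S × A) (S × A) :=
  Kernel.ofFunOfCountable fun x => pairLaw π (M.P x.1 x.2)

instance (π : Policy S A) : IsMarkovKernel (M.stepKernel π) :=
  ⟨fun x => inferInstanceAs (IsProbabilityMeasure (pairLaw π (M.P x.1 x.2)))⟩

/-- The same step, as a transition from the history up to time `n`. -/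
def historyKernel (π : Policy S A) (n : ℕ) :
    Kernel ((i : Finset.Iic n) → S × A) (S × A) :=
  (M.stepKernel π).comap (fun h => h ⟨n, Finset.mem_Iic.2 le_rfl⟩) (measurable_pi_apply _)

instance (π : Policy S A) (n : ℕ) : IsMarkovKernel (M.historyKernel π n) := by
  unfold historyKernel
  infer_instance

/-- The law of the trajectory `(s₀, a₀), (s₁, a₁), …` that starts with `(s₀, a₀) ∼ μ` and then
follows the policy `π`. -/
def pathLaw (π : Policy S A) (μ : Measure (S × A)) : Measure (Trajectory S A) :=
  Kernel.trajMeasure (X := fun _ => S × A) μ (M.historyKernel π)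

instance (π : Policy S A) (μ : Measure (S × A)) [IsProbabilityMeasure μ] :
    IsProbabilityMeasure (M.pathLaw π μ) := by
  unfold pathLaw
  infer_instance

/-- The law of the data of one iteration: all trajectories are independent, those for `(s, a)`
start in `(s, a)` and then follow `π`. -/
def batchLaw (m : ℕ) (π : Policy S A) : Measure (Batch S A m) :=
  Measure.pi fun x => M.pathLaw π (Measure.dirac (x.1, x.2.1))

instance (m : ℕ) (π : Policy S A) : IsProbabilityMeasure (M.batchLaw m π) := by
  unfold batchLaw
  infer_instance

theorem measurable_pairLaw_apply (p : stdSimplex ℝ S) (t : Set (S × A)) :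
    Measurable fun π : Policy S A => pairLaw π p t := by
  simp only [pairLaw, stateLaw, Measure.coe_finsetSum, Finset.sum_apply, Measure.smul_apply,
    smul_eq_mul]
  refine Finset.measurable_fun_sum _ fun s _ => Measurable.const_mul ?_ _
  refine Finset.measurable_fun_sum _ fun a _ => Measurable.mul_const ?_ _
  exact ((measurable_simplex_apply a).comp (measurable_pi_apply s)).ennreal_ofReal

theorem measurable_pathLaw_frestrictLe (μ : Measure (S × A)) [IsProbabilityMeasure μ] (n : ℕ)
    (x : (i : Finset.Iic n) → S × A) :
    Measurable fun π : Policy S A =>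
      (M.pathLaw π μ).map (Preorder.frestrictLe (π := fun _ => S × A) n) {x} := by
  induction n with
  | zero =>
    have h : ∀ π : Policy S A,
        (M.pathLaw π μ).map (Preorder.frestrictLe (π := fun _ => S × A) 0) =
          μ.map (MeasurableEquiv.piUnique (fun _ : Finset.Iic 0 => S × A)).symm := by
      intro π
      rw [pathLaw, Kernel.trajMeasure, Measure.map_comp _ _ (by fun_prop),
        Kernel.traj_map_frestrictLe, Kernel.partialTraj_self, Measure.id_comp]
    simp only [h]
    exact measurable_const
  | succ n ih =>
    let y : (i : Finset.Iic n) → S × A :=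
      fun i => x ⟨i.1, Finset.mem_Iic.2 ((Finset.mem_Iic.1 i.2).trans n.le_succ)⟩
    let z : S × A := x ⟨n + 1, Finset.mem_Iic.2 le_rfl⟩
    have h : ∀ π : Policy S A,
        (M.pathLaw π μ).map (Preorder.frestrictLe (π := fun _ => S × A) (n + 1)) {x} =
          pairLaw π (M.P (y ⟨n, Finset.mem_Iic.2 le_rfl⟩).1 (y ⟨n, Finset.mem_Iic.2 le_rfl⟩).2) {z}
            * (M.pathLaw π μ).map (Preorder.frestrictLe (π := fun _ => S × A) n) {y} := by
      intro π
      have hset : Preorder.frestrictLe (π := fun _ => S × A) (n + 1) ⁻¹' {x} =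
          (fun τ : Trajectory S A =>
            (Preorder.frestrictLe (π := fun _ => S × A) n τ, τ (n + 1))) ⁻¹' ({y} ×ˢ {z}) := by
        ext τ
        simp only [Set.mem_preimage, Set.mem_singleton_iff, Set.mem_prod]
        constructor
        · rintro rfl
          exact ⟨rfl, rfl⟩
        · rintro ⟨h1, h2⟩
          funext i
          rcases Nat.lt_or_ge i.1 (n + 1) with hi | hi
          · exact congrFun h1 ⟨i.1, Finset.mem_Iic.2 (Nat.lt_succ_iff.1 hi)⟩
          · have hi' : i = ⟨n + 1, Finset.mem_Iic.2 le_rfl⟩ :=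
              Subtype.ext (le_antisymm (Finset.mem_Iic.1 i.2) hi)
            subst hi'
            exact h2
      rw [Measure.map_apply (by fun_prop) (measurableSet_singleton x), hset,
        ← Measure.map_apply (by fun_prop)
          ((measurableSet_singleton y).prod (measurableSet_singleton z))]
      have := Kernel.map_frestrictLe_trajMeasure_compProd_eq_map_trajMeasure
        (X := fun _ => S × A) (μ₀ := μ) (κ := M.historyKernel π) (a := n)
      rw [pathLaw, ← this, Measure.compProd_apply_prod (measurableSet_singleton y)
        (measurableSet_singleton z), lintegral_singleton]
      rfl
    simp only [h]
    exact (measurable_pairLaw_apply _ _).mul (ih y)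

theorem measurable_pathLaw (μ : Measure (S × A)) [IsProbabilityMeasure μ] :
    Measurable fun π : Policy S A => M.pathLaw π μ := by
  refine Measurable.measure_of_isPiSystem_of_isProbabilityMeasure
    generateFrom_measurableCylinders.symm isPiSystem_measurableCylinders ?_
  intro t ht
  obtain ⟨I, t', ht', rfl⟩ := (mem_measurableCylinders t).1 ht
  obtain ⟨n, hn⟩ : ∃ n, I ⊆ Finset.Iic n :=
    ⟨I.sup id, fun i hi => Finset.mem_Iic.2 (Finset.le_sup (f := id) hi)⟩
  let t'' : Set ((i : Finset.Iic n) → S × A) := Finset.restrict₂ (π := fun _ => S × A) hn ⁻¹' t'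
  have h : ∀ π : Policy S A, M.pathLaw π μ (cylinder I t') =
      ∑ x ∈ (Set.toFinite t'').toFinset,
        (M.pathLaw π μ).map (Preorder.frestrictLe (π := fun _ => S × A) n) {x} := by
    intro π
    rw [sum_measure_singleton, Set.Finite.coe_toFinset,
      Measure.map_apply (by fun_prop) (Set.toFinite t'').measurableSet]
    rfl
  simp only [h]
  exact Finset.measurable_fun_sum _ fun x _ => M.measurable_pathLaw_frestrictLe μ n x

theorem measurable_batchLaw (m : ℕ) : Measurable (M.batchLaw m) := by
  refine Measurable.measure_of_isPiSystem_of_isProbabilityMeasure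
    generateFrom_pi.symm isPiSystem_pi ?_
  rintro _ ⟨t, ht, rfl⟩
  simp only [batchLaw, Measure.pi_pi]
  refine Finset.measurable_fun_prod _ fun x _ => ?_
  have hx : MeasurableSet (t x) := ht x (Set.mem_univ x)
  exact (Measure.measurable_coe hx).comp (M.measurable_pathLaw _)

end Laws

/-! ### Value functions and the constrained problem -/

section Values

/-- The discounted return `∑ₖ γᵏ f(sₖ, aₖ)` of a trajectory. -/
def discReturn (M : CMDP S A) (f : S → A → ℝ) (τ : Trajectory S A) : ℝ :=
  ∑' k, M.γ ^ k * f (τ k).1 (τ k).2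

variable [MeasurableSpace S] [DiscreteMeasurableSpace S]
  [MeasurableSpace A] [DiscreteMeasurableSpace A] (M : CMDP S A)

/-- The value function `V_f^π(s)`: the expected discounted return from `s` under `π`. -/
def V (f : S → A → ℝ) (π : Policy S A) (s : S) : ℝ :=
  ∫ τ, M.discReturn f τ ∂(M.pathLaw π (stateLaw π s))

/-- The value `V_f^π(ρ)` of a policy. -/
def value (f : S → A → ℝ) (π : Policy S A) : ℝ :=
  ∑ s, M.ρ s * M.V f π s

/-- `π` maximizes the reward value among the policies whose constraint value is at least `b`. -/
def IsOptimal (π : Policy S A) : Prop :=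
  M.b ≤ M.value M.c π ∧ ∀ π' : Policy S A, M.b ≤ M.value M.c π' → M.value M.r π' ≤ M.value M.r π

/-- `ζ = max_π V_c^π(ρ) - b`. -/
def ζ : ℝ := (⨆ π : Policy S A, M.value M.c π) - M.b

/-- `U = 2 / (ζ (1 - γ))`. -/
def U : ℝ := 2 / (M.ζ * (1 - M.γ))

/-- The normalized discounted state occupation measure of `π`, started from `ρ`. -/
def occupation (π : Policy S A) (s : S) : ℝ :=
  (1 - M.γ) * ∑' k : ℕ, M.γ ^ k * (M.pathLaw π (pairLaw π M.ρ)).real {τ | (τ k).1 = s}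

/-- `𝔼_{s ∼ ν} KL(π(·|s) ‖ π'(·|s))`, where `ν` is the discounted occupation measure of `π`. -/
def policyKL (π π' : Policy S A) : ℝ≥0∞ :=
  ∑ s, ENNReal.ofReal (M.occupation π s) *
    InformationTheory.klDiv (simplexMeasure (π s)) (simplexMeasure (π' s))

end Values

/-! ### The coin-betting updates -/

/-- Weights, policy and dual variable of one iteration. -/
structure Iterate (S A : Type*) [Fintype A] where
  w : S → A → ℝ
  pol : Policy S A
  lam : ℝ

/-- The policy `π(a|s) ∝ π₀(a|s) [w(s, a)]₊`, which is `π₀(·|s)` if all these numbers vanish. -/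
def coinPolicy (π₀ : Policy S A) (w : S → A → ℝ) : Policy S A := fun s =>
  if h : ∑ a, π₀ s a * max (w s a) 0 = 0 then π₀ s
  else ⟨fun a => π₀ s a * max (w s a) 0 / ∑ a', π₀ s a' * max (w s a') 0,
    fun a => div_nonneg (mul_nonneg (stdSimplex.zero_le _ _) (le_max_right _ _))
      (Finset.sum_nonneg fun _ _ => mul_nonneg (stdSimplex.zero_le _ _) (le_max_right _ _)),
    by rw [← Finset.sum_div, div_self h]⟩

section Updates

variable (M : CMDP S A) (U : ℝ)

/-- The estimated action-value function of the Lagrangian, `Q̂_r + λ Q̂_c`. -/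
def lagQ (lam : ℝ) (q : Estimate S A) (s : S) (a : A) : ℝ := q.1 s a + lam * q.2 s a

/-- The normalized advantage. -/
def advHat (x : Iterate S A) (q : Estimate S A) (s : S) (a : A) : ℝ :=
  (1 - M.γ) / (1 + U) * (lagQ x.lam q s a - ∑ a', x.pol s a' * lagQ x.lam q s a')

/-- The truncated advantage. -/
def advTilde (x : Iterate S A) (q : Estimate S A) (s : S) (a : A) : ℝ :=
  if 0 < x.w s a then M.advHat U x q s a else max (M.advHat U x q s a) 0

/-- The estimated constraint value `V̂_c^π(ρ)`. -/
def valueHat (π : Policy S A) (q : Estimate S A) : ℝ :=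
  ∑ s, M.ρ s * ∑ a, π s a * q.2 s a

/-- The iterates of the coin-betting primal and dual updates with horizon `T`, where the dual
variable is projected onto `[0, U]`; `q i` is the estimate obtained in iteration `i`, and iterate
`t` depends on `q 0, …, q (t - 1)` only. -/
def iterate (T : ℕ) (π₀ : Policy S A) (lam₀ : ℝ) (q : ℕ → Estimate S A) : ℕ → Iterate S A
  | 0 => ⟨fun _ _ => 0, π₀, lam₀⟩
  | t + 1 =>
    let x : Fin (t + 1) → Iterate S A := fun i => iterate T π₀ lam₀ q i.1
    let adv : Fin (t + 1) → S → A → ℝ := fun i => M.advTilde U (x i) (q i)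
    let g : Fin (t + 1) → ℝ := fun i => M.valueHat (x i).pol (q i) - M.b
    let w : S → A → ℝ := fun s a =>
      (∑ i, adv i s a) / ((t + 1 : ℝ) + T / 2) * (1 + ∑ i, adv i s a * (x i).w s a)
    let β : ℝ := (1 - M.γ) *
      (2 * Real.sigmoid (2 * (∑ i, g i) / (1 / (1 - M.γ) + ∑ i, |g i|)) - 1)
    let lam : ℝ := lam₀ - β * (1 / (1 - M.γ) - ∑ i, ((x i).lam - lam₀) * g i)
    ⟨w, coinPolicy π₀ w, max 0 (min U lam)⟩
  termination_by t => t
  decreasing_by exact i.2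

/-- The Monte Carlo estimates: averages of the discounted returns over the `m` trajectories. -/
def estimate {m : ℕ} (B : Batch S A m) : Estimate S A :=
  (fun s a => (∑ j, M.discReturn M.r (B (s, a, j))) / m,
    fun s a => (∑ j, M.discReturn M.c (B (s, a, j))) / m)

/-- The iterates along the data `B 0, B 1, …` of the successive iterations. -/
def runIterate {m : ℕ} (T : ℕ) (π₀ : Policy S A) (lam₀ : ℝ) (B : ℕ → Batch S A m) (t : ℕ) :
    Iterate S A :=
  M.iterate U T π₀ lam₀ (fun i => M.estimate (B i)) t

/-- The policy of iteration `n + 1` as a function of the data of the iterations `0, …, n`. -/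
def nextPolicy {m : ℕ} (T : ℕ) (π₀ : Policy S A) (lam₀ : ℝ) (n : ℕ)
    (h : (i : Finset.Iic n) → Batch S A m) : Policy S A :=
  (M.iterate U T π₀ lam₀
    (fun i => if hi : i ≤ n then M.estimate (h ⟨i, Finset.mem_Iic.2 hi⟩) else 0) (n + 1)).pol

end Updates

/-! ### The law of a run of the algorithm -/

section Run

variable [MeasurableSpace S] [DiscreteMeasurableSpace S]
  [MeasurableSpace A] [DiscreteMeasurableSpace A] (M : CMDP S A)

theorem measurable_discReturn (f : S → A → ℝ) : Measurable (M.discReturn f) := by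
  unfold discReturn
  refine Measurable.tsum fun k => Measurable.const_mul ?_ _
  exact (measurable_of_countable fun x : S × A => f x.1 x.2).comp (measurable_pi_apply k)

theorem measurable_estimate (m : ℕ) : Measurable (M.estimate (m := m)) := by
  have h : ∀ f : S → A → ℝ, Measurable fun (B : Batch S A m) (s : S) (a : A) =>
      (∑ j, M.discReturn f (B (s, a, j))) / m := by
    intro f
    refine measurable_pi_lambda _ fun s => measurable_pi_lambda _ fun a => ?_
    refine Measurable.div_const ?_ _
    exact Finset.measurable_fun_sum _ fun j _ =>
      (M.measurable_discReturn f).comp (measurable_pi_apply _)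
  exact (h M.r).prodMk (h M.c)

theorem measurable_coinPolicy {Ω : Type*} [MeasurableSpace Ω] (π₀ : Policy S A)
    {w : Ω → S → A → ℝ} (hw : ∀ s a, Measurable fun ω => w ω s a) :
    Measurable fun ω => coinPolicy π₀ (w ω) := by
  have hn : ∀ s a, Measurable fun ω => π₀ s a * max (w ω s a) 0 := fun s a =>
    ((hw s a).max measurable_const).const_mul _
  have hd : ∀ s, Measurable fun ω => ∑ a, π₀ s a * max (w ω s a) 0 := fun s =>
    Finset.measurable_fun_sum _ fun a _ => hn s a
  refine measurable_pi_lambda _ fun s => Measurable.subtype_mk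
    (f := fun ω => (coinPolicy π₀ (w ω) s : A → ℝ)) (measurable_pi_lambda _ fun a => ?_)
  have h : (fun ω => (coinPolicy π₀ (w ω) s : A → ℝ) a) = fun ω =>
      if ∑ a, π₀ s a * max (w ω s a) 0 = 0 then π₀ s a
      else π₀ s a * max (w ω s a) 0 / ∑ a', π₀ s a' * max (w ω s a') 0 := by
    funext ω
    unfold coinPolicy
    split_ifs <;> rfl
  rw [h]
  exact Measurable.ite (hd s (measurableSet_singleton 0)) measurable_const ((hn s a).div (hd s))

theorem measurable_iterate {Ω : Type*} [MeasurableSpace Ω] (U : ℝ) (T : ℕ) (π₀ : Policy S A)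
    (lam₀ : ℝ) {q : Ω → ℕ → Estimate S A} (hq : ∀ i, Measurable fun ω => q ω i) (t : ℕ) :
    (∀ s a, Measurable fun ω => (M.iterate U T π₀ lam₀ (q ω) t).w s a) ∧
      (Measurable fun ω => (M.iterate U T π₀ lam₀ (q ω) t).pol) ∧
      Measurable fun ω => (M.iterate U T π₀ lam₀ (q ω) t).lam := by
  induction t using Nat.strong_induction_on with
  | _ t ih =>
    cases t with
    | zero =>
      simp only [iterate]
      exact ⟨fun _ _ => measurable_const, measurable_const, measurable_const⟩
    | succ t =>
      have hw := fun i : Fin (t + 1) => (ih i.1 i.2).1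
      have hlam := fun i : Fin (t + 1) => (ih i.1 i.2).2.2
      have hpol : ∀ (i : Fin (t + 1)) (s : S) (a : A),
          Measurable fun ω => (M.iterate U T π₀ lam₀ (q ω) i.1).pol s a := fun i s a =>
        (measurable_simplex_apply a).comp ((measurable_pi_apply s).comp (ih i.1 i.2).2.1)
      have hq1 : ∀ i s a, Measurable fun ω => (q ω i).1 s a := fun i s a =>
        (measurable_pi_apply a).comp ((measurable_pi_apply s).comp (hq i).fst)
      have hq2 : ∀ i s a, Measurable fun ω => (q ω i).2 s a := fun i s a =>
        (measurable_pi_apply a).comp ((measurable_pi_apply s).comp (hq i).snd)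
      have hL : ∀ (i : Fin (t + 1)) (s : S) (a : A), Measurable fun ω =>
          lagQ (M.iterate U T π₀ lam₀ (q ω) i.1).lam (q ω i) s a := fun i s a =>
        (hq1 i s a).add ((hlam i).mul (hq2 i s a))
      have hH : ∀ (i : Fin (t + 1)) (s : S) (a : A), Measurable fun ω =>
          M.advHat U (M.iterate U T π₀ lam₀ (q ω) i.1) (q ω i) s a := fun i s a =>
        Measurable.const_mul ((hL i s a).sub
          (Finset.measurable_fun_sum _ fun a' _ => (hpol i s a').mul (hL i s a'))) _
      have hadv : ∀ (i : Fin (t + 1)) (s : S) (a : A), Measurable fun ω =>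
          M.advTilde U (M.iterate U T π₀ lam₀ (q ω) i.1) (q ω i) s a := fun i s a =>
        Measurable.ite (measurableSet_lt measurable_const (hw i s a)) (hH i s a)
          ((hH i s a).max measurable_const)
      have hg : ∀ i : Fin (t + 1), Measurable fun ω =>
          M.valueHat (M.iterate U T π₀ lam₀ (q ω) i.1).pol (q ω i) - M.b := fun i =>
        Measurable.sub_const (Finset.measurable_fun_sum _ fun s _ => Measurable.const_mul
          (Finset.measurable_fun_sum _ fun a _ => (hpol i s a).mul (hq2 i s a)) _) _
      have hw' : ∀ s a, Measurable fun ω =>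
          (∑ i : Fin (t + 1), M.advTilde U (M.iterate U T π₀ lam₀ (q ω) i.1) (q ω i) s a) /
            ((t + 1 : ℝ) + T / 2) *
          (1 + ∑ i : Fin (t + 1), M.advTilde U (M.iterate U T π₀ lam₀ (q ω) i.1) (q ω i) s a *
            (M.iterate U T π₀ lam₀ (q ω) i.1).w s a) := fun s a =>
        Measurable.mul
          (Measurable.div_const (Finset.measurable_fun_sum _ fun i _ => hadv i s a) _)
          (Measurable.const_add
            (Finset.measurable_fun_sum _ fun i _ => (hadv i s a).mul (hw i s a)) _)
      refine ⟨?_, ?_, ?_⟩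
      · intro s a
        simp only [iterate]
        exact hw' s a
      · simp only [iterate]
        exact measurable_coinPolicy π₀ hw'
      · simp only [iterate]
        have hs : Measurable Real.sigmoid := by fun_prop
        refine measurable_const.max (measurable_const.min (Measurable.const_sub (Measurable.mul
          (Measurable.const_mul (Measurable.sub_const (Measurable.const_mul (hs.comp
            (Measurable.div (Measurable.const_mul (Finset.measurable_fun_sum _ fun i _ => hg i) _)
              (Measurable.const_add (Finset.measurable_fun_sum _ fun i _ => (hg i).abs) _))) _) _)
            _)
          (Measurable.const_sub (Finset.measurable_fun_sum _ fun i _ =>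
            Measurable.mul ((hlam i).sub_const _) (hg i)) _)) _))

theorem measurable_nextPolicy (U : ℝ) {m : ℕ} (T : ℕ) (π₀ : Policy S A) (lam₀ : ℝ) (n : ℕ) :
    Measurable (M.nextPolicy U (m := m) T π₀ lam₀ n) := by
  refine (M.measurable_iterate U T π₀ lam₀ (fun i => ?_) (n + 1)).2.1
  by_cases hi : i ≤ n
  · simp only [hi, dite_true]
    exact (M.measurable_estimate m).comp (measurable_pi_apply _)
  · simp only [hi, dite_false]
    exact measurable_const

/-- The conditional law of the data of iteration `n + 1` given the earlier data. -/
def runKernel (U : ℝ) (m T : ℕ) (π₀ : Policy S A) (lam₀ : ℝ) (n : ℕ) :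
    Kernel ((i : Finset.Iic n) → Batch S A m) (Batch S A m) where
  toFun h := M.batchLaw m (M.nextPolicy U T π₀ lam₀ n h)
  measurable' := (M.measurable_batchLaw m).comp (M.measurable_nextPolicy U T π₀ lam₀ n)

instance (U : ℝ) (m T : ℕ) (π₀ : Policy S A) (lam₀ : ℝ) (n : ℕ) :
    IsMarkovKernel (M.runKernel U m T π₀ lam₀ n) :=
  ⟨fun h => inferInstanceAs (IsProbabilityMeasure (M.batchLaw m (M.nextPolicy U T π₀ lam₀ n h)))⟩

/-- The law of all the data drawn by the algorithm with dual bound `U`: in iteration `t` the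
trajectories are drawn with the current policy `π_t`, which is computed from the earlier data. -/
def runLaw (U : ℝ) (m T : ℕ) (π₀ : Policy S A) (lam₀ : ℝ) : Measure (ℕ → Batch S A m) :=
  Kernel.trajMeasure (X := fun _ => Batch S A m) (M.batchLaw m π₀) (M.runKernel U m T π₀ lam₀)

instance (U : ℝ) (m T : ℕ) (π₀ : Policy S A) (lam₀ : ℝ) :
    IsProbabilityMeasure (M.runLaw U m T π₀ lam₀) := by
  unfold runLaw
  infer_instance

/-- The average optimality gap of the policies `pol 0, …, pol (T - 1)` with respect to `πs`. -/
def optGap (πs : Policy S A) (T : ℕ) (pol : ℕ → Policy S A) : ℝ :=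
  (1 / T) * ∑ t ∈ Finset.range T, (M.value M.r πs - M.value M.r (pol t))

/-- The average constraint violation of the policies `pol 0, …, pol (T - 1)`. -/
def constrViolation (T : ℕ) (pol : ℕ → Policy S A) : ℝ :=
  (1 / T) * max (∑ t ∈ Finset.range T, (M.b - M.value M.c (pol t))) 0

/-- The sampling error `ε_s`. -/
def epsS (m : ℕ) (δ : ℝ) : ℝ :=
  1 / (1 - M.γ) * √(Real.log (2 * Fintype.card S * Fintype.card A / δ) / (2 * m))

/-- `Ψ = 4 U √(log ((T + 1) U)) + 1`. -/
def Psi (T : ℕ) : ℝ := 4 * M.U * √(Real.log ((T + 1) * M.U)) + 1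

end Run

end CMDP

end

/-! The proof compares the run with `πs` through the Lagrangian. For a fixed dual variable `λ ∈ {0,
U}`, the sum over `t` of `V_r^{π*} - V_r^{π_t} + λ (b - V_c^{π_t})` is at most a primal regret, plus
a dual regret, plus a noise term that is linear in the estimation errors (`lagrangian_gap_le`,
resting on the performance difference lemma `IsFlow.sum_advantage`).

Primal regret: in each state the actions are experts with prior `π₀`, and each action owns a
coin-betting wealth. The wealth is at least `exp (θ² / (3T) - 2)`, where `θ` is the sum of the
truncated advantages (`exp_sq_le_wealth`), while its average under the prior never exceeds `1`. The
Donsker-Varadhan inequality converts these two facts into a regret of order `√(T (1 + KL))`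
(`sum_coin_le_sqrt_klDiv`), and Jensen's inequality averages it over the occupation measure.

Dual regret: `λ₀ - λ_t` is a coin bet with fraction `tanh`, clipped to an interval. Clipping
destroys the multiplicative growth of the wealth, so the wealth is not compared with a Gaussian
potential itself but with that potential continued linearly, with slope the clipping bound, beyond
the point where the bet reaches the bound. This comparison survives every round
(`BetInvariant.step`) and gives the regret against both end points of `[0, U]`
(`clipped_regret_le`).

Noise: `π_t` and `λ_t` are determined by the past, so given the past the noise of iteration `t` is a
centred combination of independent bounded returns, hence sub-Gaussian. A Chernoff bound over the
whole run is made only for `λ = 0` and `λ = U`, so no union over states, actions or iterations is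
needed (`runLaw_noise_ge_le`). For small `T` trivial bounds on the values suffice.

Conclusion: `λ = 0` gives the optimality gap. For the violation take `λ = U`: the achievable pairs
of values form a convex set (`convex_values`), so the averaged run has the values of a single
policy, and a policy violating the constraint by `v` beats `πs` by at most `v / (ζ (1 - γ))`
(`ζ_mul_le`). As `ζ U = 2 / (1 - γ)`, the penalty is twice this gain. -/

noncomputable section

/-! ### Coin betting with an entropy potential -/

/-- `a` times the relative entropy of a coin with bias `θ / a` with respect to a fair coin. -/
def entropyPotential (a θ : ℝ) : ℝ :=
  ((a + θ) * Real.log (a + θ) + (a - θ) * Real.log (a - θ)) / 2 - a * Real.log a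

theorem entropyPotential_neg (a θ : ℝ) : entropyPotential a (-θ) = entropyPotential a θ := by
  unfold entropyPotential
  rw [sub_neg_eq_add, ← sub_eq_add_neg]
  ring

theorem entropyPotential_zero (a : ℝ) : entropyPotential a 0 = 0 := by
  simp [entropyPotential]

theorem two_mul_log_le_sub_inv {u : ℝ} (hu : 1 ≤ u) : 2 * Real.log u ≤ u - u⁻¹ := by
  have h := Real.self_le_sinh_iff.2 (Real.log_nonneg hu)
  rw [Real.sinh_log (by linarith)] at h
  linarith

/-- For `v = (x + 1) / x` the claim reads `log v ≤ (v - v⁻¹) / 2`, a form of `sinh z ≥ z`. -/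
theorem add_one_mul_log_le {x : ℝ} (hx : 0 < x) :
    (x + 1) * (Real.log (x + 1) - Real.log x) ≤ 1 + 1 / (2 * x) := by
  rw [← Real.log_div (by linarith) hx.ne']
  set v := (x + 1) / x with hv
  have hv1 : 1 < v := by rw [hv, lt_div_iff₀ hx]; linarith
  have hu := two_mul_log_le_sub_inv (u := √v) (Real.one_le_sqrt.2 hv1.le)
  rw [Real.log_sqrt (by linarith)] at hu
  have hs : 0 < √v := Real.sqrt_pos.2 (by linarith)
  have hs2 : √v * √v = v := Real.mul_self_sqrt (by linarith)
  have h1 : √v - (√v)⁻¹ ≤ (v - v⁻¹) / 2 := by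
    have key : ∀ u : ℝ, 0 < u →
        (u * u - (u * u)⁻¹) / 2 - (u - u⁻¹) = (u - u⁻¹) * (u - 1) ^ 2 / (2 * u) := by
      intro u hu0
      field_simp
      ring
    have := key _ hs
    rw [hs2] at this
    have h2 : 0 ≤ √v - (√v)⁻¹ := by
      have h3 : 1 ≤ √v := Real.one_le_sqrt.2 hv1.le
      have := inv_le_one_of_one_le₀ h3
      linarith
    have : 0 ≤ (√v - (√v)⁻¹) * (√v - 1) ^ 2 / (2 * √v) := by positivity
    linarith
  have h2 : Real.log v ≤ (v - v⁻¹) / 2 := by linarith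
  calc (x + 1) * Real.log v ≤ (x + 1) * ((v - v⁻¹) / 2) := by gcongr
    _ = 1 + 1 / (2 * x) := by rw [hv]; field_simp; ring

theorem one_le_add_one_mul_log {a : ℝ} (ha : 0 < a) :
    1 ≤ (a + 1) * (Real.log (a + 1) - Real.log a) := by
  rw [← Real.log_div (by linarith) ha.ne']
  have h := Real.one_sub_inv_le_log_of_pos (x := (a + 1) / a) (by positivity)
  have h2 : 1 - ((a + 1) / a)⁻¹ = 1 / (a + 1) := by field_simp; ring
  rw [h2, div_le_iff₀ (by linarith)] at h
  linarith

/-- A won unit leaves `a - θ` unchanged and raises `a + θ` by `2`. With `x = (a + θ) / 2`, the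
increment is `log (1 + θ / a)` plus the difference of the quantities in `add_one_mul_log_le` (at
`x`) and `one_le_add_one_mul_log`; the leading `1`s cancel and `1 / (a + θ)` remains. -/
theorem entropyPotential_add_one_le {a θ : ℝ} (ha : 0 < a) (hθ : |θ| < a) :
    entropyPotential (a + 1) (θ + 1) ≤
      entropyPotential a θ + Real.log (1 + θ / a) + 1 / (a - |θ|) := by
  obtain ⟨h1, h2⟩ := abs_lt.1 hθ
  have hx : 0 < (a + θ) / 2 := by linarith
  have k1 := add_one_mul_log_le hx
  have k2 := one_le_add_one_mul_log ha
  have k3 : 1 / (2 * ((a + θ) / 2)) ≤ 1 / (a - |θ|) :=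
    one_div_le_one_div_of_le (by linarith) (by linarith [neg_abs_le θ])
  have e1 : Real.log ((a + θ) / 2 + 1) = Real.log (a + θ + 2) - Real.log 2 := by
    rw [← Real.log_div (by linarith) (by norm_num)]; congr 1; ring
  have e2 : Real.log ((a + θ) / 2) = Real.log (a + θ) - Real.log 2 :=
    Real.log_div (by linarith) (by norm_num)
  have e3 : Real.log (1 + θ / a) = Real.log (a + θ) - Real.log a := by
    rw [← Real.log_div (by linarith) ha.ne']; congr 1; field_simp
  rw [e1, e2] at k1
  unfold entropyPotential
  rw [e3, show a + 1 + (θ + 1) = a + θ + 2 by ring, show a + 1 - (θ + 1) = a - θ by ring]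
  nlinarith

theorem convexOn_entropyPotential (a : ℝ) :
    ConvexOn ℝ (Set.Icc (-a) a) (entropyPotential a) := by
  have h1 : ConvexOn ℝ (Set.Icc (-a) a) fun θ : ℝ => (a + θ) * Real.log (a + θ) := by
    have := Real.convexOn_mul_log.comp_affineMap (AffineMap.const ℝ ℝ a + AffineMap.id ℝ ℝ)
    exact this.subset (fun θ hθ => by simpa using by linarith [hθ.1]) (convex_Icc _ _)
  have h2 : ConvexOn ℝ (Set.Icc (-a) a) fun θ : ℝ => (a - θ) * Real.log (a - θ) := by
    have := Real.convexOn_mul_log.comp_affineMap (AffineMap.const ℝ ℝ a - AffineMap.id ℝ ℝ)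
    exact this.subset (fun θ hθ => by simpa using by linarith [hθ.2]) (convex_Icc _ _)
  have h3 := ((h1.add h2).smul (c := (1 / 2 : ℝ)) (by norm_num)).add_const (-(a * Real.log a))
  refine h3.congr fun θ _ => ?_
  simp only [entropyPotential, Pi.add_apply, smul_eq_mul]
  ring

theorem exp_le_exp_mul_of_le_add_log {x y z : ℝ} (hz : 0 < z) (h : x ≤ y + Real.log z) :
    Real.exp x ≤ Real.exp y * z := by
  calc Real.exp x ≤ Real.exp (y + Real.log z) := Real.exp_le_exp.2 h
    _ = Real.exp y * z := by rw [Real.exp_add, Real.exp_log hz]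

/-- The left side is convex in `g` and the right side affine, so only `g = 1` and `g = -1` matter,
and these are mirror images. -/
theorem exp_entropyPotential_step {a θ g : ℝ} (ha : 0 < a) (hθ : |θ| < a)
    (hg : g ∈ Set.Icc (-1 : ℝ) 1) :
    Real.exp (entropyPotential (a + 1) (θ + g)) ≤
      Real.exp (entropyPotential a θ + 1 / (a - |θ|)) * (1 + θ / a * g) := by
  obtain ⟨h1, h2⟩ := abs_lt.1 hθ
  have hp : 0 < 1 + θ / a := by
    have : -1 < θ / a := by rw [lt_div_iff₀ ha]; linarith
    linarith
  have hm : 0 < 1 - θ / a := by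
    have : θ / a < 1 := by rw [div_lt_iff₀ ha]; linarith
    linarith
  have hup : Real.exp (entropyPotential (a + 1) (θ + 1)) ≤
      Real.exp (entropyPotential a θ + 1 / (a - |θ|)) * (1 + θ / a) := by
    exact exp_le_exp_mul_of_le_add_log hp (by linarith [entropyPotential_add_one_le ha hθ])
  have hdn : Real.exp (entropyPotential (a + 1) (θ - 1)) ≤
      Real.exp (entropyPotential a θ + 1 / (a - |θ|)) * (1 - θ / a) := by
    have := entropyPotential_add_one_le (θ := -θ) ha (by simpa using hθ)
    rw [entropyPotential_neg, abs_neg, neg_div, ← sub_eq_add_neg,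
      show -θ + 1 = -(θ - 1) by ring, entropyPotential_neg] at this
    exact exp_le_exp_mul_of_le_add_log hm (by linarith)
  have hg1 : 0 ≤ (1 - g) / 2 := by linarith [hg.2]
  have hg2 : 0 ≤ (1 + g) / 2 := by linarith [hg.1]
  have hc : entropyPotential (a + 1) (θ + g) ≤
      (1 - g) / 2 * entropyPotential (a + 1) (θ - 1) +
        (1 + g) / 2 * entropyPotential (a + 1) (θ + 1) := by
    have hx : θ - 1 ∈ Set.Icc (-(a + 1)) (a + 1) := ⟨by linarith, by linarith⟩
    have hy : θ + 1 ∈ Set.Icc (-(a + 1)) (a + 1) := ⟨by linarith, by linarith⟩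
    have := (convexOn_entropyPotential (a + 1)).2 hx hy hg1 hg2 (by ring)
    simp only [smul_eq_mul] at this
    rwa [show (1 - g) / 2 * (θ - 1) + (1 + g) / 2 * (θ + 1) = θ + g by ring] at this
  have he := convexOn_exp.2 (Set.mem_univ (entropyPotential (a + 1) (θ - 1)))
    (Set.mem_univ (entropyPotential (a + 1) (θ + 1)))
    hg1 hg2 (by ring)
  simp only [smul_eq_mul] at he
  calc _ ≤ _ := Real.exp_le_exp.2 hc
    _ ≤ _ := he
    _ ≤ (1 - g) / 2 * (Real.exp (entropyPotential a θ + 1 / (a - |θ|)) * (1 - θ / a)) +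
        (1 + g) / 2 * (Real.exp (entropyPotential a θ + 1 / (a - |θ|)) * (1 + θ / a)) := by
      gcongr
    _ = _ := by ring

theorem mul_log_sub_log_ge {x c : ℝ} (hx : 0 < x) (hc : 0 < c) :
    x - c ≤ x * (Real.log x - Real.log c) := by
  have h := Real.log_le_sub_one_of_pos (div_pos hc hx)
  rw [Real.log_div hc.ne' hx.ne'] at h
  have := mul_le_mul_of_nonneg_left h hx.le
  have e : x * (c / x - 1) = c - x := by field_simp
  nlinarith

/-- A Pinsker inequality for coins: the weights `a ± θ` are compared, by Gibbs' inequality, with the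
tilted weights `a exp (± y) / cosh y` of the same total mass `2 a`, and `cosh y ≤ exp (y² / 2)` at
`y = θ / a`. -/
theorem sq_div_le_entropyPotential {a θ : ℝ} (ha : 0 < a) (hθ : |θ| < a) :
    θ ^ 2 / (2 * a) ≤ entropyPotential a θ := by
  obtain ⟨h1, h2⟩ := abs_lt.1 hθ
  set y := θ / a with hy
  have hθy : θ = a * y := by rw [hy]; field_simp
  have hcosh : 0 < Real.cosh y := Real.cosh_pos y
  have k1 := mul_log_sub_log_ge (x := a + θ) (c := a * Real.exp y / Real.cosh y) (by linarith)
    (by positivity)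
  have k2 := mul_log_sub_log_ge (x := a - θ) (c := a * Real.exp (-y) / Real.cosh y) (by linarith)
    (by positivity)
  rw [Real.log_div (by positivity) hcosh.ne', Real.log_mul ha.ne' (Real.exp_pos _).ne',
    Real.log_exp] at k1 k2
  have hl : Real.log (Real.cosh y) ≤ y ^ 2 / 2 := by
    rw [Real.log_le_iff_le_exp hcosh]
    exact Real.cosh_le_exp_half_sq y
  have hsum : a * Real.exp y / Real.cosh y + a * Real.exp (-y) / Real.cosh y = 2 * a := by
    rw [← add_div, ← mul_add, div_eq_iff hcosh.ne', Real.cosh_eq]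
    ring
  have e : θ ^ 2 / (2 * a) = a * y ^ 2 / 2 := by rw [hθy]; field_simp
  rw [e]
  unfold entropyPotential
  have := mul_le_mul_of_nonneg_left hl ha.le
  have e2 : θ * y = a * y ^ 2 := by rw [hθy]; ring
  nlinarith

theorem abs_sum_range_le {c : ℕ → ℝ} {n : ℕ} (hc : ∀ i < n, |c i| ≤ 1) :
    |∑ i ∈ Finset.range n, c i| ≤ n := by
  calc _ ≤ ∑ i ∈ Finset.range n, |c i| := Finset.abs_sum_le_sum_abs _ _
    _ ≤ ∑ _i ∈ Finset.range n, (1 : ℝ) :=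
      Finset.sum_le_sum fun i hi => hc i (Finset.mem_range.1 hi)
    _ = n := by simp

/-- The wealth of the shifted Krichevsky-Trofimov bettor. -/
theorem exp_entropyPotential_le_wealth {c w : ℕ → ℝ} {N : ℕ} (hN : 0 < N)
    (hc : ∀ i < N, |c i| ≤ 1)
    (hw : ∀ n < N, w n = (∑ i ∈ Finset.range n, c i) / (n + N / 2 : ℝ) *
      (1 + ∑ i ∈ Finset.range n, c i * w i)) (n : ℕ) (hn : n ≤ N) :
    Real.exp (entropyPotential (n + N / 2) (∑ i ∈ Finset.range n, c i) - 2 * n / N) ≤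
      1 + ∑ i ∈ Finset.range n, c i * w i := by
  have hN' : (0 : ℝ) < N := by exact_mod_cast hN
  induction n with
  | zero => simp [entropyPotential_zero]
  | succ n ih =>
    have ih := ih (by omega)
    set θ := ∑ i ∈ Finset.range n, c i with hθ
    set W := 1 + ∑ i ∈ Finset.range n, c i * w i with hW
    have habs : |θ| ≤ n := abs_sum_range_le fun i hi => hc i (by omega)
    have ha : (0 : ℝ) < n + N / 2 := by positivity
    have hg := abs_le.1 (hc n (by omega))
    have hstep := exp_entropyPotential_step ha (by linarith : |θ| < n + N / 2) (g := c n) hg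
    -- The shift `N / 2` keeps `|θ|` away from the scale: every round loses at most a factor `exp
    -- (-2 / N)`, hence all `N` rounds at most `exp (-2)`.
    have hd : 1 / ((n + N / 2 : ℝ) - |θ|) ≤ 2 / N := by
      rw [div_le_div_iff₀ (by linarith) hN']
      linarith
    have hpos : 0 ≤ 1 + θ / (n + N / 2 : ℝ) * c n := by
      have h1 : |θ / (n + N / 2 : ℝ)| ≤ 1 := by
        rw [abs_div, abs_of_pos ha, div_le_one ha]
        linarith
      have h2 : |θ / (n + N / 2 : ℝ) * c n| ≤ 1 := by
        rw [abs_mul]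
        exact mul_le_one₀ h1 (abs_nonneg _) (hc n (by omega))
      linarith [(abs_le.1 h2).1]
    rw [Finset.sum_range_succ, Finset.sum_range_succ, ← hθ, ← add_assoc, ← hW, hw n (by omega),
      ← hθ, ← hW]
    push_cast
    calc Real.exp (entropyPotential (n + 1 + N / 2) (θ + c n) - 2 * (n + 1) / N)
        = Real.exp (entropyPotential (n + N / 2 + 1) (θ + c n)) *
            Real.exp (-(2 * (n + 1) / N)) := by
          rw [← Real.exp_add]; congr 1; ring_nf
      _ ≤ Real.exp (entropyPotential (n + N / 2) θ + 2 / N) * (1 + θ / (n + N / 2) * c n) *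
            Real.exp (-(2 * (n + 1) / N)) := by
          refine mul_le_mul_of_nonneg_right (hstep.trans ?_) (Real.exp_pos _).le
          exact mul_le_mul_of_nonneg_right (Real.exp_le_exp.2 (by linarith)) hpos
      _ = Real.exp (entropyPotential (n + N / 2) θ - 2 * n / N) *
            (1 + θ / (n + N / 2) * c n) := by
          rw [mul_right_comm, ← Real.exp_add]
          congr 2
          field_simp
          ring
      _ ≤ W * (1 + θ / (n + N / 2) * c n) := mul_le_mul_of_nonneg_right ih hpos
      _ = W + c n * (θ / (n + N / 2) * W) := by ring

/-- At the end the scale is `N + N / 2`, and twice this is the denominator `3 N`. -/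
theorem exp_sq_le_wealth {c w : ℕ → ℝ} {N : ℕ} (hN : 0 < N) (hc : ∀ i < N, |c i| ≤ 1)
    (hw : ∀ n < N, w n = (∑ i ∈ Finset.range n, c i) / (n + N / 2 : ℝ) *
      (1 + ∑ i ∈ Finset.range n, c i * w i)) :
    Real.exp ((∑ i ∈ Finset.range N, c i) ^ 2 / (3 * N) - 2) ≤
      1 + ∑ i ∈ Finset.range N, c i * w i := by
  have hN' : (0 : ℝ) < N := by exact_mod_cast hN
  refine le_trans (Real.exp_le_exp.2 ?_) (exp_entropyPotential_le_wealth hN hc hw N le_rfl)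
  have habs := abs_sum_range_le hc
  have := sq_div_le_entropyPotential (a := N + N / 2) (by positivity)
    (lt_of_le_of_lt habs (by linarith))
  rw [mul_div_assoc, div_self hN'.ne', show 3 * (N : ℝ) = 2 * (N + N / 2) by ring]
  linarith

/-! ### The variational bound for the relative entropy on finite types -/

section Simplex

variable {X : Type*} [Fintype X] [MeasurableSpace X] [DiscreteMeasurableSpace X]

instance (p : stdSimplex ℝ X) : IsProbabilityMeasure (simplexMeasure p) := by
  constructor
  simp [simplexMeasure, simplex_sum_ofReal]

theorem integral_simplexMeasure (p : stdSimplex ℝ X) (f : X → ℝ) :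
    ∫ x, f x ∂simplexMeasure p = ∑ x, p x * f x := by
  unfold simplexMeasure
  rw [integral_finsetSum_measure]
  · refine Finset.sum_congr rfl fun x _ => ?_
    rw [integral_smul_measure, integral_dirac, ENNReal.toReal_ofReal (stdSimplex.zero_le p x),
      smul_eq_mul]
  · intro x _
    exact Integrable.smul_measure (integrable_dirac (by simp)) (by simp)

/-- Donsker-Varadhan: the gap between the two sides is the relative entropy of `p` with respect to
`q` tilted by `f`, which is nonnegative. -/
theorem sum_mul_le_klDiv_add_log (p q : stdSimplex ℝ X)
    (h : InformationTheory.klDiv (simplexMeasure p) (simplexMeasure q) ≠ ∞) (f : X → ℝ) :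
    ∑ x, p x * f x ≤ (InformationTheory.klDiv (simplexMeasure p) (simplexMeasure q)).toReal +
      Real.log (∑ x, q x * Real.exp (f x)) := by
  obtain ⟨hac, hint⟩ := InformationTheory.klDiv_ne_top_iff.1 h
  have hf : ∀ (r : stdSimplex ℝ X) (g : X → ℝ), Integrable g (simplexMeasure r) :=
    fun _ _ => Integrable.of_finite
  have h1 := integral_llr_tilted_right hac (hf p f) (hf q _) hint
  rw [InformationTheory.toReal_klDiv_of_measure_eq hac (by simp)]
  rw [integral_simplexMeasure q, integral_simplexMeasure p f] at h1
  have : IsProbabilityMeasure ((simplexMeasure q).tilted f) := isProbabilityMeasure_tilted (hf q _)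
  have h2 := InformationTheory.integral_llr_add_sub_measure_univ_nonneg
    (μ := simplexMeasure p) (ν := (simplexMeasure q).tilted f)
    (hac.trans (absolutelyContinuous_tilted (hf q _)))
    (integrable_llr_tilted_right hac (hf p f) hint (hf q _))
  simp only [probReal_univ] at h2
  linarith

/-- The regret of coin betting with prior `q` against `p`. -/
theorem sum_coin_le_sqrt_klDiv (p q : stdSimplex ℝ X)
    (h : InformationTheory.klDiv (simplexMeasure p) (simplexMeasure q) ≠ ∞)
    {c w : ℕ → X → ℝ} {N : ℕ} (hN : 0 < N) (hc : ∀ i < N, ∀ x, |c i x| ≤ 1)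
    (hw : ∀ n < N, ∀ x, w n x = (∑ i ∈ Finset.range n, c i x) / (n + N / 2 : ℝ) *
      (1 + ∑ i ∈ Finset.range n, c i x * w i x))
    (hq : ∀ i < N, ∑ x, q x * (c i x * w i x) ≤ 0) :
    ∑ x, p x * ∑ i ∈ Finset.range N, c i x ≤
      3 * √N * √(1 + (InformationTheory.klDiv (simplexMeasure p) (simplexMeasure q)).toReal) := by
  have hN' : (0 : ℝ) < N := by exact_mod_cast hN
  set K := (InformationTheory.klDiv (simplexMeasure p) (simplexMeasure q)).toReal with hK
  have hK0 : 0 ≤ K := ENNReal.toReal_nonneg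
  set θ : X → ℝ := fun x => ∑ i ∈ Finset.range N, c i x with hθ
  have hp1 : ∑ x, p x = 1 := stdSimplex.sum_eq_one p
  have h1 := sum_mul_le_klDiv_add_log p q h fun x => θ x ^ 2 / (3 * N) - 2
  -- The exponential is a lower bound for the wealth, and by `hq` the wealth averaged under the
  -- prior never rises above its initial value `1`.
  have h2 : ∑ x, q x * Real.exp (θ x ^ 2 / (3 * N) - 2) ≤ 1 := by
    calc _ ≤ ∑ x, q x * (1 + ∑ i ∈ Finset.range N, c i x * w i x) :=
          Finset.sum_le_sum fun x _ => mul_le_mul_of_nonneg_left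
            (exp_sq_le_wealth hN (fun i hi => hc i hi x) (fun n hn => hw n hn x))
            (stdSimplex.zero_le q x)
      _ = 1 + ∑ i ∈ Finset.range N, ∑ x, q x * (c i x * w i x) := by
          rw [Finset.sum_comm]
          simp only [mul_add, mul_one, Finset.sum_add_distrib, Finset.mul_sum,
            stdSimplex.sum_eq_one]
      _ ≤ 1 := by
          linarith [Finset.sum_nonpos fun i hi => hq i (Finset.mem_range.1 hi)]
  have h3 : Real.log (∑ x, q x * Real.exp (θ x ^ 2 / (3 * N) - 2)) ≤ 0 :=
    Real.log_nonpos (Finset.sum_nonneg fun x _ => mul_nonneg (stdSimplex.zero_le q x)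
      (Real.exp_pos _).le) h2
  have h4 : ∑ x, p x * (θ x ^ 2 / (3 * N) - 2) = (∑ x, p x * θ x ^ 2) / (3 * N) - 2 := by
    simp only [mul_sub, Finset.sum_sub_distrib, ← Finset.sum_mul, hp1, Finset.sum_div,
      mul_div_assoc, one_mul]
  have h5 : (∑ x, p x * θ x) ^ 2 ≤ ∑ x, p x * θ x ^ 2 := by
    have := (even_two.convexOn_pow (𝕜 := ℝ)).map_sum_le (t := Finset.univ) (w := fun x => p x)
      (p := θ) (fun x _ => stdSimplex.zero_le p x) hp1 (fun _ _ => Set.mem_univ _)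
    simpa using this
  rw [← Real.sqrt_sq (by norm_num : (0 : ℝ) ≤ 3), ← Real.sqrt_mul (by positivity),
    ← Real.sqrt_mul (by positivity)]
  refine Real.le_sqrt_of_sq_le ?_
  -- With Jensen's inequality `h5` the squared regret is at most `3 N (K + 2) ≤ 9 N (1 + K)`, the
  -- source of the factor `3`.
  have h6 : (∑ x, p x * θ x ^ 2) / (3 * N) ≤ K + 2 := by linarith
  rw [div_le_iff₀ (by positivity)] at h6
  nlinarith

end Simplex

/-! ### Coin betting with clipped bets -/

/-- The betting fraction `2σ(2y) - 1`. -/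
def sigmoidBet (y : ℝ) : ℝ := 2 * Real.sigmoid (2 * y) - 1

/-- The right side is `tanh y`; the bounds that follow are bounds on `tanh`. -/
theorem sigmoidBet_eq (y : ℝ) :
    sigmoidBet y = (Real.exp (2 * y) - 1) / (Real.exp (2 * y) + 1) := by
  have h : Real.exp (-(2 * y)) = (Real.exp (2 * y))⁻¹ := Real.exp_neg _
  have := Real.exp_pos (2 * y)
  rw [sigmoidBet, Real.sigmoid_def, h]
  field_simp
  ring

theorem sigmoidBet_neg (y : ℝ) : sigmoidBet (-y) = -sigmoidBet y := by
  rw [sigmoidBet, sigmoidBet, mul_neg, Real.sigmoid_neg]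
  ring

theorem sigmoidBet_zero : sigmoidBet 0 = 0 := by
  simp [sigmoidBet_eq]

theorem sigmoidBet_strictMono : StrictMono sigmoidBet := fun x y h => by
  have := Real.sigmoid_strictMono (by linarith : 2 * x < 2 * y)
  unfold sigmoidBet
  linarith

theorem continuous_sigmoidBet : Continuous sigmoidBet := by
  unfold sigmoidBet
  fun_prop

theorem sigmoidBet_lt_one (y : ℝ) : sigmoidBet y < 1 := by
  unfold sigmoidBet
  linarith [Real.sigmoid_lt_one (2 * y)]

theorem sigmoidBet_nonneg {y : ℝ} (hy : 0 ≤ y) : 0 ≤ sigmoidBet y := by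
  rw [← sigmoidBet_zero]
  exact sigmoidBet_strictMono.monotone hy

theorem sigmoidBet_le_self {y : ℝ} (hy : 0 ≤ y) : sigmoidBet y ≤ y := by
  have h1 : 1 ≤ Real.exp (2 * y) := Real.one_le_exp (by linarith)
  have h := Real.le_log_one_add_of_nonneg (x := Real.exp (2 * y) - 1) (by linarith)
  rw [add_sub_cancel, Real.log_exp] at h
  rw [sigmoidBet_eq]
  have e : 2 * (Real.exp (2 * y) - 1) / (Real.exp (2 * y) - 1 + 2) =
      2 * ((Real.exp (2 * y) - 1) / (Real.exp (2 * y) + 1)) := by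
    rw [show Real.exp (2 * y) - 1 + 2 = Real.exp (2 * y) + 1 by ring, mul_div_assoc]
  linarith

/-- `1 + tanh y = exp y / cosh y` and `cosh y ≤ exp (y² / 2)`. -/
theorem exp_le_one_add_sigmoidBet (y : ℝ) : Real.exp (y - y ^ 2 / 2) ≤ 1 + sigmoidBet y := by
  have h := Real.cosh_le_exp_half_sq y
  rw [Real.cosh_eq] at h
  have e : 1 + sigmoidBet y = Real.exp y / ((Real.exp y + Real.exp (-y)) / 2) := by
    rw [sigmoidBet_eq, two_mul, Real.exp_add, Real.exp_neg]
    have := Real.exp_pos y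
    field_simp
    ring
  rw [e, Real.exp_sub]
  have := Real.exp_pos y
  have := Real.exp_pos (-y)
  gcongr

/-- The constant must lie between `exp (1 / 2) - 1 ≈ 0.649`, needed in `exp_half_sub_one_le`, and
`tanh 1 ≈ 0.762`. The value `11 / 16 = 1 / 2 + 3 / 16` is what the second-order bound on `exp`
yields there. -/
theorem mul_le_sigmoidBet {y : ℝ} (h0 : 0 ≤ y) (h1 : y ≤ 1) : 11 / 16 * y ≤ sigmoidBet y := by
  have h := Real.sum_le_exp_of_nonneg (by linarith : 0 ≤ 2 * y) 4
  simp only [Finset.sum_range_succ, Finset.sum_range_zero, Nat.factorial] at h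
  norm_num at h
  have := Real.exp_pos (2 * y)
  rw [sigmoidBet_eq, le_div_iff₀ (by linarith)]
  have hp : 0 ≤ 1 - 11 / 16 * y := by linarith
  have := mul_le_mul_of_nonneg_left h hp
  have h3 : 0 ≤ y * ((1 - y) * (1 + y + y ^ 2)) := by
    have : 0 ≤ 1 - y := by linarith
    positivity
  have h4 : 0 ≤ y * (1 - y) := mul_nonneg h0 (by linarith)
  have h5 : 0 ≤ y ^ 2 * (1 - y) := mul_nonneg (by positivity) (by linarith)
  nlinarith

theorem exp_half_sub_one_le {z : ℝ} (h0 : 0 ≤ z) (h1 : z ≤ 1) :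
    Real.exp (z / 2) ≤ 1 + 11 / 16 * z := by
  have h := Real.exp_bound' (by linarith : 0 ≤ z / 2) (by linarith) (n := 2) (by norm_num)
  simp only [Finset.sum_range_succ, Finset.sum_range_zero, Nat.factorial] at h
  norm_num at h
  nlinarith

/-- The potential that bounds the wealth from below while no bet is clipped. -/
def gaussPotential (θ a : ℝ) : ℝ := Real.exp (θ ^ 2 / (2 * a) - 2 * Real.log a)

theorem gaussPotential_pos (θ a : ℝ) : 0 < gaussPotential θ a := Real.exp_pos _

theorem gaussPotential_neg (θ a : ℝ) : gaussPotential (-θ) a = gaussPotential θ a := by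
  simp [gaussPotential]

theorem gaussPotential_anti {θ a a' : ℝ} (ha : 0 < a) (h : a ≤ a') :
    gaussPotential θ a' ≤ gaussPotential θ a := by
  unfold gaussPotential
  refine Real.exp_le_exp.2 (sub_le_sub ?_ ?_)
  · gcongr
  · gcongr

theorem continuous_gaussPotential (a : ℝ) : Continuous fun θ => gaussPotential θ a := by
  unfold gaussPotential
  fun_prop

theorem gaussPotential_tangent {θ θ' a : ℝ} (ha : 0 < a) :
    gaussPotential θ' a + θ' / a * gaussPotential θ' a * (θ - θ') ≤ gaussPotential θ a := by
  have e : gaussPotential θ a =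
      gaussPotential θ' a * Real.exp ((θ ^ 2 - θ' ^ 2) / (2 * a)) := by
    unfold gaussPotential
    rw [← Real.exp_add]
    congr 1
    ring
  have h1 : θ' / a * (θ - θ') ≤ (θ ^ 2 - θ' ^ 2) / (2 * a) := by
    have : (θ ^ 2 - θ' ^ 2) / (2 * a) - θ' / a * (θ - θ') = (θ - θ') ^ 2 / (2 * a) := by
      field_simp
      ring
    have : 0 ≤ (θ - θ') ^ 2 / (2 * a) := by positivity
    linarith
  have h2 := Real.add_one_le_exp ((θ ^ 2 - θ' ^ 2) / (2 * a))
  rw [e]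
  have := mul_le_mul_of_nonneg_left (h1.trans (by linarith : _ ≤
    Real.exp ((θ ^ 2 - θ' ^ 2) / (2 * a)) - 1)) (gaussPotential_pos θ' a).le
  linarith

/-- With `y = θ / a`, the quadratic exponent grows by `y - y² / 2` plus `(1 - y)² / (2 (a + 1)) ≤ 2
/ (a + 1)`. The first part is covered by `1 + tanh y`, the second by the growth of `2 log a`; this
is why the potential carries the factor `a⁻²`. -/
theorem gaussPotential_add_one_le {θ a : ℝ} (ha : 0 < a) (hθ : |θ| ≤ a) :
    gaussPotential (θ + 1) (a + 1) ≤ gaussPotential θ a * (1 + sigmoidBet (θ / a)) := by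
  refine le_trans ?_ (mul_le_mul_of_nonneg_left (exp_le_one_add_sigmoidBet _)
    (gaussPotential_pos θ a).le)
  unfold gaussPotential
  rw [← Real.exp_add]
  refine Real.exp_le_exp.2 ?_
  have h1 := one_le_add_one_mul_log ha
  have h2 : 1 / (a + 1) ≤ Real.log (a + 1) - Real.log a := by
    rw [div_le_iff₀ (by linarith)]
    linarith
  have h3 : (θ + 1) ^ 2 / (2 * (a + 1)) - θ ^ 2 / (2 * a) - (θ / a - (θ / a) ^ 2 / 2) =
      (1 - θ / a) ^ 2 / (2 * (a + 1)) := by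
    field_simp
    ring
  have h4 : |θ / a| ≤ 1 := by rwa [abs_div, abs_of_pos ha, div_le_one ha]
  obtain ⟨h5, h6⟩ := abs_le.1 h4
  have h7 : (1 - θ / a) ^ 2 / (2 * (a + 1)) ≤ 2 * (1 / (a + 1)) := by
    have h8 : (1 - θ / a) ^ 2 ≤ 4 := by nlinarith
    rw [mul_one_div, div_le_div_iff₀ (by linarith) (by linarith)]
    nlinarith
  linarith

/-- Along `(θ + g, a + g)` the exponent is convex in `g`, being a square over a linear function
minus a logarithm. The case `0 ≤ g ≤ 1` thus interpolates between `g = 0` and `g = 1`. -/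
theorem gaussPotential_step_of_nonneg {θ a g : ℝ} (ha : 0 < a) (hθ : |θ| ≤ a) (h0 : 0 ≤ g)
    (h1 : g ≤ 1) :
    gaussPotential (θ + g) (a + g) ≤ gaussPotential θ a * (1 + sigmoidBet (θ / a) * g) := by
  have hlog : (1 - g) * Real.log a + g * Real.log (a + 1) ≤ Real.log (a + g) := by
    have := strictConcaveOn_log_Ioi.concaveOn.2 (Set.mem_Ioi.2 ha)
      (Set.mem_Ioi.2 (by linarith : 0 < a + 1)) (sub_nonneg.2 h1) h0 (by ring)
    simp only [smul_eq_mul] at this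
    rwa [show (1 - g) * a + g * (a + 1) = a + g by ring] at this
  have hq : (θ + g) ^ 2 / (2 * (a + g)) ≤
      (1 - g) * (θ ^ 2 / (2 * a)) + g * ((θ + 1) ^ 2 / (2 * (a + 1))) := by
    have e : (1 - g) * (θ ^ 2 / (2 * a)) + g * ((θ + 1) ^ 2 / (2 * (a + 1))) -
        (θ + g) ^ 2 / (2 * (a + g)) =
        g * (1 - g) * (θ - a) ^ 2 / (2 * a * (a + 1) * (a + g)) := by
      field_simp
      ring
    have : 0 ≤ g * (1 - g) * (θ - a) ^ 2 / (2 * a * (a + 1) * (a + g)) := by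
      have : 0 ≤ 1 - g := by linarith
      positivity
    linarith
  have hexp := convexOn_exp.2 (Set.mem_univ (θ ^ 2 / (2 * a) - 2 * Real.log a))
    (Set.mem_univ ((θ + 1) ^ 2 / (2 * (a + 1)) - 2 * Real.log (a + 1)))
    (sub_nonneg.2 h1) h0 (by ring)
  simp only [smul_eq_mul] at hexp
  calc gaussPotential (θ + g) (a + g) ≤ _ := Real.exp_le_exp.2 (by linarith)
    _ ≤ (1 - g) * gaussPotential θ a + g * gaussPotential (θ + 1) (a + 1) := hexp
    _ ≤ (1 - g) * gaussPotential θ a +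
        g * (gaussPotential θ a * (1 + sigmoidBet (θ / a))) := by
      gcongr
      exact gaussPotential_add_one_le ha hθ
    _ = _ := by ring

theorem gaussPotential_step {θ a g : ℝ} (ha : 0 < a) (hθ : |θ| ≤ a) (hg : |g| ≤ 1) :
    gaussPotential (θ + g) (a + |g|) ≤ gaussPotential θ a * (1 + sigmoidBet (θ / a) * g) := by
  rcases le_total 0 g with h | h
  · rw [abs_of_nonneg h] at hg ⊢
    exact gaussPotential_step_of_nonneg ha hθ h hg
  · rw [abs_of_nonpos h] at hg ⊢
    have := gaussPotential_step_of_nonneg (θ := -θ) ha (by rwa [abs_neg]) (neg_nonneg.2 h) hg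
    rw [← neg_add, gaussPotential_neg, gaussPotential_neg, neg_div, sigmoidBet_neg,
      neg_mul_neg] at this
    exact this

/-- When the scale grows, a point of clipping moves up at a cost that the clipped bet covers. -/
theorem gaussPotential_le_of_bet_le {θ θ' a a' : ℝ} (h0 : 0 ≤ θ') (hθ : θ' ≤ θ) (ha : 0 < a)
    (haa : a ≤ a') (haa' : a' ≤ a + 1) (hθa : θ' ≤ a)
    (h : sigmoidBet (θ / a') * gaussPotential θ a' ≤ sigmoidBet (θ' / a) * gaussPotential θ' a) :
    gaussPotential θ a' ≤
      gaussPotential θ' a + sigmoidBet (θ' / a) * gaussPotential θ' a * (θ - θ') := by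
  have ha' : 0 < a' := ha.trans_le haa
  rcases h0.eq_or_lt with rfl | h0
  · rw [zero_div, sigmoidBet_zero, zero_mul] at h
    have h1 : sigmoidBet (θ / a') ≤ sigmoidBet 0 := by
      rw [sigmoidBet_zero]
      exact nonpos_of_mul_nonpos_left h (gaussPotential_pos _ _)
    have h2 := sigmoidBet_strictMono.le_iff_le.1 h1
    have h3 : θ = 0 := by
      refine le_antisymm ?_ hθ
      rwa [div_le_iff₀ ha', zero_mul] at h2
    subst h3
    simpa using gaussPotential_anti ha haa
  set y := θ' / a with hy
  have hy0 : 0 < y := div_pos h0 ha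
  have hy1 : y ≤ 1 := (div_le_one ha).2 hθa
  have hb : 0 < sigmoidBet y := by
    rw [← sigmoidBet_zero]
    exact sigmoidBet_strictMono hy0
  have hE := gaussPotential_pos θ' a
  -- If the betting fraction did not fall, the hypothesis on the bets forces the potential itself
  -- not to grow. If it fell, then `θ - θ' ≤ y ≤ 1`, the exponent grows by at most `y (θ - θ') / 2`,
  -- and the two bounds with `11 / 16` compare this growth with the linear gain.
  rcases le_or_gt y (θ / a') with hc | hc
  · have h1 := sigmoidBet_strictMono.monotone hc
    have h2 : gaussPotential θ a' ≤ gaussPotential θ' a := by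
      refine le_of_mul_le_mul_left ?_ hb
      exact (mul_le_mul_of_nonneg_right h1 (gaussPotential_pos _ _).le).trans h
    have : 0 ≤ sigmoidBet y * gaussPotential θ' a * (θ - θ') :=
      mul_nonneg (by positivity) (by linarith)
    linarith
  · have hδ : θ - θ' ≤ y := by
      rw [hy, div_lt_div_iff₀ ha' ha] at hc
      rw [hy, le_div_iff₀ ha]
      nlinarith
    have hz0 : 0 ≤ y * (θ - θ') := mul_nonneg hy0.le (by linarith)
    have hz1 : y * (θ - θ') ≤ 1 := by nlinarith
    have h1 : θ ^ 2 / (2 * a') - 2 * Real.log a' ≤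
        θ' ^ 2 / (2 * a) - 2 * Real.log a + y * (θ - θ') / 2 := by
      have hl := Real.log_le_log ha haa
      have hm := mul_le_mul_of_nonneg_left hc.le (by linarith : 0 ≤ θ)
      have e1 : θ ^ 2 / (2 * a') = θ * (θ / a') / 2 := by field_simp
      have e2 : θ' ^ 2 / (2 * a) = θ' * y / 2 := by rw [hy]; field_simp
      rw [e1, e2]
      nlinarith
    calc gaussPotential θ a' ≤ gaussPotential θ' a * Real.exp (y * (θ - θ') / 2) := by
          unfold gaussPotential
          rw [← Real.exp_add]
          exact Real.exp_le_exp.2 h1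
      _ ≤ gaussPotential θ' a * (1 + 11 / 16 * (y * (θ - θ'))) := by
          gcongr
          exact exp_half_sub_one_le hz0 hz1
      _ = gaussPotential θ' a + 11 / 16 * y * gaussPotential θ' a * (θ - θ') := by ring
      _ ≤ _ := by
          have := mul_le_sigmoidBet hy0.le hy1
          have h3 : 0 ≤ θ - θ' := by linarith
          gcongr

/-- The wealth `W` dominates the potential up to a point where the bet reaches the bound `u`, and
its continuation with slope `u` from there on. -/
def BetInvariant (u θ a W : ℝ) : Prop :=
  ∃ θ', 0 ≤ θ' ∧ θ' ≤ θ ∧ gaussPotential θ' a + u * (θ - θ') ≤ W ∧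
    sigmoidBet (θ' / a) * gaussPotential θ' a ≤ u ∧
    (θ' = θ ∨ sigmoidBet (θ' / a) * gaussPotential θ' a = u)

theorem exists_bet_eq {u θ₁ θ₂ a : ℝ} (h : θ₁ ≤ θ₂)
    (h1 : sigmoidBet (θ₁ / a) * gaussPotential θ₁ a ≤ u)
    (h2 : u ≤ sigmoidBet (θ₂ / a) * gaussPotential θ₂ a) :
    ∃ θ ∈ Set.Icc θ₁ θ₂, sigmoidBet (θ / a) * gaussPotential θ a = u := by
  have hc : Continuous fun θ => sigmoidBet (θ / a) * gaussPotential θ a :=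
    (continuous_sigmoidBet.comp (continuous_id.div_const a)).mul (continuous_gaussPotential a)
  exact intermediate_value_Icc h hc.continuousOn ⟨h1, h2⟩

/-- The continuation with slope `u` lies below the potential: at the clipping point the potential
has slope `θ' / a` times its value, which is at least `tanh (θ' / a)` times its value, that is `u`.
A bound by the potential therefore (re)starts the invariant. -/
theorem BetInvariant.of_gaussPotential_le {u θ a W : ℝ} (hθ : 0 ≤ θ) (hu : 0 ≤ u) (ha : 0 < a)
    (h : gaussPotential θ a ≤ W) : BetInvariant u θ a W := by
  rcases le_total (sigmoidBet (θ / a) * gaussPotential θ a) u with h1 | h1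
  · exact ⟨θ, hθ, le_rfl, by linarith, h1, Or.inl rfl⟩
  · obtain ⟨θ', ⟨h2, h3⟩, h4⟩ := exists_bet_eq hθ (by simpa [sigmoidBet_zero] using hu) h1
    refine ⟨θ', h2, h3, ?_, h4.le, Or.inr h4⟩
    have h5 := gaussPotential_tangent (θ := θ) (θ' := θ') ha
    have h6 := sigmoidBet_le_self (div_nonneg h2 ha.le)
    have h7 : u * (θ - θ') ≤ θ' / a * gaussPotential θ' a * (θ - θ') := by
      rw [← h4]
      have := gaussPotential_pos θ' a
      have : 0 ≤ θ - θ' := by linarith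
      gcongr
    linarith

theorem BetInvariant.pos {u θ a W : ℝ} (hu : 0 ≤ u) (h : BetInvariant u θ a W) : 0 < W := by
  obtain ⟨θ', -, h1, h2, -⟩ := h
  have := mul_nonneg hu (sub_nonneg.2 h1)
  linarith [gaussPotential_pos θ' a]

/-- The first alternative is the stronger bound by the potential itself; it also covers steps across
zero, where the clipping bound of the other side takes over. -/
theorem BetInvariant.step {u θ a W g : ℝ} (hu : 0 ≤ u) (ha : 0 < a) (hθa : θ ≤ a)
    (h : BetInvariant u θ a W) (hg : |g| ≤ 1) :
    gaussPotential (θ + g) (a + |g|) ≤ W + min u (sigmoidBet (θ / a) * W) * g ∨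
      (0 ≤ θ + g ∧
        BetInvariant u (θ + g) (a + |g|) (W + min u (sigmoidBet (θ / a) * W) * g)) := by
  have hW := h.pos hu
  obtain ⟨hg1, hg2⟩ := abs_le.1 hg
  obtain ⟨θ', h0, hle, hWE, hbu, rfl | heq⟩ := h
  · left
    have hstep := gaussPotential_step ha (by rwa [abs_of_nonneg h0]) hg
    refine hstep.trans ?_
    set b := sigmoidBet (θ' / a)
    have hb0 : 0 ≤ b := sigmoidBet_nonneg (div_nonneg h0 ha.le)
    have hb1 : b < 1 := sigmoidBet_lt_one _
    rw [sub_self, mul_zero, add_zero] at hWE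
    -- When the bet is cut down to `u`, a win still pays at least `b` times the potential, by `hbu`,
    -- and a loss costs less than the unclipped bet would.
    rcases le_total u (b * W) with hm | hm
    · rw [min_eq_left hm]
      rcases le_total 0 g with hg0 | hg0
      · nlinarith
      · have h1 : u * (-g) ≤ b * W * (-g) := mul_le_mul_of_nonneg_right hm (by linarith)
        have h2 : gaussPotential θ' a * (1 + b * g) ≤ W * (1 + b * g) :=
          mul_le_mul_of_nonneg_right hWE (by nlinarith)
        nlinarith
    · rw [min_eq_right hm]
      have h2 : gaussPotential θ' a * (1 + b * g) ≤ W * (1 + b * g) :=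
        mul_le_mul_of_nonneg_right hWE (by nlinarith)
      linarith
  · have hbb : sigmoidBet (θ' / a) ≤ sigmoidBet (θ / a) :=
      sigmoidBet_strictMono.monotone (by gcongr)
    have hb0 : 0 ≤ sigmoidBet (θ' / a) := sigmoidBet_nonneg (div_nonneg h0 ha.le)
    have hEW : gaussPotential θ' a ≤ W := by
      have := mul_nonneg hu (sub_nonneg.2 hle)
      linarith
    have hm : u ≤ sigmoidBet (θ / a) * W := by
      rw [← heq]
      exact mul_le_mul hbb hEW (gaussPotential_pos _ _).le (hb0.trans hbb)
    rw [min_eq_left hm]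
    have haa : a ≤ a + |g| := by linarith [abs_nonneg g]
    have ha' : 0 < a + |g| := by linarith
    -- Beyond `θ'` the wealth moves along the line of slope `u`. Falling below `θ'` is a step of
    -- size at most `|g|` that starts at `θ'`, where the bet on the potential is exactly `u`.
    -- Otherwise the clipping point is recomputed for the larger scale and can only move up.
    rcases le_total (θ + g) θ' with hc | hc
    · left
      have hg' : |θ + g - θ'| ≤ |g| := by
        rw [abs_of_nonpos (by linarith), abs_of_nonpos (by linarith)]
        linarith
      have h1 := gaussPotential_step ha (by rw [abs_of_nonneg h0]; linarith : |θ'| ≤ a)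
        (hg'.trans hg)
      rw [add_sub_cancel] at h1
      have h2 : gaussPotential (θ + g) (a + |g|) ≤ gaussPotential (θ + g) (a + |θ + g - θ'|) :=
        gaussPotential_anti (by linarith [abs_nonneg (θ + g - θ')]) (by linarith)
      have h3 : gaussPotential θ' a * (1 + sigmoidBet (θ' / a) * (θ + g - θ')) =
          gaussPotential θ' a + u * (θ + g - θ') := by
        rw [← heq]
        ring
      linarith
    · right
      refine ⟨h0.trans hc, ?_⟩
      rcases le_total (sigmoidBet ((θ + g) / (a + |g|)) * gaussPotential (θ + g) (a + |g|)) u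
        with h1 | h1
      · refine ⟨θ + g, h0.trans hc, le_rfl, ?_, h1, Or.inl rfl⟩
        have h2 := gaussPotential_le_of_bet_le h0 hc ha haa (by linarith) (by linarith)
          (h1.trans_eq heq.symm)
        rw [heq] at h2
        linarith
      · have h2 : sigmoidBet (θ' / (a + |g|)) * gaussPotential θ' (a + |g|) ≤ u := by
          rw [← heq]
          refine mul_le_mul (sigmoidBet_strictMono.monotone (by gcongr))
            (gaussPotential_anti ha haa) (gaussPotential_pos _ _).le hb0
        obtain ⟨θ'', ⟨h3, h4⟩, h5⟩ := exists_bet_eq hc h2 h1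
        refine ⟨θ'', h0.trans h3, h4, ?_, h5.le, Or.inr h5⟩
        have h6 := gaussPotential_le_of_bet_le h0 h3 ha haa (by linarith) (by linarith)
          (h5.trans heq.symm).le
        rw [heq] at h6
        linarith

/-- The two-sided invariant: bets are clipped to `[-um, up]`. -/
def TwoSidedInvariant (up um θ a W : ℝ) : Prop :=
  (0 ≤ θ → BetInvariant up θ a W) ∧ (θ ≤ 0 → BetInvariant um (-θ) a W)

theorem TwoSidedInvariant.of_gaussPotential_le {up um θ a W : ℝ} (hup : 0 ≤ up) (hum : 0 ≤ um)
    (ha : 0 < a) (h : gaussPotential θ a ≤ W) : TwoSidedInvariant up um θ a W :=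
  ⟨fun h0 => .of_gaussPotential_le h0 hup ha h,
    fun h0 => .of_gaussPotential_le (neg_nonneg.2 h0) hum ha (by rwa [gaussPotential_neg])⟩

theorem TwoSidedInvariant.pos {up um θ a W : ℝ} (hup : 0 ≤ up) (hum : 0 ≤ um)
    (h : TwoSidedInvariant up um θ a W) : 0 < W := by
  rcases le_total 0 θ with h0 | h0
  · exact (h.1 h0).pos hup
  · exact (h.2 h0).pos hum

theorem TwoSidedInvariant.symm {up um θ a W : ℝ} (h : TwoSidedInvariant up um θ a W) :
    TwoSidedInvariant um up (-θ) a W :=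
  ⟨fun h0 => h.2 (neg_nonneg.1 h0), fun h0 => by
    rw [neg_neg]; exact h.1 (neg_nonpos.1 h0)⟩

theorem TwoSidedInvariant.step_of_nonneg {up um θ a W g : ℝ} (hup : 0 ≤ up) (hum : 0 ≤ um)
    (ha : 0 < a) (hθa : |θ| ≤ a) (h : TwoSidedInvariant up um θ a W) (hg : |g| ≤ 1)
    (h0 : 0 ≤ θ) :
    TwoSidedInvariant up um (θ + g) (a + |g|)
      (W + max (-um) (min up (sigmoidBet (θ / a) * W)) * g) := by
  have ha' : 0 < a + |g| := by linarith [abs_nonneg g]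
  have hW := h.pos hup hum
  have hb := sigmoidBet_nonneg (div_nonneg h0 ha.le)
  have hmax : max (-um) (min up (sigmoidBet (θ / a) * W)) =
      min up (sigmoidBet (θ / a) * W) :=
    max_eq_right ((neg_nonpos.2 hum).trans (le_min hup (by positivity)))
  rw [hmax]
  rcases (h.1 h0).step hup ha ((le_abs_self θ).trans hθa) hg with h1 | ⟨h1, h2⟩
  · exact .of_gaussPotential_le hup hum ha' h1
  -- Only `θ + g = 0` lies on both sides; there the clipping point is `0`, so the wealth dominates
  -- the potential and the other side can start afresh.
  · refine ⟨fun _ => h2, fun h3 => ?_⟩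
    have h4 : θ + g = 0 := le_antisymm h3 h1
    obtain ⟨θ', h5, h6, h7, -⟩ := h2
    rw [h4] at h6 h7 ⊢
    have : θ' = 0 := le_antisymm h6 h5
    subst this
    rw [neg_zero]
    refine .of_gaussPotential_le le_rfl hum ha' (by linarith)

theorem TwoSidedInvariant.step {up um θ a W g : ℝ} (hup : 0 ≤ up) (hum : 0 ≤ um)
    (ha : 0 < a) (hθa : |θ| ≤ a) (h : TwoSidedInvariant up um θ a W) (hg : |g| ≤ 1) :
    TwoSidedInvariant up um (θ + g) (a + |g|)
      (W + max (-um) (min up (sigmoidBet (θ / a) * W)) * g) := by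
  rcases le_total 0 θ with h0 | h0
  · exact h.step_of_nonneg hup hum ha hθa hg h0
  · have := (h.symm.step_of_nonneg hum hup ha (by rwa [abs_neg]) (g := -g) (by rwa [abs_neg])
      (neg_nonneg.2 h0)).symm
    rw [abs_neg, neg_div, sigmoidBet_neg, ← neg_add, neg_neg, neg_mul] at this
    convert this using 1
    have e : max (-up) (min um (-(sigmoidBet (θ / a) * W))) =
        -max (-um) (min up (sigmoidBet (θ / a) * W)) := by
      simp only [max_def, min_def]
      split_ifs <;> linarith
    rw [e]
    ring

theorem twoSidedInvariant_of_clipped {c x : ℕ → ℝ} {N : ℕ} {up um : ℝ} (hup : 0 ≤ up)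
    (hum : 0 ≤ um) (hc : ∀ i < N, |c i| ≤ 1)
    (hx : ∀ n < N, x n = max (-um) (min up
      (sigmoidBet ((∑ i ∈ Finset.range n, c i) / (1 + ∑ i ∈ Finset.range n, |c i|)) *
        (1 + ∑ i ∈ Finset.range n, x i * c i)))) (n : ℕ) (hn : n ≤ N) :
    TwoSidedInvariant up um (∑ i ∈ Finset.range n, c i) (1 + ∑ i ∈ Finset.range n, |c i|)
      (1 + ∑ i ∈ Finset.range n, x i * c i) := by
  induction n with
  | zero =>
    refine .of_gaussPotential_le hup hum (by simp) ?_
    simp [gaussPotential]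
  | succ n ih =>
    have hs : |∑ i ∈ Finset.range n, c i| ≤ ∑ i ∈ Finset.range n, |c i| :=
      Finset.abs_sum_le_sum_abs _ _
    have := (ih (by omega)).step hup hum (by linarith [abs_nonneg (∑ i ∈ Finset.range n, c i)])
      (by linarith) (hc n (by omega))
    rw [← hx n (by omega)] at this
    simpa only [Finset.sum_range_succ, ← add_assoc] using this

/-- The linear part of the invariant pays for `u (θ - θ')`, so only `u θ'` minus the potential at
`θ'` is left. Either `θ'` is below the threshold `τ`, or the potential there already exceeds `U (N +
1) ≥ u θ'`. -/
theorem BetInvariant.mul_sub_le {u θ a W U : ℝ} {N : ℕ} (hN : 0 < N) (hu : 0 ≤ u) (huU : u ≤ U)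
    (hU : 1 ≤ U) (ha : 0 < a) (haN : a ≤ N + 1) (hθa : θ ≤ a) (h : BetInvariant u θ a W) :
    u * θ - W ≤ u * (4 * √(N * Real.log ((N + 1) * U))) := by
  obtain ⟨θ', h0, hle, hW, -⟩ := h
  set τ := 4 * √(N * Real.log ((N + 1) * U)) with hτ
  have hN' : (1 : ℝ) ≤ N := by exact_mod_cast hN
  have hE := gaussPotential_pos θ' a
  suffices h : u * θ' - gaussPotential θ' a ≤ u * τ by linarith
  rcases le_or_gt θ' τ with hc | hc
  · have := mul_le_mul_of_nonneg_left hc hu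
    linarith
  have hNU : 1 ≤ (N + 1) * U := by nlinarith
  have hℓ : 0 ≤ Real.log ((N + 1) * U) := Real.log_nonneg hNU
  have hτ0 : 0 ≤ τ := by positivity
  have hsq : 16 * (N * Real.log ((N + 1) * U)) ≤ θ' ^ 2 := by
    have : τ ^ 2 ≤ θ' ^ 2 := by gcongr
    rwa [hτ, mul_pow, Real.sq_sqrt (by positivity), show (4 : ℝ) ^ 2 = 16 by norm_num] at this
  have hexp : 2 * Real.log (N + 1) + 4 * Real.log U ≤
      θ' ^ 2 / (2 * (N + 1 : ℝ)) - 2 * Real.log (N + 1) := by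
    -- The `16` in `τ²` leaves `8 N / (N + 1) ≥ 4` logarithms; two logarithms of `N + 1` are lost to
    -- the factor `a⁻²` of the potential.
    have h1 : 4 * Real.log ((N + 1) * U) ≤ θ' ^ 2 / (2 * (N + 1 : ℝ)) := by
      rw [le_div_iff₀ (by positivity)]
      nlinarith
    rw [Real.log_mul (by positivity) (by positivity)] at h1
    linarith
  have hu' : u * θ' ≤ gaussPotential θ' a := by
    have hlogN : 0 ≤ Real.log (N + 1) := Real.log_nonneg (by linarith)
    have hlogU : 0 ≤ Real.log U := Real.log_nonneg hU
    calc u * θ' ≤ U * (N + 1) := by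
          refine mul_le_mul huU (by linarith) h0 (by linarith)
      _ = Real.exp (Real.log U + Real.log (N + 1)) := by
          rw [Real.exp_add, Real.exp_log (by linarith), Real.exp_log (by linarith)]
      _ ≤ gaussPotential θ' (N + 1) := Real.exp_le_exp.2 (by linarith)
      _ ≤ gaussPotential θ' a := gaussPotential_anti ha haN
  have := mul_nonneg hu hτ0
  linarith

/-- The regret of coin betting with clipped bets against the two extreme bets. -/
theorem clipped_regret_le {c x : ℕ → ℝ} {N : ℕ} {up um U : ℝ} (hN : 0 < N) (hup : 0 ≤ up)
    (hum : 0 ≤ um) (hupU : up ≤ U) (humU : um ≤ U) (hU : 1 ≤ U) (hc : ∀ i < N, |c i| ≤ 1)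
    (hx : ∀ n < N, x n = max (-um) (min up
      (sigmoidBet ((∑ i ∈ Finset.range n, c i) / (1 + ∑ i ∈ Finset.range n, |c i|)) *
        (1 + ∑ i ∈ Finset.range n, x i * c i)))) :
    ∑ i ∈ Finset.range N, (up - x i) * c i ≤
        1 + U * (4 * √(N * Real.log ((N + 1) * U))) ∧
      ∑ i ∈ Finset.range N, (-um - x i) * c i ≤
        1 + U * (4 * √(N * Real.log ((N + 1) * U))) := by
  have h := twoSidedInvariant_of_clipped hup hum hc hx N le_rfl
  have hW := h.pos hup hum
  have h1 : ∑ i ∈ Finset.range N, |c i| ≤ N := by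
    simpa using Finset.sum_le_sum (g := fun _ => (1 : ℝ)) fun i hi => hc i (Finset.mem_range.1 hi)
  have h2 : |∑ i ∈ Finset.range N, c i| ≤ ∑ i ∈ Finset.range N, |c i| :=
    Finset.abs_sum_le_sum_abs _ _
  have h3 := abs_nonneg (∑ i ∈ Finset.range N, c i)
  have hτ : 0 ≤ 4 * √(N * Real.log ((N + 1) * U)) := by positivity
  simp only [sub_mul, Finset.sum_sub_distrib, ← Finset.mul_sum]
  have h4 := le_abs_self (∑ i ∈ Finset.range N, c i)
  have h5 := neg_abs_le (∑ i ∈ Finset.range N, c i)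
  have h6 := mul_le_mul_of_nonneg_right hupU hτ
  have h7 := mul_le_mul_of_nonneg_right humU hτ
  have h8 : 0 ≤ U * (4 * √(N * Real.log ((N + 1) * U))) := by positivity
  -- The regrets are `up θ - W + 1` and `-um θ - W + 1`. The invariant handles the extreme bet with
  -- the sign of `θ`; for the other one `W > 0` is enough.
  rcases le_total 0 (∑ i ∈ Finset.range N, c i) with h0 | h0
  · have h9 := (h.1 h0).mul_sub_le hN hup hupU hU (by linarith) (by linarith) (by linarith)
    have h10 := mul_nonneg hum h0
    constructor <;> linarith
  · have h9 := (h.2 h0).mul_sub_le hN hum humU hU (by linarith) (by linarith) (by linarith)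
    have h10 := mul_nonpos_of_nonneg_of_nonpos hup h0
    constructor <;> linarith

/-! ### Discounted returns, the Markov property and the Bellman equation -/

namespace CMDP

variable {S A : Type*} [Fintype S] [Fintype A]

theorem one_sub_γ_pos (M : CMDP S A) : 0 < 1 - M.γ := sub_pos.2 M.γ_lt_one

theorem summable_γ_pow (M : CMDP S A) : Summable fun k : ℕ => M.γ ^ k :=
  summable_geometric_of_lt_one M.γ_nonneg M.γ_lt_one

theorem summable_γ_pow_mul (M : CMDP S A) {u : ℕ → ℝ} {C : ℝ} (h : ∀ k, |u k| ≤ C) :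
    Summable fun k : ℕ => M.γ ^ k * u k := by
  refine Summable.of_norm_bounded (M.summable_γ_pow.mul_right C) fun k => ?_
  rw [norm_mul, norm_pow, Real.norm_of_nonneg M.γ_nonneg, Real.norm_eq_abs]
  exact mul_le_mul_of_nonneg_left (h k) (pow_nonneg M.γ_nonneg k)

theorem discReturn_mem (M : CMDP S A) {f : S → A → ℝ} (hf : ∀ s a, f s a ∈ Set.Icc (0 : ℝ) 1)
    (τ : Trajectory S A) : M.discReturn f τ ∈ Set.Icc 0 (1 / (1 - M.γ)) := by
  constructor
  · exact tsum_nonneg fun k => mul_nonneg (pow_nonneg M.γ_nonneg k) (hf _ _).1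
  · rw [one_div, ← tsum_geometric_of_lt_one M.γ_nonneg M.γ_lt_one]
    refine Summable.tsum_le_tsum (fun k => ?_)
      (M.summable_γ_pow_mul (C := 1) fun k => ?_) M.summable_γ_pow
    · exact mul_le_of_le_one_right (pow_nonneg M.γ_nonneg k) (hf _ _).2
    · rw [abs_of_nonneg (hf _ _).1]
      exact (hf _ _).2

section Values

variable [MeasurableSpace S] [DiscreteMeasurableSpace S]
  [MeasurableSpace A] [DiscreteMeasurableSpace A] (M : CMDP S A)

theorem integral_stateLaw (π : Policy S A) (s : S) (g : S × A → ℝ) :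
    ∫ x, g x ∂stateLaw π s = ∑ a, π s a * g (s, a) := by
  unfold stateLaw
  rw [integral_finsetSum_measure]
  · refine Finset.sum_congr rfl fun a _ => ?_
    rw [integral_smul_measure, integral_dirac, ENNReal.toReal_ofReal (stdSimplex.zero_le _ a),
      smul_eq_mul]
  · exact fun a _ => Integrable.smul_measure (integrable_dirac (by simp)) (by simp)

theorem integral_pairLaw (π : Policy S A) (p : stdSimplex ℝ S) (g : S × A → ℝ) :
    ∫ x, g x ∂pairLaw π p = ∑ s, p s * ∑ a, π s a * g (s, a) := by
  unfold pairLaw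
  rw [integral_finsetSum_measure]
  · refine Finset.sum_congr rfl fun s _ => ?_
    rw [integral_smul_measure, integral_stateLaw, ENNReal.toReal_ofReal (stdSimplex.zero_le _ s),
      smul_eq_mul]
  · exact fun s _ => Integrable.smul_measure Integrable.of_finite (by simp)

/-- The transition operator of the state-action chain. -/
def stepOp (π : Policy S A) (g : S × A → ℝ) (x : S × A) : ℝ :=
  ∑ s, M.P x.1 x.2 s * ∑ a, π s a * g (s, a)

theorem integral_pathLaw_zero (π : Policy S A) (μ : Measure (S × A)) [IsProbabilityMeasure μ]
    (g : S × A → ℝ) : ∫ τ, g (τ 0) ∂M.pathLaw π μ = ∫ x, g x ∂μ := by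
  have h : (M.pathLaw π μ).map (Preorder.frestrictLe (π := fun _ => S × A) 0) =
      μ.map (MeasurableEquiv.piUnique (fun _ : Finset.Iic 0 => S × A)).symm := by
    rw [pathLaw, Kernel.trajMeasure, Measure.map_comp _ _ (by fun_prop),
      Kernel.traj_map_frestrictLe, Kernel.partialTraj_self, Measure.id_comp]
  have h1 : ∫ τ, g (τ 0) ∂M.pathLaw π μ =
      ∫ y, g (y ⟨0, Finset.mem_Iic.2 le_rfl⟩)
        ∂(M.pathLaw π μ).map (Preorder.frestrictLe (π := fun _ => S × A) 0) := by
    rw [integral_map (by fun_prop) (measurable_of_finite _).aestronglyMeasurable]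
    rfl
  rw [h1, h, integral_map (by fun_prop) (measurable_of_finite _).aestronglyMeasurable]
  rfl

/-- The Markov property; iterating it turns every expected return into a power series in the
transition operator. -/
theorem integral_pathLaw_succ (π : Policy S A) (μ : Measure (S × A)) [IsProbabilityMeasure μ]
    (g : S × A → ℝ) (n : ℕ) :
    ∫ τ, g (τ (n + 1)) ∂M.pathLaw π μ = ∫ τ, M.stepOp π g (τ n) ∂M.pathLaw π μ := by
  have h := Kernel.map_frestrictLe_trajMeasure_compProd_eq_map_trajMeasure
    (X := fun _ => S × A) (μ₀ := μ) (κ := M.historyKernel π) (a := n)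
  have h1 : ∫ τ, g (τ (n + 1)) ∂M.pathLaw π μ =
      ∫ y, g y.2 ∂(M.pathLaw π μ).map
        (fun τ => (Preorder.frestrictLe (π := fun _ => S × A) n τ, τ (n + 1))) := by
    rw [integral_map (by fun_prop) (measurable_of_finite _).aestronglyMeasurable]
  have : IsProbabilityMeasure ((M.pathLaw π μ).map
      (Preorder.frestrictLe (π := fun _ => S × A) n)) :=
    Measure.isProbabilityMeasure_map (by fun_prop)
  rw [h1, pathLaw, ← h, ← pathLaw, Measure.integral_compProd Integrable.of_finite,
    integral_map (by fun_prop) (measurable_of_finite _).aestronglyMeasurable]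
  refine integral_congr_ae (Filter.Eventually.of_forall fun τ => ?_)
  exact integral_pairLaw π _ g

theorem integral_pathLaw (π : Policy S A) (μ : Measure (S × A)) [IsProbabilityMeasure μ]
    (g : S × A → ℝ) (n : ℕ) :
    ∫ τ, g (τ n) ∂M.pathLaw π μ = ∫ x, (M.stepOp π)^[n] g x ∂μ := by
  induction n generalizing g with
  | zero => exact M.integral_pathLaw_zero π μ g
  | succ n ih => rw [integral_pathLaw_succ, ih, Function.iterate_succ_apply]

theorem sum_simplex_mul_mem {X : Type*} [Fintype X] (p : stdSimplex ℝ X) {g : X → ℝ} {C : ℝ}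
    (hg : ∀ x, g x ∈ Set.Icc 0 C) : ∑ x, p x * g x ∈ Set.Icc 0 C := by
  constructor
  · exact Finset.sum_nonneg fun x _ => mul_nonneg (stdSimplex.zero_le p x) (hg x).1
  · calc _ ≤ ∑ x, p x * C := Finset.sum_le_sum fun x _ =>
          mul_le_mul_of_nonneg_left (hg x).2 (stdSimplex.zero_le p x)
      _ = C := by rw [← Finset.sum_mul, stdSimplex.sum_eq_one, one_mul]

/-- The action-value function. -/
def actionValue (f : S → A → ℝ) (π : Policy S A) (s : S) (a : A) : ℝ :=
  ∫ τ, M.discReturn f τ ∂M.pathLaw π (Measure.dirac (s, a))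

variable {f : S → A → ℝ}

theorem hasSum_integral_discReturn (hf : ∀ s a, f s a ∈ Set.Icc (0 : ℝ) 1)
    (π : Policy S A) (μ : Measure (S × A))
    [IsProbabilityMeasure μ] :
    HasSum (fun k => M.γ ^ k * ∫ x, (M.stepOp π)^[k] (fun x => f x.1 x.2) x ∂μ)
      (∫ τ, M.discReturn f τ ∂M.pathLaw π μ) := by
  have hm : ∀ k, Measurable fun τ : Trajectory S A => f (τ k).1 (τ k).2 := fun k =>
    (measurable_of_countable fun x : S × A => f x.1 x.2).comp (measurable_pi_apply k)
  have hb : ∀ k (τ : Trajectory S A), ‖M.γ ^ k * f (τ k).1 (τ k).2‖ ≤ M.γ ^ k := by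
    intro k τ
    rw [norm_mul, norm_pow, Real.norm_of_nonneg M.γ_nonneg, Real.norm_of_nonneg (hf _ _).1]
    exact mul_le_of_le_one_right (pow_nonneg M.γ_nonneg k) (hf _ _).2
  have hint : ∀ k, Integrable (fun τ : Trajectory S A => M.γ ^ k * f (τ k).1 (τ k).2)
      (M.pathLaw π μ) := fun k =>
    Integrable.of_bound ((hm k).const_mul _).aestronglyMeasurable (M.γ ^ k)
      (Filter.Eventually.of_forall (hb k))
  have h := hasSum_integral_of_summable_integral_norm hint
    (Summable.of_nonneg_of_le (fun k => by positivity) (fun k => ?_) M.summable_γ_pow)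
  · refine (h.congr_fun ?_)
    intro k
    rw [integral_const_mul, ← integral_pathLaw]
  · calc _ ≤ ∫ _τ, M.γ ^ k ∂M.pathLaw π μ :=
          integral_mono (hint k).norm (integrable_const _) (hb k)
      _ = M.γ ^ k := by simp

theorem hasSum_actionValue (hf : ∀ s a, f s a ∈ Set.Icc (0 : ℝ) 1)
    (π : Policy S A) (x : S × A) :
    HasSum (fun k => M.γ ^ k * (M.stepOp π)^[k] (fun x => f x.1 x.2) x)
      (M.actionValue f π x.1 x.2) := by
  have := M.hasSum_integral_discReturn hf π (Measure.dirac x)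
  simp only [integral_dirac] at this
  exact this

theorem actionValue_eq (hf : ∀ s a, f s a ∈ Set.Icc (0 : ℝ) 1)
    (π : Policy S A) (s : S) (a : A) :
    M.actionValue f π s a = f s a +
      M.γ * ∑ s', M.P s a s' * ∑ a', π s' a' * M.actionValue f π s' a' := by
  have h0 := M.hasSum_actionValue hf π (s, a)
  have h1 : HasSum (fun k => M.γ ^ (k + 1) *
      (M.stepOp π)^[k + 1] (fun x => f x.1 x.2) (s, a))
      (M.γ * ∑ s', M.P s a s' * ∑ a', π s' a' * M.actionValue f π s' a') := by
    have := (hasSum_sum fun s' (_ : s' ∈ Finset.univ) => (hasSum_sum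
      fun a' (_ : a' ∈ Finset.univ) =>
        (M.hasSum_actionValue hf π (s', a')).mul_left (π s' a')).mul_left (M.P s a s')).mul_left M.γ
    refine this.congr_fun fun k => ?_
    rw [Function.iterate_succ_apply', stepOp, pow_succ', mul_assoc]
    congr 1
    rw [Finset.mul_sum]
    refine Finset.sum_congr rfl fun s' _ => ?_
    rw [mul_left_comm, Finset.mul_sum]
    congr 1
    exact Finset.sum_congr rfl fun a' _ => by ring
  have h2 := h0.unique ((hasSum_nat_add_iff 1).1 h1)
  simpa [add_comm] using h2

theorem V_eq (hf : ∀ s a, f s a ∈ Set.Icc (0 : ℝ) 1)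
    (π : Policy S A) (s : S) :
    M.V f π s = ∑ a, π s a * M.actionValue f π s a := by
  have h0 := M.hasSum_integral_discReturn hf π (stateLaw π s)
  refine h0.unique ((hasSum_sum fun a (_ : a ∈ Finset.univ) =>
    (M.hasSum_actionValue hf π (s, a)).mul_left (π s a)).congr_fun fun k => ?_)
  rw [integral_stateLaw, Finset.mul_sum]
  exact Finset.sum_congr rfl fun a _ => by ring

theorem actionValue_mem (hf : ∀ s a, f s a ∈ Set.Icc (0 : ℝ) 1)
    (π : Policy S A) (s : S) (a : A) :
    M.actionValue f π s a ∈ Set.Icc 0 (1 / (1 - M.γ)) := by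
  have hm := M.measurable_discReturn f
  have hi : Integrable (M.discReturn f) (M.pathLaw π (Measure.dirac (s, a))) :=
    Integrable.of_bound hm.aestronglyMeasurable (1 / (1 - M.γ))
      (Filter.Eventually.of_forall fun τ => by
        rw [Real.norm_of_nonneg (M.discReturn_mem hf τ).1]
        exact (M.discReturn_mem hf τ).2)
  constructor
  · exact integral_nonneg fun τ => (M.discReturn_mem hf τ).1
  · calc _ ≤ ∫ _τ, 1 / (1 - M.γ) ∂M.pathLaw π (Measure.dirac (s, a)) :=
          integral_mono hi (integrable_const _) fun τ => (M.discReturn_mem hf τ).2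
      _ = _ := by simp

theorem value_mem (hf : ∀ s a, f s a ∈ Set.Icc (0 : ℝ) 1)
    (π : Policy S A) : M.value f π ∈ Set.Icc 0 (1 / (1 - M.γ)) :=
  sum_simplex_mul_mem _ fun s => by
    rw [M.V_eq hf]
    exact sum_simplex_mul_mem _ fun a => M.actionValue_mem hf π s a

/-! ### Occupation measures -/

/-- `ν` is a nonnegative solution of the flow equation of the policy `π`. -/
def IsFlow (π : Policy S A) (ν : S → ℝ) : Prop :=
  (∀ s, 0 ≤ ν s) ∧ ∀ s', ν s' = (1 - M.γ) * M.ρ s' +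
    M.γ * ∑ s, ν s * ∑ a, π s a * M.P s a s'

variable {M}

/-- The flow equation tested against `g`. All later facts about occupation measures use only this,
hence hold for any solution of the flow equation, in particular for mixtures of occupation measures.
-/
theorem IsFlow.sum_mul {π : Policy S A} {ν : S → ℝ} (h : M.IsFlow π ν) (g : S → ℝ) :
    ∑ s, ν s * g s = (1 - M.γ) * ∑ s, M.ρ s * g s +
      M.γ * ∑ s, ν s * ∑ a, π s a * ∑ s', M.P s a s' * g s' := by
  have e : ∑ s, ν s * ∑ a, π s a * ∑ s', M.P s a s' * g s' =
      ∑ s', (∑ s, ν s * ∑ a, π s a * M.P s a s') * g s' := by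
    simp only [Finset.mul_sum, Finset.sum_mul]
    rw [Finset.sum_comm' (t' := Finset.univ) (s' := fun _ => Finset.univ) (by simp)]
    conv_rhs => rw [Finset.sum_comm]
    rw [Finset.sum_comm]
    refine Finset.sum_congr rfl fun s _ => ?_
    rw [Finset.sum_comm]
    exact Finset.sum_congr rfl fun s' _ => Finset.sum_congr rfl fun a _ => by ring
  rw [e, Finset.mul_sum, Finset.mul_sum, ← Finset.sum_add_distrib]
  refine Finset.sum_congr rfl fun s _ => ?_
  rw [h.2 s]
  conv_lhs => rw [← h.2 s]
  conv_lhs => rw [h.2 s]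
  ring

theorem IsFlow.sum_eq_one {π : Policy S A} {ν : S → ℝ} (h : M.IsFlow π ν) : ∑ s, ν s = 1 := by
  have h1 := h.sum_mul fun _ => 1
  simp only [mul_one, stdSimplex.sum_eq_one] at h1
  have := M.one_sub_γ_pos
  have h2 : (1 - M.γ) * (∑ s, ν s - 1) = 0 := by linarith
  rcases mul_eq_zero.1 h2 with h3 | h3 <;> linarith

/-- The performance difference lemma. -/
theorem IsFlow.sum_advantage (hf : ∀ s a, f s a ∈ Set.Icc (0 : ℝ) 1)
    {π : Policy S A} {ν : S → ℝ} (h : M.IsFlow π ν)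
    (π' : Policy S A) :
    ∑ s, ν s * ∑ a, π s a * (M.actionValue f π' s a - M.V f π' s) =
      ∑ s, ν s * ∑ a, π s a * f s a - (1 - M.γ) * M.value f π' := by
  have h1 := h.sum_mul (M.V f π')
  have h2 : ∀ s, ∑ a, π s a * (M.actionValue f π' s a - M.V f π' s) =
      ∑ a, π s a * f s a + M.γ * (∑ a, π s a * ∑ s', M.P s a s' * M.V f π' s') -
        M.V f π' s := by
    intro s
    simp only [mul_sub, Finset.sum_sub_distrib, ← Finset.sum_mul, stdSimplex.sum_eq_one, one_mul]
    congr 1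
    rw [Finset.mul_sum, ← Finset.sum_add_distrib]
    refine Finset.sum_congr rfl fun a _ => ?_
    rw [M.actionValue_eq hf]
    simp only [M.V_eq hf]
    ring
  simp only [h2]
  simp only [mul_sub, mul_add, Finset.sum_sub_distrib, Finset.sum_add_distrib]
  have e : ∑ s, ν s * (M.γ * ∑ a, π s a * ∑ s', M.P s a s' * M.V f π' s') =
      M.γ * ∑ s, ν s * ∑ a, π s a * ∑ s', M.P s a s' * M.V f π' s' := by
    rw [Finset.mul_sum]
    exact Finset.sum_congr rfl fun s _ => mul_left_comm _ _ _
  rw [h1, value, e]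
  ring

theorem IsFlow.sum_eq_value (hf : ∀ s a, f s a ∈ Set.Icc (0 : ℝ) 1)
    {π : Policy S A} {ν : S → ℝ} (h : M.IsFlow π ν) :
    ∑ s, ν s * ∑ a, π s a * f s a = (1 - M.γ) * M.value f π := by
  have h1 := h.sum_advantage hf π
  have h2 : ∀ s, ∑ a, π s a * (M.actionValue f π s a - M.V f π s) = 0 := fun s => by
    simp only [mul_sub, Finset.sum_sub_distrib, ← Finset.sum_mul, stdSimplex.sum_eq_one, one_mul]
    rw [M.V_eq hf, sub_self]
  simp only [h2, mul_zero, Finset.sum_const_zero] at h1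
  linarith

variable (M)

theorem isFlow_occupation (π : Policy S A) : M.IsFlow π (M.occupation π) := by
  classical
  set μ := M.pathLaw π (pairLaw π M.ρ) with hμ
  set p : ℕ → S → ℝ := fun k s => μ.real {τ | (τ k).1 = s} with hp
  have hp01 : ∀ k s, |p k s| ≤ 1 := fun k s => by
    rw [abs_of_nonneg measureReal_nonneg]
    exact measureReal_le_one
  have hpint : ∀ k s, p k s = ∫ τ, (if (τ k).1 = s then 1 else 0 : ℝ) ∂μ := by
    intro k s
    have hms : MeasurableSet {τ : Trajectory S A | (τ k).1 = s} :=
      (measurable_fst.comp (measurable_pi_apply k)) (measurableSet_singleton s)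
    change μ.real _ = _
    rw [← integral_indicator_one hms]
    rfl
  -- At every time, given the state, the action is distributed according to `π`; so the state
  -- marginals alone satisfy a recursion, and its discounted sum is the flow equation.
  have hE : ∀ k (g : S × A → ℝ), ∫ τ, g (τ k) ∂μ = ∑ s, p k s * ∑ a, π s a * g (s, a) := by
    have hlin : ∀ k (u : S → S × A → ℝ) (v : S → ℝ),
        ∫ τ, ∑ s, u s (τ k) * v s ∂μ = ∑ s, (∫ τ, u s (τ k) ∂μ) * v s := by
      intro k u v
      have hi : ∀ s, Integrable (fun τ : Trajectory S A => u s (τ k)) μ := fun s => by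
        have hm : Measurable fun τ : Trajectory S A => u s (τ k) :=
          (measurable_of_finite (u s)).comp (measurable_pi_apply k)
        refine Integrable.of_bound hm.aestronglyMeasurable (∑ x, ‖u s x‖)
          (Filter.Eventually.of_forall fun τ => ?_)
        exact Finset.single_le_sum (f := fun x => ‖u s x‖) (fun _ _ => norm_nonneg _)
          (Finset.mem_univ _)
      rw [integral_finsetSum _ fun s _ => (hi s).mul_const _]
      exact Finset.sum_congr rfl fun s _ => integral_mul_const _ _
    have hone : ∀ s', (∑ a, π s' a * (1 : ℝ)) = 1 := fun s' => by
      simp only [mul_one, stdSimplex.sum_eq_one]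
    intro k
    cases k with
    | zero =>
      have h0 : ∀ s, p 0 s = M.ρ s := fun s => by
        rw [hpint]
        have := M.integral_pathLaw_zero π (pairLaw π M.ρ) fun x => if x.1 = s then 1 else 0
        rw [this, integral_pairLaw]
        simp [stdSimplex.sum_eq_one]
      intro g
      rw [hμ, integral_pathLaw_zero, integral_pairLaw]
      simp only [h0]
    | succ k =>
      have h0 : ∀ s, p (k + 1) s = ∫ τ, M.P (τ k).1 (τ k).2 s ∂μ := fun s => by
        rw [hpint]
        have := M.integral_pathLaw_succ π (pairLaw π M.ρ) (fun x => if x.1 = s then 1 else 0) k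
        rw [hμ, this]
        simp [stepOp, stdSimplex.sum_eq_one]
      intro g
      rw [hμ, integral_pathLaw_succ, ← hμ]
      simp only [h0, stepOp]
      exact hlin k (fun s x => M.P x.1 x.2 s) fun s => ∑ a, π s a * g (s, a)
  have hp0 : ∀ s, p 0 s = M.ρ s := fun s => by
    rw [hpint]
    have := M.integral_pathLaw_zero π (pairLaw π M.ρ) fun x => if x.1 = s then 1 else 0
    rw [this, integral_pairLaw]
    simp [stdSimplex.sum_eq_one]
  have hps : ∀ k s', p (k + 1) s' = ∑ s, p k s * ∑ a, π s a * M.P s a s' := fun k s' => by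
    rw [hpint]
    have := M.integral_pathLaw_succ π (pairLaw π M.ρ) (fun x => if x.1 = s' then 1 else 0) k
    rw [hμ, this, ← hμ, hE]
    simp [stepOp, stdSimplex.sum_eq_one]
  have hsum : ∀ s, HasSum (fun k => M.γ ^ k * p k s) (∑' k, M.γ ^ k * p k s) := fun s =>
    (M.summable_γ_pow_mul fun k => hp01 k s).hasSum
  refine ⟨fun s => mul_nonneg M.one_sub_γ_pos.le (tsum_nonneg fun k =>
    mul_nonneg (pow_nonneg M.γ_nonneg k) measureReal_nonneg), fun s' => ?_⟩
  have h1 : HasSum (fun k => M.γ ^ (k + 1) * p (k + 1) s')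
      (M.γ * ∑ s, (∑' k, M.γ ^ k * p k s) * ∑ a, π s a * M.P s a s') := by
    have := (hasSum_sum fun s (_ : s ∈ Finset.univ) =>
      (hsum s).mul_right (∑ a, π s a * M.P s a s')).mul_left M.γ
    refine this.congr_fun fun k => ?_
    rw [hps, Finset.mul_sum, Finset.mul_sum]
    exact Finset.sum_congr rfl fun s _ => by rw [pow_succ']; ring
  have h2 := (hsum s').unique ((hasSum_nat_add_iff 1).1 h1)
  have h3 : ∀ s, M.occupation π s = (1 - M.γ) * ∑' k, M.γ ^ k * p k s := fun s => rfl
  simp only [h3]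
  rw [h2, Finset.sum_range_one, pow_zero, one_mul, hp0, add_comm, mul_add]
  congr 1
  rw [Finset.mul_sum, Finset.mul_sum, Finset.mul_sum]
  exact Finset.sum_congr rfl fun s _ => by ring

/-! ### Convexity of the set of achievable values -/

/-- The policy that picks actions according to a nonnegative state-action weight `d`. -/
theorem exists_policy_of_weight (π₀ : Policy S A) {d : S → A → ℝ} (hd : ∀ s a, 0 ≤ d s a) :
    ∃ π : Policy S A, ∀ s a, (∑ a', d s a') * π s a = d s a := by
  have h : ∀ s, ∃ p : stdSimplex ℝ A, ∀ a, (∑ a', d s a') * p a = d s a := by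
    intro s
    by_cases h0 : ∑ a', d s a' = 0
    · refine ⟨π₀ s, fun a => ?_⟩
      rw [h0, zero_mul]
      exact ((Finset.sum_eq_zero_iff_of_nonneg fun a _ => hd s a).1 h0 a (Finset.mem_univ a)).symm
    · refine ⟨⟨fun a => d s a / ∑ a', d s a', fun a => div_nonneg (hd s a)
        (Finset.sum_nonneg fun a _ => hd s a), by rw [← Finset.sum_div, div_self h0]⟩, fun a => ?_⟩
      exact mul_div_cancel₀ _ h0
  choose π hπ using h
  exact ⟨π, hπ⟩

/-- Values are linear in the state-action occupation measure. A mixture of two such measures is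
disintegrated into a policy, and the mixed state measure solves the flow equation of that policy. -/
theorem convex_values {f f' : S → A → ℝ} (hf : ∀ s a, f s a ∈ Set.Icc (0 : ℝ) 1)
    (hf' : ∀ s a, f' s a ∈ Set.Icc (0 : ℝ) 1) :
    Convex ℝ (Set.range fun π : Policy S A => (M.value f π, M.value f' π)) := by
  rintro _ ⟨π₁, rfl⟩ _ ⟨π₂, rfl⟩ t₁ t₂ ht₁ ht₂ ht
  obtain ⟨h1, h1'⟩ := M.isFlow_occupation π₁
  obtain ⟨h2, h2'⟩ := M.isFlow_occupation π₂
  obtain ⟨π, hπ⟩ := exists_policy_of_weight π₁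
    (d := fun s a => t₁ * (M.occupation π₁ s * π₁ s a) + t₂ * (M.occupation π₂ s * π₂ s a))
    fun s a => add_nonneg (mul_nonneg ht₁ (mul_nonneg (h1 s) (stdSimplex.zero_le _ _)))
      (mul_nonneg ht₂ (mul_nonneg (h2 s) (stdSimplex.zero_le _ _)))
  have hν : ∀ s, ∑ a, (t₁ * (M.occupation π₁ s * π₁ s a) +
      t₂ * (M.occupation π₂ s * π₂ s a)) =
      t₁ * M.occupation π₁ s + t₂ * M.occupation π₂ s := fun s => by
    simp only [Finset.sum_add_distrib, ← Finset.mul_sum, stdSimplex.sum_eq_one, mul_one]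
  simp only [hν] at hπ
  have hlin : ∀ (s : S) (g : A → ℝ),
      (t₁ * M.occupation π₁ s + t₂ * M.occupation π₂ s) * ∑ a, π s a * g a =
        t₁ * (M.occupation π₁ s * ∑ a, π₁ s a * g a) +
          t₂ * (M.occupation π₂ s * ∑ a, π₂ s a * g a) := by
    intro s g
    simp only [Finset.mul_sum]
    rw [← Finset.sum_add_distrib]
    refine Finset.sum_congr rfl fun a _ => ?_
    rw [← mul_assoc, hπ]
    ring
  have hflow : M.IsFlow π fun s => t₁ * M.occupation π₁ s + t₂ * M.occupation π₂ s := by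
    refine ⟨fun s => add_nonneg (mul_nonneg ht₁ (h1 s)) (mul_nonneg ht₂ (h2 s)), fun s' => ?_⟩
    simp only [hlin, Finset.sum_add_distrib, ← Finset.mul_sum]
    rw [h1' s', h2' s']
    linear_combination (1 - M.γ) * M.ρ s' * ht
  have hval : ∀ {g : S → A → ℝ}, (∀ s a, g s a ∈ Set.Icc (0 : ℝ) 1) →
      M.value g π = t₁ * M.value g π₁ + t₂ * M.value g π₂ := by
    intro g hg
    have e := hflow.sum_eq_value hg
    simp only [hlin, Finset.sum_add_distrib, ← Finset.mul_sum] at e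
    rw [(M.isFlow_occupation π₁).sum_eq_value hg, (M.isFlow_occupation π₂).sum_eq_value hg] at e
    have := M.one_sub_γ_pos
    refine mul_left_cancel₀ this.ne' ?_
    linarith
  exact ⟨π, by simp [hval hf, hval hf']⟩

/-- The loss in constraint value bounds the gain in reward value over an optimal policy. -/
theorem ζ_mul_le {πs : Policy S A} (hπs : M.IsOptimal πs) {x y : ℝ}
    (hxy : (x, y) ∈ Set.range fun π : Policy S A => (M.value M.r π, M.value M.c π))
    (hy : y ≤ M.b) : M.ζ * (x - M.value M.r πs) ≤ (M.b - y) * (1 / (1 - M.γ)) := by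
  have hL : 0 ≤ 1 / (1 - M.γ) := one_div_nonneg.2 M.one_sub_γ_pos.le
  have hv := mul_nonneg (sub_nonneg.2 hy) hL
  have key : ∀ π' : Policy S A, (M.value M.c π' - M.b) * (x - M.value M.r πs) ≤
      (M.b - y) * (M.value M.r πs - M.value M.r π') ∨ M.value M.c π' ≤ M.b := by
    intro π'
    rcases le_or_gt (M.value M.c π') M.b with h | h
    · exact Or.inr h
    left
    have hD : 0 < (M.value M.c π' - M.b) + (M.b - y) := by linarith
    -- The weights are chosen such that the mixture with the strictly feasible `π'` has constraint
    -- value exactly `b`; then optimality of `πs` applies to it.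
    obtain ⟨π, hπ⟩ := M.convex_values M.r_mem M.c_mem hxy (Set.mem_range_self π')
      (div_nonneg (sub_nonneg.2 h.le) hD.le) (div_nonneg (sub_nonneg.2 hy) hD.le)
      (by rw [← add_div, div_self hD.ne'])
    simp only [Prod.smul_mk, Prod.mk_add_mk, Prod.mk.injEq, smul_eq_mul] at hπ
    obtain ⟨e1, e2⟩ := hπ
    have e3 : M.value M.c π = M.b := by
      rw [e2]
      field_simp
      ring
    have h4 := hπs.2 π e3.ge
    rw [e1, div_mul_eq_mul_div, div_mul_eq_mul_div, ← add_div, div_le_iff₀ hD] at h4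
    linarith
  rcases le_or_gt x (M.value M.r πs) with hx | hx
  · rcases le_or_gt 0 M.ζ with hz | hz
    · exact (mul_nonpos_of_nonneg_of_nonpos hz (by linarith)).trans hv
    · have hcs : M.value M.c πs ≤ ⨆ π : Policy S A, M.value M.c π :=
        le_ciSup ⟨1 / (1 - M.γ), by rintro _ ⟨π, rfl⟩; exact (M.value_mem M.c_mem π).2⟩ πs
      have := hπs.1
      unfold ζ at hz
      linarith
  · have hgap : 0 < x - M.value M.r πs := by linarith
    -- Dividing by the gap turns the claim into an upper bound on each constraint value, so it
    -- passes to the supremum without a maximizer.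
    rw [← le_div_iff₀ hgap, ζ, sub_le_iff_le_add]
    have : Nonempty (Policy S A) := ⟨πs⟩
    refine ciSup_le fun π' => ?_
    rw [← sub_le_iff_le_add, le_div_iff₀ hgap]
    rcases key π' with h | h
    · refine h.trans (mul_le_mul_of_nonneg_left ?_ (sub_nonneg.2 hy))
      have h1 := (M.value_mem M.r_mem πs).2
      have h2 := (M.value_mem M.r_mem π').1
      linarith
    · exact (mul_nonpos_of_nonpos_of_nonneg (by linarith) hgap.le).trans hv

theorem ζ_le (πs : Policy S A) (hb : 0 ≤ M.b) : M.ζ ≤ 1 / (1 - M.γ) := by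
  have : Nonempty (Policy S A) := ⟨πs⟩
  have := ciSup_le fun π : Policy S A => (M.value_mem M.c_mem π).2
  unfold ζ
  linarith

theorem two_le_U (πs : Policy S A) (hb : 0 ≤ M.b) (hζ : 0 < M.ζ) : 2 ≤ M.U := by
  have h1 := M.one_sub_γ_pos
  have h2 := M.ζ_le πs hb
  rw [le_div_iff₀ h1] at h2
  rw [U, le_div_iff₀ (by positivity)]
  linarith

theorem b_le (πs : Policy S A) (hζ : 0 < M.ζ) : M.b ≤ 1 / (1 - M.γ) := by
  have : Nonempty (Policy S A) := ⟨πs⟩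
  have := ciSup_le fun π : Policy S A => (M.value_mem M.c_mem π).2
  unfold ζ at hζ
  linarith

theorem average_mem_values {f f' : S → A → ℝ} (hf : ∀ s a, f s a ∈ Set.Icc (0 : ℝ) 1)
    (hf' : ∀ s a, f' s a ∈ Set.Icc (0 : ℝ) 1) (pol : ℕ → Policy S A) {T : ℕ} (hT : 0 < T) :
    (1 / T * ∑ t ∈ Finset.range T, M.value f (pol t),
      1 / T * ∑ t ∈ Finset.range T, M.value f' (pol t)) ∈
      Set.range fun π : Policy S A => (M.value f π, M.value f' π) := by
  have hT' : (0 : ℝ) < T := by exact_mod_cast hT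
  have := (M.convex_values hf hf').sum_mem (t := Finset.range T) (w := fun _ => (1 / T : ℝ))
    (z := fun t => (M.value f (pol t), M.value f' (pol t))) (fun _ _ => by positivity)
    (by simp [hT'.ne']) (fun t _ => Set.mem_range_self (pol t))
  rw [← Finset.smul_sum, ← prod_mk_sum, Prod.smul_mk, smul_eq_mul, smul_eq_mul] at this
  exact this

end Values

end CMDP

namespace CMDP

variable {S A : Type*} [Fintype S] [Fintype A]

/-! ### The recursion of the iterates -/

section Recursion

variable (M : CMDP S A) (U : ℝ) (T : ℕ) (π₀ : Policy S A) (lam₀ : ℝ) (q : ℕ → Estimate S A)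

/-- The estimated constraint margin of iteration `t`. -/
def marginHat (t : ℕ) : ℝ := M.valueHat (M.iterate U T π₀ lam₀ q t).pol (q t) - M.b

/-- The truncated advantages of iteration `t`. -/
def iterAdv (t : ℕ) (s : S) (a : A) : ℝ := M.advTilde U (M.iterate U T π₀ lam₀ q t) (q t) s a

/-- The recursion in the indexing of the betting lemmas, where `n = 0` is covered because the empty
sum gives the bet `0`. -/
theorem iterate_w (n : ℕ) (s : S) (a : A) :
    (M.iterate U T π₀ lam₀ q n).w s a =
      (∑ i ∈ Finset.range n, M.iterAdv U T π₀ lam₀ q i s a) / (n + T / 2 : ℝ) *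
        (1 + ∑ i ∈ Finset.range n, M.iterAdv U T π₀ lam₀ q i s a *
          (M.iterate U T π₀ lam₀ q i).w s a) := by
  cases n with
  | zero => simp [iterate]
  | succ n =>
    rw [iterate, Finset.sum_range, Finset.sum_range]
    push_cast
    rfl

theorem coinPolicy_zero : coinPolicy π₀ (fun _ _ => (0 : ℝ)) = π₀ := by
  funext s
  simp [coinPolicy]

theorem iterate_pol (n : ℕ) :
    (M.iterate U T π₀ lam₀ q n).pol = coinPolicy π₀ (M.iterate U T π₀ lam₀ q n).w := by
  cases n with
  | zero => simp only [iterate]; exact (coinPolicy_zero π₀).symm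
  | succ n => simp only [iterate]

theorem iterate_lam (hlam₀ : lam₀ ∈ Set.Icc 0 U) (n : ℕ) :
    (M.iterate U T π₀ lam₀ q n).lam = max 0 (min U (lam₀ -
      (1 - M.γ) * sigmoidBet ((∑ i ∈ Finset.range n, M.marginHat U T π₀ lam₀ q i) /
        (1 / (1 - M.γ) + ∑ i ∈ Finset.range n, |M.marginHat U T π₀ lam₀ q i|)) *
      (1 / (1 - M.γ) - ∑ i ∈ Finset.range n,
        ((M.iterate U T π₀ lam₀ q i).lam - lam₀) * M.marginHat U T π₀ lam₀ q i))) := by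
  cases n with
  -- At time `0` the betting fraction is `tanh 0 = 0`, and projecting `lam₀ ∈ [0, U]` changes
  -- nothing.
  | zero => simp [iterate, sigmoidBet_zero, hlam₀.1, hlam₀.2]
  | succ n =>
    rw [iterate, Finset.sum_range, Finset.sum_range, Finset.sum_range, sigmoidBet,
      ← mul_div_assoc]
    rfl

theorem iterate_lam_mem (hlam₀ : lam₀ ∈ Set.Icc 0 U) (n : ℕ) :
    (M.iterate U T π₀ lam₀ q n).lam ∈ Set.Icc 0 U := by
  rw [M.iterate_lam U T π₀ lam₀ q hlam₀]
  exact ⟨le_max_left _ _, max_le (hlam₀.1.trans hlam₀.2) (min_le_left _ _)⟩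

/-- An iterate depends on the earlier estimates only. -/
theorem iterate_congr {q q' : ℕ → Estimate S A} {n : ℕ} (h : ∀ i < n, q i = q' i) :
    M.iterate U T π₀ lam₀ q n = M.iterate U T π₀ lam₀ q' n := by
  induction n using Nat.strong_induction_on with
  | _ n ih =>
    cases n with
    | zero => simp only [iterate]
    | succ n =>
      have h1 : ∀ i : Fin (n + 1), M.iterate U T π₀ lam₀ q i.1 = M.iterate U T π₀ lam₀ q' i.1 :=
        fun i => ih i.1 i.2 fun j hj => h j (hj.trans i.2)
      have h2 : ∀ i : Fin (n + 1), q i.1 = q' i.1 := fun i => h i.1 i.2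
      rw [iterate, iterate]
      simp only [h1, h2]

end Recursion

/-! ### Regret bounds for arbitrary estimates with values in `[0, 1 / (1 - γ)]` -/

section Regret

variable (M : CMDP S A)

/-- Estimates with values in the range of discounted returns. -/
def IsBoundedEstimate (q : Estimate S A) : Prop :=
  ∀ s a, q.1 s a ∈ Set.Icc 0 (1 / (1 - M.γ)) ∧ q.2 s a ∈ Set.Icc 0 (1 / (1 - M.γ))

theorem isBoundedEstimate_estimate {m : ℕ} (hm : 0 < m) (B : Batch S A m) :
    M.IsBoundedEstimate (M.estimate B) := by
  have hm' : (0 : ℝ) < m := by exact_mod_cast hm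
  have h : ∀ {f : S → A → ℝ}, (∀ s a, f s a ∈ Set.Icc (0 : ℝ) 1) → ∀ s a,
      (∑ j, M.discReturn f (B (s, a, j))) / m ∈ Set.Icc 0 (1 / (1 - M.γ)) := by
    intro f hf s a
    constructor
    · exact div_nonneg (Finset.sum_nonneg fun j _ => (M.discReturn_mem hf _).1) hm'.le
    · rw [div_le_iff₀ hm']
      calc _ ≤ ∑ _j : Fin m, 1 / (1 - M.γ) :=
            Finset.sum_le_sum fun j _ => (M.discReturn_mem hf _).2
        _ = _ := by simp [mul_comm]
  exact fun s a => ⟨h M.r_mem s a, h M.c_mem s a⟩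

variable {M}

theorem valueHat_mem {q : Estimate S A} (hq : M.IsBoundedEstimate q) (π : Policy S A) :
    M.valueHat π q ∈ Set.Icc 0 (1 / (1 - M.γ)) :=
  sum_simplex_mul_mem _ fun s => sum_simplex_mul_mem _ fun a => (hq s a).2

theorem lagQ_mem {q : Estimate S A} (hq : M.IsBoundedEstimate q) {U lam : ℝ}
    (hlam : lam ∈ Set.Icc 0 U) (s : S) (a : A) :
    lagQ lam q s a ∈ Set.Icc 0 ((1 + U) * (1 / (1 - M.γ))) := by
  obtain ⟨⟨h1, h2⟩, h3, h4⟩ := hq s a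
  have h5 := mul_nonneg hlam.1 h3
  have h6 := mul_le_mul hlam.2 h4 h3 (hlam.1.trans hlam.2)
  unfold lagQ
  constructor <;> linarith

theorem abs_advHat_le {q : Estimate S A} (hq : M.IsBoundedEstimate q) {U : ℝ} {x : Iterate S A}
    (hlam : x.lam ∈ Set.Icc 0 U) (s : S) (a : A) : |M.advHat U x q s a| ≤ 1 := by
  have hU : 0 < 1 + U := by linarith [hlam.1.trans hlam.2]
  have hγ := M.one_sub_γ_pos
  obtain ⟨h1, h2⟩ := lagQ_mem hq hlam s a
  obtain ⟨h3, h4⟩ := sum_simplex_mul_mem (x.pol s) fun a => lagQ_mem hq hlam s a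
  have h5 : |lagQ x.lam q s a - ∑ a', x.pol s a' * lagQ x.lam q s a'| ≤
      (1 + U) * (1 / (1 - M.γ)) := abs_le.2 ⟨by linarith, by linarith⟩
  rw [advHat, abs_mul, abs_of_pos (div_pos hγ hU)]
  calc _ ≤ (1 - M.γ) / (1 + U) * ((1 + U) * (1 / (1 - M.γ))) := by gcongr
    _ = 1 := by field_simp

theorem abs_advTilde_le {q : Estimate S A} (hq : M.IsBoundedEstimate q) {U : ℝ}
    {x : Iterate S A} (hlam : x.lam ∈ Set.Icc 0 U) (s : S) (a : A) :
    |M.advTilde U x q s a| ≤ 1 := by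
  obtain ⟨h1, h2⟩ := abs_le.1 (abs_advHat_le hq hlam s a)
  unfold advTilde
  split_ifs
  · exact abs_le.2 ⟨h1, h2⟩
  · exact abs_le.2 ⟨by linarith [le_max_right (M.advHat U x q s a) 0], max_le h2 zero_le_one⟩

theorem advHat_le_advTilde (U : ℝ) (x : Iterate S A) (q : Estimate S A) (s : S) (a : A) :
    M.advHat U x q s a ≤ M.advTilde U x q s a := by
  unfold advTilde
  split_ifs
  · exact le_rfl
  · exact le_max_left _ _

theorem sum_pol_mul_advHat (U : ℝ) (x : Iterate S A) (q : Estimate S A) (s : S) :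
    ∑ a, x.pol s a * M.advHat U x q s a = 0 := by
  have : ∀ a, x.pol s a * M.advHat U x q s a = (1 - M.γ) / (1 + U) *
      (x.pol s a * lagQ x.lam q s a -
        x.pol s a * ∑ a', x.pol s a' * lagQ x.lam q s a') := fun a => by
    unfold advHat
    ring
  simp only [this, ← Finset.mul_sum, Finset.sum_sub_distrib, ← Finset.sum_mul,
    stdSimplex.sum_eq_one, one_mul, sub_self, mul_zero]

theorem mul_max_eq_coinPolicy (π₀ : Policy S A) (w : S → A → ℝ) (s : S) (a : A) :
    π₀ s a * max (w s a) 0 = (∑ a', π₀ s a' * max (w s a') 0) * coinPolicy π₀ w s a := by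
  unfold coinPolicy
  split_ifs with h
  · rw [h, zero_mul]
    exact (Finset.sum_eq_zero_iff_of_nonneg fun a _ =>
      mul_nonneg (stdSimplex.zero_le _ _) (le_max_right _ _)).1 h a (Finset.mem_univ a)
  · exact (mul_div_cancel₀ _ h).symm

/-- The bets do not lose on average under the prior. -/
theorem sum_advTilde_mul_w_le (U : ℝ) {x : Iterate S A} (q : Estimate S A) (π₀ : Policy S A)
    (hx : x.pol = coinPolicy π₀ x.w) (s : S) :
    ∑ a, π₀ s a * (M.advTilde U x q s a * x.w s a) ≤ 0 := by
  -- Where the bet is not positive, truncation makes the coin nonnegative, so the product is at most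
  -- `0`. The remaining terms are weighted proportionally to the current policy, under which the
  -- advantage averages to zero.
  calc _ ≤ ∑ a, π₀ s a * max (x.w s a) 0 * M.advHat U x q s a := by
        refine Finset.sum_le_sum fun a _ => ?_
        rw [mul_assoc]
        refine mul_le_mul_of_nonneg_left ?_ (stdSimplex.zero_le _ _)
        unfold advTilde
        split_ifs with h
        · rw [max_eq_left h.le, mul_comm]
        · rw [max_eq_right (not_lt.1 h), zero_mul]
          exact mul_nonpos_of_nonneg_of_nonpos (le_max_right _ _) (not_lt.1 h)
    _ = (∑ a', π₀ s a' * max (x.w s a') 0) * ∑ a, x.pol s a * M.advHat U x q s a := by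
        rw [Finset.mul_sum]
        exact Finset.sum_congr rfl fun a _ => by rw [mul_max_eq_coinPolicy, ← hx, mul_assoc]
    _ = 0 := by rw [sum_pol_mul_advHat, mul_zero]

variable {U : ℝ} {T : ℕ} {π₀ : Policy S A} {lam₀ : ℝ} {q : ℕ → Estimate S A}

/-- The regret of the dual player. -/
theorem dual_regret_le (hT : 0 < T) (hU : 1 ≤ U) (hb0 : 0 ≤ M.b) (hbL : M.b ≤ 1 / (1 - M.γ))
    (hlam₀ : lam₀ ∈ Set.Icc 0 U) (hq : ∀ i, M.IsBoundedEstimate (q i)) {lam : ℝ}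
    (hlam : lam = 0 ∨ lam = U) :
    ∑ t ∈ Finset.range T, ((M.iterate U T π₀ lam₀ q t).lam - lam) * M.marginHat U T π₀ lam₀ q t ≤
      1 / (1 - M.γ) * (√T * (4 * U * √(Real.log ((T + 1) * U)) + 1)) := by
  have hγ := M.one_sub_γ_pos
  set g := M.marginHat U T π₀ lam₀ q with hg
  set l := fun t => (M.iterate U T π₀ lam₀ q t).lam with hl
  have hc : ∀ i < T, |(1 - M.γ) * g i| ≤ 1 := by
    intro i _
    obtain ⟨h1, h2⟩ := valueHat_mem (hq i) (M.iterate U T π₀ lam₀ q i).pol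
    have h3 : |g i| ≤ 1 / (1 - M.γ) := by
      rw [hg, marginHat]
      exact abs_le.2 ⟨by linarith, by linarith⟩
    rw [abs_mul, abs_of_pos hγ]
    calc _ ≤ (1 - M.γ) * (1 / (1 - M.γ)) := by gcongr
      _ = 1 := by field_simp
  -- The bets are `lam₀ - λ_n` on the coins `(1 - γ) g_n`; projecting `λ` onto `[0, U]` clips them
  -- to `[-(U - lam₀), lam₀]`. The end points are the comparators `λ = U` and `λ = 0`.
  have hx : ∀ n < T, lam₀ - l n = max (-(U - lam₀)) (min lam₀
      (sigmoidBet ((∑ i ∈ Finset.range n, (1 - M.γ) * g i) /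
        (1 + ∑ i ∈ Finset.range n, |(1 - M.γ) * g i|)) *
        (1 + ∑ i ∈ Finset.range n, (lam₀ - l i) * ((1 - M.γ) * g i)))) := by
    intro n _
    have e1 : (∑ i ∈ Finset.range n, (1 - M.γ) * g i) /
        (1 + ∑ i ∈ Finset.range n, |(1 - M.γ) * g i|) =
        (∑ i ∈ Finset.range n, g i) / (1 / (1 - M.γ) + ∑ i ∈ Finset.range n, |g i|) := by
      simp only [abs_mul, abs_of_pos hγ, ← Finset.mul_sum]
      have h0 : 0 ≤ ∑ i ∈ Finset.range n, |g i| := Finset.sum_nonneg fun i _ => abs_nonneg _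
      have h1 : 0 < 1 + (1 - M.γ) * ∑ i ∈ Finset.range n, |g i| := by positivity
      field_simp
    have e2 : 1 + ∑ i ∈ Finset.range n, (lam₀ - l i) * ((1 - M.γ) * g i) =
        (1 - M.γ) * (1 / (1 - M.γ) - ∑ i ∈ Finset.range n, (l i - lam₀) * g i) := by
      have e3 : ∑ i ∈ Finset.range n, (lam₀ - l i) * ((1 - M.γ) * g i) =
          -((1 - M.γ) * ∑ i ∈ Finset.range n, (l i - lam₀) * g i) := by
        rw [Finset.mul_sum, ← Finset.sum_neg_distrib]
        exact Finset.sum_congr rfl fun i _ => by ring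
      rw [e3, mul_sub, mul_one_div_cancel hγ.ne', ← sub_eq_add_neg]
    rw [e1, e2, hl]
    simp only
    rw [M.iterate_lam U T π₀ lam₀ q hlam₀ n]
    simp only [max_def, min_def]
    have h1 := hlam₀.1
    have h2 := hlam₀.2
    rw [mul_comm (1 - M.γ) (sigmoidBet _), mul_assoc (sigmoidBet _)]
    split_ifs <;> linarith
  have h := clipped_regret_le (x := fun t => lam₀ - l t) hT hlam₀.1 (sub_nonneg.2 hlam₀.2)
    hlam₀.2 (sub_le_self U hlam₀.1) hU hc hx
  have h' : ∑ i ∈ Finset.range T, (l i - lam) * ((1 - M.γ) * g i) ≤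
      1 + U * (4 * √(T * Real.log ((T + 1) * U))) := by
    rcases hlam with rfl | rfl
    · refine le_of_eq_of_le (Finset.sum_congr rfl fun i _ => ?_) h.1
      ring
    · refine le_of_eq_of_le (Finset.sum_congr rfl fun i _ => ?_) h.2
      ring
  have e : ∑ i ∈ Finset.range T, (l i - lam) * ((1 - M.γ) * g i) =
      (1 - M.γ) * ∑ i ∈ Finset.range T, (l i - lam) * g i := by
    rw [Finset.mul_sum]
    exact Finset.sum_congr rfl fun i _ => by ring
  rw [e] at h'
  have hT1 : 1 ≤ √(T : ℝ) := Real.one_le_sqrt.2 (by exact_mod_cast hT)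
  rw [Real.sqrt_mul (by positivity)] at h'
  rw [one_div, inv_mul_eq_div, le_div_iff₀ hγ, mul_comm]
  linarith

end Regret

/-! ### Primal regret and decomposition of the Lagrangian gap -/

section PrimalRegret

variable [MeasurableSpace S] [DiscreteMeasurableSpace S]
  [MeasurableSpace A] [DiscreteMeasurableSpace A] {M : CMDP S A}
  {U : ℝ} {T : ℕ} {π₀ : Policy S A} {lam₀ : ℝ} {q : ℕ → Estimate S A}

/-- The regret of the primal player in one state. -/
theorem primal_regret_le (hT : 0 < T) (hlam₀ : lam₀ ∈ Set.Icc 0 U)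
    (hq : ∀ i, M.IsBoundedEstimate (q i)) (s : S) (p : stdSimplex ℝ A)
    (h : InformationTheory.klDiv (simplexMeasure p) (simplexMeasure (π₀ s)) ≠ ∞) :
    ∑ t ∈ Finset.range T, ∑ a, p a * M.advHat U (M.iterate U T π₀ lam₀ q t) (q t) s a ≤
      3 * √T * √(1 + (InformationTheory.klDiv (simplexMeasure p)
        (simplexMeasure (π₀ s))).toReal) := by
  have h1 := sum_coin_le_sqrt_klDiv p (π₀ s) h (c := fun t a => M.iterAdv U T π₀ lam₀ q t s a)
    (w := fun t a => (M.iterate U T π₀ lam₀ q t).w s a) hT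
    (fun i _ a => abs_advTilde_le (hq i) (M.iterate_lam_mem U T π₀ lam₀ q hlam₀ i) s a)
    (fun n _ a => M.iterate_w U T π₀ lam₀ q n s a)
    (fun i _ => sum_advTilde_mul_w_le U (q i) π₀ (M.iterate_pol U T π₀ lam₀ q i) s)
  refine le_trans ?_ h1
  rw [Finset.sum_comm]
  simp only [Finset.mul_sum]
  exact Finset.sum_le_sum fun a _ => Finset.sum_le_sum fun t _ =>
    mul_le_mul_of_nonneg_left (advHat_le_advTilde U _ _ s a) (stdSimplex.zero_le p a)

theorem occupation_nonneg (π : Policy S A) (s : S) : 0 ≤ M.occupation π s :=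
  (M.isFlow_occupation π).1 s

theorem sum_occupation (π : Policy S A) : ∑ s, M.occupation π s = 1 :=
  (M.isFlow_occupation π).sum_eq_one

/-- Jensen's inequality for the square, with the occupation measure as weights. -/
theorem sum_occupation_mul_sqrt_le {πs : Policy S A} (hKL : M.policyKL πs π₀ ≠ ∞) :
    ∑ s, M.occupation πs s * √(1 + (InformationTheory.klDiv (simplexMeasure (πs s))
      (simplexMeasure (π₀ s))).toReal) ≤ √(1 + (M.policyKL πs π₀).toReal) := by
  refine Real.le_sqrt_of_sq_le ?_
  have h1 := (even_two.convexOn_pow (𝕜 := ℝ)).map_sum_le (t := Finset.univ)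
    (w := fun s => M.occupation πs s)
    (p := fun s => √(1 + (InformationTheory.klDiv (simplexMeasure (πs s))
      (simplexMeasure (π₀ s))).toReal)) (fun s _ => occupation_nonneg πs s) (sum_occupation πs)
    (fun _ _ => Set.mem_univ _)
  simp only [smul_eq_mul] at h1
  refine h1.trans (le_of_eq ?_)
  have h2 : ∀ s, √(1 + (InformationTheory.klDiv (simplexMeasure (πs s))
      (simplexMeasure (π₀ s))).toReal) ^ 2 = 1 + (InformationTheory.klDiv
        (simplexMeasure (πs s)) (simplexMeasure (π₀ s))).toReal := fun s =>
    Real.sq_sqrt (add_nonneg zero_le_one ENNReal.toReal_nonneg)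
  simp only [h2, mul_add, mul_one, Finset.sum_add_distrib, sum_occupation]
  rw [policyKL, ENNReal.toReal_sum]
  · congr 1
    refine Finset.sum_congr rfl fun s _ => ?_
    rw [ENNReal.toReal_mul, ENNReal.toReal_ofReal (occupation_nonneg πs s)]
  · intro s _
    exact (ENNReal.sum_ne_top.1 hKL) s (Finset.mem_univ s)

/-- The regret of the primal player, averaged over the occupation measure of `πs`. -/
theorem sum_occupation_mul_lagQ_le {πs : Policy S A} (hKL : M.policyKL πs π₀ ≠ ∞) (hT : 0 < T)
    (hlam₀ : lam₀ ∈ Set.Icc 0 U) (hq : ∀ i, M.IsBoundedEstimate (q i)) :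
    ∑ t ∈ Finset.range T, ∑ s, M.occupation πs s * ∑ a,
      (πs s a - (M.iterate U T π₀ lam₀ q t).pol s a) *
        lagQ (M.iterate U T π₀ lam₀ q t).lam (q t) s a ≤
      (1 + U) * (1 / (1 - M.γ)) * (3 * √T * √(1 + (M.policyKL πs π₀).toReal)) := by
  have hU : 0 < 1 + U := by linarith [hlam₀.1.trans hlam₀.2]
  have hγ := M.one_sub_γ_pos
  have e : ∀ t s, ∑ a, (πs s a - (M.iterate U T π₀ lam₀ q t).pol s a) *
        lagQ (M.iterate U T π₀ lam₀ q t).lam (q t) s a = (1 + U) * (1 / (1 - M.γ)) *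
      ∑ a, πs s a * M.advHat U (M.iterate U T π₀ lam₀ q t) (q t) s a := by
    intro t s
    have h1 : ∀ a, πs s a * M.advHat U (M.iterate U T π₀ lam₀ q t) (q t) s a =
        (1 - M.γ) / (1 + U) * (πs s a * lagQ (M.iterate U T π₀ lam₀ q t).lam (q t) s a -
          πs s a * ∑ a', (M.iterate U T π₀ lam₀ q t).pol s a' *
            lagQ (M.iterate U T π₀ lam₀ q t).lam (q t) s a') := fun a => by
      unfold advHat
      ring
    simp only [h1, ← Finset.mul_sum, sub_mul, Finset.sum_sub_distrib, ← Finset.sum_mul,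
      stdSimplex.sum_eq_one, one_mul]
    field_simp
  simp only [e]
  rw [Finset.sum_comm]
  have e2 : ∀ s, ∑ t ∈ Finset.range T, M.occupation πs s * ((1 + U) * (1 / (1 - M.γ)) *
      ∑ a, πs s a * M.advHat U (M.iterate U T π₀ lam₀ q t) (q t) s a) =
      (1 + U) * (1 / (1 - M.γ)) * (M.occupation πs s * ∑ t ∈ Finset.range T,
        ∑ a, πs s a * M.advHat U (M.iterate U T π₀ lam₀ q t) (q t) s a) := fun s => by
    simp only [Finset.mul_sum]
    exact Finset.sum_congr rfl fun t _ => Finset.sum_congr rfl fun a _ => by ring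
  simp only [e2, ← Finset.mul_sum]
  refine mul_le_mul_of_nonneg_left ?_ (by positivity)
  calc _ ≤ ∑ s, M.occupation πs s * (3 * √T * √(1 + (InformationTheory.klDiv
        (simplexMeasure (πs s)) (simplexMeasure (π₀ s))).toReal)) := by
        refine Finset.sum_le_sum fun s _ => ?_
        -- Finiteness of the averaged entropy says nothing about states that `πs` never visits, but
        -- these carry weight zero.
        rcases (occupation_nonneg (M := M) πs s).eq_or_lt with h0 | h0
        · rw [← h0, zero_mul, zero_mul]
        · refine mul_le_mul_of_nonneg_left (primal_regret_le hT hlam₀ hq s (πs s) ?_) h0.le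
          intro htop
          have := (ENNReal.sum_ne_top.1 hKL) s (Finset.mem_univ s)
          rw [htop] at this
          exact this (ENNReal.mul_top (by simpa using h0))
    _ = 3 * √T * ∑ s, M.occupation πs s * √(1 + (InformationTheory.klDiv
        (simplexMeasure (πs s)) (simplexMeasure (π₀ s))).toReal) := by
        rw [Finset.mul_sum]
        exact Finset.sum_congr rfl fun s _ => by ring
    _ ≤ _ := mul_le_mul_of_nonneg_left (sum_occupation_mul_sqrt_le hKL) (by positivity)

/-- The contribution of the estimation errors of one iteration to the regret against the dual
variable `lam`. -/
def noise (M : CMDP S A) (πs : Policy S A) (lam : ℝ) (x : Iterate S A) (q : Estimate S A) : ℝ :=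
  1 / (1 - M.γ) * ∑ s, M.occupation πs s * ∑ a, (πs s a - x.pol s a) *
      ((M.actionValue M.r x.pol s a - q.1 s a) + x.lam * (M.actionValue M.c x.pol s a - q.2 s a)) +
    (x.lam - lam) * ∑ s, M.ρ s * ∑ a, x.pol s a * (M.actionValue M.c x.pol s a - q.2 s a)

theorem sum_sub_mul_actionValue {f : S → A → ℝ} (hf : ∀ s a, f s a ∈ Set.Icc (0 : ℝ) 1)
    (πs π : Policy S A) :
    1 / (1 - M.γ) * ∑ s, M.occupation πs s * ∑ a, (πs s a - π s a) * M.actionValue f π s a =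
      M.value f πs - M.value f π := by
  have h := (M.isFlow_occupation πs).sum_advantage hf π
  rw [(M.isFlow_occupation πs).sum_eq_value hf, ← mul_sub] at h
  have e : ∀ s, ∑ a, (πs s a - π s a) * M.actionValue f π s a =
      ∑ a, πs s a * (M.actionValue f π s a - M.V f π s) := fun s => by
    simp only [sub_mul, mul_sub, Finset.sum_sub_distrib, ← Finset.sum_mul, stdSimplex.sum_eq_one,
      one_mul, ← M.V_eq hf]
  simp only [e]
  rw [h, ← mul_assoc, one_div_mul_cancel M.one_sub_γ_pos.ne', one_mul]

/-- With exact action values, the primal and dual terms together exceed the left side by `λ_t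
(V_c^{π*} - b) ≥ 0`, as `πs` is feasible. Replacing action values by estimates costs exactly
`noise`. -/
theorem lagrangian_gap_le {πs : Policy S A} (hπs : M.b ≤ M.value M.c πs) {lam : ℝ}
    (x : Iterate S A) (hx : 0 ≤ x.lam) (q : Estimate S A) :
    M.value M.r πs - M.value M.r x.pol + lam * (M.b - M.value M.c x.pol) ≤
      1 / (1 - M.γ) * ∑ s, M.occupation πs s * ∑ a, (πs s a - x.pol s a) * lagQ x.lam q s a +
        (x.lam - lam) * (M.valueHat x.pol q - M.b) + M.noise πs lam x q := by
  have hr := sum_sub_mul_actionValue (M := M) M.r_mem πs x.pol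
  have hc := sum_sub_mul_actionValue (M := M) M.c_mem πs x.pol
  have e1 : ∑ s, M.occupation πs s * ∑ a, (πs s a - x.pol s a) * lagQ x.lam q s a +
      ∑ s, M.occupation πs s * ∑ a, (πs s a - x.pol s a) *
      ((M.actionValue M.r x.pol s a - q.1 s a) +
        x.lam * (M.actionValue M.c x.pol s a - q.2 s a)) =
      ∑ s, M.occupation πs s * ∑ a, (πs s a - x.pol s a) * M.actionValue M.r x.pol s a +
        x.lam * ∑ s, M.occupation πs s * ∑ a,
          (πs s a - x.pol s a) * M.actionValue M.c x.pol s a := by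
    simp only [Finset.mul_sum, ← Finset.sum_add_distrib]
    refine Finset.sum_congr rfl fun s _ => Finset.sum_congr rfl fun a _ => ?_
    unfold lagQ
    ring
  have e2 : M.valueHat x.pol q +
      ∑ s, M.ρ s * ∑ a, x.pol s a * (M.actionValue M.c x.pol s a - q.2 s a) =
      M.value M.c x.pol := by
    simp only [value, M.V_eq M.c_mem, valueHat, Finset.mul_sum, ← Finset.sum_add_distrib]
    refine Finset.sum_congr rfl fun s _ => Finset.sum_congr rfl fun a _ => ?_
    ring
  have h := mul_nonneg hx (sub_nonneg.2 hπs)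
  have e3 := congrArg (1 / (1 - M.γ) * ·) e1
  simp only [mul_add] at e3
  rw [hr, mul_left_comm _ x.lam, hc] at e3
  have e4 : ∑ s, M.ρ s * ∑ a, x.pol s a * (M.actionValue M.c x.pol s a - q.2 s a) =
      M.value M.c x.pol - M.valueHat x.pol q := by linarith
  rw [noise, e4]
  simp only [mul_add]
  linarith

/-- The deterministic part of the analysis. -/
theorem sum_lagrangian_gap_le {πs : Policy S A} (hπs : M.b ≤ M.value M.c πs)
    (hKL : M.policyKL πs π₀ ≠ ∞) (hT : 0 < T) (hU : 1 ≤ U) (hb0 : 0 ≤ M.b)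
    (hbL : M.b ≤ 1 / (1 - M.γ)) (hlam₀ : lam₀ ∈ Set.Icc 0 U)
    (hq : ∀ i, M.IsBoundedEstimate (q i)) {lam : ℝ} (hlam : lam = 0 ∨ lam = U) :
    ∑ t ∈ Finset.range T, (M.value M.r πs - M.value M.r (M.iterate U T π₀ lam₀ q t).pol) +
      lam * ∑ t ∈ Finset.range T, (M.b - M.value M.c (M.iterate U T π₀ lam₀ q t).pol) ≤
      √T / (1 - M.γ) * (3 * (1 + U) * √(1 + (M.policyKL πs π₀).toReal) / (1 - M.γ) +
        (4 * U * √(Real.log ((T + 1) * U)) + 1)) +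
      ∑ t ∈ Finset.range T, M.noise πs lam (M.iterate U T π₀ lam₀ q t) (q t) := by
  have h1 := dual_regret_le (π₀ := π₀) hT hU hb0 hbL hlam₀ hq hlam
  have h2 := sum_occupation_mul_lagQ_le hKL hT hlam₀ hq
  have h3 := Finset.sum_le_sum fun t (_ : t ∈ Finset.range T) =>
    lagrangian_gap_le hπs (lam := lam) (M.iterate U T π₀ lam₀ q t)
      (M.iterate_lam_mem U T π₀ lam₀ q hlam₀ t).1 (q t)
  simp only [Finset.sum_add_distrib, ← Finset.mul_sum] at h3
  have h4 := mul_le_mul_of_nonneg_left h2 (one_div_nonneg.2 M.one_sub_γ_pos.le)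
  refine h3.trans ?_
  have e : √T / (1 - M.γ) * (3 * (1 + U) * √(1 + (M.policyKL πs π₀).toReal) / (1 - M.γ) +
        (4 * U * √(Real.log ((T + 1) * U)) + 1)) =
      1 / (1 - M.γ) * ((1 + U) * (1 / (1 - M.γ)) *
        (3 * √T * √(1 + (M.policyKL πs π₀).toReal))) +
      1 / (1 - M.γ) * (√T * (4 * U * √(Real.log ((T + 1) * U)) + 1)) := by
    have := M.one_sub_γ_pos.ne'
    field_simp
  rw [e]
  exact add_le_add (add_le_add h4 h1) le_rfl

end PrimalRegret

end CMDP

/-! ### Exponential moments along a trajectory of kernels -/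

section Trajectory

variable {Ω : Type*} [MeasurableSpace Ω]

/-- The history `h` up to time `n`, continued by the constant `x`. -/
def extendHistory (n : ℕ) (p : ((i : Finset.Iic n) → Ω) × Ω) (i : ℕ) : Ω :=
  if hi : i ≤ n then p.1 ⟨i, Finset.mem_Iic.2 hi⟩ else p.2

theorem measurable_extendHistory (n : ℕ) : Measurable (extendHistory (Ω := Ω) n) := by
  refine measurable_pi_lambda _ fun i => ?_
  unfold extendHistory
  by_cases hi : i ≤ n
  · simp only [hi, dite_true]
    fun_prop
  · simp only [hi, dite_false]
    fun_prop

/-- The tower property, written with `Function.update` so that `G` remains a function of whole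
sequences; `extendHistory` factors it through the history and the next point. -/
theorem lintegral_trajMeasure_succ {μ₀ : Measure Ω} [IsProbabilityMeasure μ₀]
    {κ : (n : ℕ) → Kernel ((i : Finset.Iic n) → Ω) Ω} [∀ n, IsMarkovKernel (κ n)] (n : ℕ)
    {G : (ℕ → Ω) → ℝ≥0∞} (hG : Measurable G)
    (hdep : ∀ ω ω' : ℕ → Ω, (∀ i ≤ n + 1, ω i = ω' i) → G ω = G ω') :
    ∫⁻ ω, G ω ∂Kernel.trajMeasure (X := fun _ => Ω) μ₀ κ =
      ∫⁻ ω, ∫⁻ x, G (Function.update ω (n + 1) x)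
        ∂κ n (Preorder.frestrictLe (π := fun _ => Ω) n ω)
        ∂Kernel.trajMeasure (X := fun _ => Ω) μ₀ κ := by
  have hm := hG.comp (measurable_extendHistory (Ω := Ω) n)
  have h := Kernel.map_frestrictLe_trajMeasure_compProd_eq_map_trajMeasure
    (X := fun _ => Ω) (μ₀ := μ₀) (κ := κ) (a := n)
  have e1 : ∀ ω : ℕ → Ω, G ω = (G ∘ extendHistory n)
      (Preorder.frestrictLe (π := fun _ => Ω) n ω, ω (n + 1)) := by
    intro ω
    refine hdep _ _ fun i hi => ?_
    unfold extendHistory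
    split_ifs with h'
    · rfl
    · rw [show i = n + 1 by omega]
  have e2 : ∀ (ω : ℕ → Ω) (x : Ω), G (Function.update ω (n + 1) x) = (G ∘ extendHistory n)
      (Preorder.frestrictLe (π := fun _ => Ω) n ω, x) := by
    intro ω x
    refine hdep _ _ fun i hi => ?_
    unfold extendHistory
    split_ifs with h'
    · rw [Function.update_of_ne (by omega)]
      rfl
    · rw [show i = n + 1 by omega, Function.update_self]
  have : IsProbabilityMeasure ((Kernel.trajMeasure (X := fun _ => Ω) μ₀ κ).map
      (Preorder.frestrictLe (π := fun _ => Ω) n)) :=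
    Measure.isProbabilityMeasure_map (by fun_prop)
  simp only [e2]
  calc _ = ∫⁻ ω, (G ∘ extendHistory n) (Preorder.frestrictLe (π := fun _ => Ω) n ω, ω (n + 1))
        ∂Kernel.trajMeasure (X := fun _ => Ω) μ₀ κ := lintegral_congr e1
    _ = ∫⁻ p, (G ∘ extendHistory n) p ∂(Kernel.trajMeasure (X := fun _ => Ω) μ₀ κ).map
          (fun ω => (Preorder.frestrictLe (π := fun _ => Ω) n ω, ω (n + 1))) :=
        (lintegral_map hm (by fun_prop)).symm
    _ = _ := by
      rw [← h, Measure.lintegral_compProd hm, lintegral_map _ (by fun_prop)]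
      exact hm.lintegral_kernel_prod_right'

theorem lintegral_trajMeasure_zero {μ₀ : Measure Ω} [IsProbabilityMeasure μ₀]
    {κ : (n : ℕ) → Kernel ((i : Finset.Iic n) → Ω) Ω} [∀ n, IsMarkovKernel (κ n)]
    {G : (ℕ → Ω) → ℝ≥0∞} (hG : Measurable G)
    (hdep : ∀ ω ω' : ℕ → Ω, ω 0 = ω' 0 → G ω = G ω') :
    ∫⁻ ω, G ω ∂Kernel.trajMeasure (X := fun _ => Ω) μ₀ κ = ∫⁻ x, G (fun _ => x) ∂μ₀ := by
  have h : (Kernel.trajMeasure (X := fun _ => Ω) μ₀ κ).map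
      (Preorder.frestrictLe (π := fun _ => Ω) 0) =
      μ₀.map (MeasurableEquiv.piUnique (fun _ : Finset.Iic 0 => Ω)).symm := by
    rw [Kernel.trajMeasure, Measure.map_comp _ _ (by fun_prop),
      Kernel.traj_map_frestrictLe, Kernel.partialTraj_self, Measure.id_comp]
  have hm : Measurable fun y : (i : Finset.Iic 0) → Ω =>
      G (fun _ => y ⟨0, Finset.mem_Iic.2 le_rfl⟩) :=
    hG.comp (measurable_pi_lambda _ fun _ => measurable_pi_apply _)
  calc _ = ∫⁻ ω, (fun y : (i : Finset.Iic 0) → Ω => G (fun _ => y ⟨0, Finset.mem_Iic.2 le_rfl⟩))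
        (Preorder.frestrictLe (π := fun _ => Ω) 0 ω)
        ∂Kernel.trajMeasure (X := fun _ => Ω) μ₀ κ := lintegral_congr fun ω => hdep _ _ rfl
    _ = _ := by
      rw [← lintegral_map hm (by fun_prop), h, lintegral_map hm (by fun_prop)]
      rfl

/-- The exponential moment of a sum whose increments have conditional exponential moments at
most `C`. -/
theorem lintegral_exp_sum_trajMeasure_le {μ₀ : Measure Ω} [IsProbabilityMeasure μ₀]
    {κ : (n : ℕ) → Kernel ((i : Finset.Iic n) → Ω) Ω} [∀ n, IsMarkovKernel (κ n)]
    {F : ℕ → (ℕ → Ω) → ℝ} (hF : ∀ n, Measurable (F n))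
    (hdep : ∀ n, ∀ ω ω' : ℕ → Ω, (∀ i ≤ n, ω i = ω' i) → F n ω = F n ω') {C : ℝ≥0∞}
    (h0 : ∫⁻ x, ENNReal.ofReal (Real.exp (F 0 fun _ => x)) ∂μ₀ ≤ C)
    (hC : ∀ n ω, ∫⁻ x, ENNReal.ofReal (Real.exp (F (n + 1) (Function.update ω (n + 1) x)))
      ∂κ n (Preorder.frestrictLe (π := fun _ => Ω) n ω) ≤ C) (n : ℕ) :
    ∫⁻ ω, ENNReal.ofReal (Real.exp (∑ k ∈ Finset.range (n + 1), F k ω))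
      ∂Kernel.trajMeasure (X := fun _ => Ω) μ₀ κ ≤ C ^ (n + 1) := by
  induction n with
  | zero =>
    simp only [zero_add, Finset.sum_range_one, pow_one]
    rw [lintegral_trajMeasure_zero (hF 0).exp.ennreal_ofReal fun ω ω' h => ?_]
    · exact h0
    · rw [hdep 0 ω ω' fun i hi => by rw [Nat.le_zero.1 hi, h]]
  | succ n ih =>
    have hm : ∀ n, Measurable fun ω => ENNReal.ofReal
        (Real.exp (∑ k ∈ Finset.range (n + 1), F k ω)) := fun n =>
      (Finset.measurable_fun_sum _ fun k _ => hF k).exp.ennreal_ofReal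
    rw [lintegral_trajMeasure_succ n (hm (n + 1)) fun ω ω' h => ?_]
    · calc _ ≤ ∫⁻ ω, ENNReal.ofReal (Real.exp (∑ k ∈ Finset.range (n + 1), F k ω)) * C
            ∂Kernel.trajMeasure (X := fun _ => Ω) μ₀ κ := by
            refine lintegral_mono fun ω => ?_
            have e : ∀ x, ENNReal.ofReal (Real.exp (∑ k ∈ Finset.range (n + 1 + 1),
                F k (Function.update ω (n + 1) x))) =
                ENNReal.ofReal (Real.exp (∑ k ∈ Finset.range (n + 1), F k ω)) *
                ENNReal.ofReal (Real.exp (F (n + 1) (Function.update ω (n + 1) x))) := by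
              intro x
              rw [Finset.sum_range_succ, Real.exp_add, ENNReal.ofReal_mul (Real.exp_pos _).le]
              congr 3
              refine Finset.sum_congr rfl fun k hk => hdep k _ _ fun i hi => ?_
              have := Finset.mem_range.1 hk
              rw [Function.update_of_ne (by omega)]
            simp only [e]
            rw [lintegral_const_mul' _ _ ENNReal.ofReal_ne_top]
            gcongr
            exact hC n ω
        _ = _ := lintegral_mul_const _ (hm n)
        _ ≤ C ^ (n + 1) * C := by gcongr
        _ = _ := (pow_succ _ _).symm
    · congr 2
      refine Finset.sum_congr rfl fun k hk => hdep k _ _ fun i hi => h i ?_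
      have := Finset.mem_range.1 hk
      omega

end Trajectory

namespace CMDP

variable {S A : Type*} [Fintype S] [Fintype A]

/-! ### Sub-Gaussian estimation errors and the tail of their sum -/

section Concentration

variable [MeasurableSpace S] [DiscreteMeasurableSpace S]
  [MeasurableSpace A] [DiscreteMeasurableSpace A] (M : CMDP S A)

theorem neg_mul_mem_Icc {α x L : ℝ} (hx : x ∈ Set.Icc 0 L) :
    -(α * x) ∈ Set.Icc (-(max α 0 * L)) (max (-α) 0 * L) := by
  obtain ⟨h0, h1⟩ := hx
  rcases le_total 0 α with h | h
  · rw [max_eq_left h, max_eq_right (by linarith)]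
    constructor <;> nlinarith
  · rw [max_eq_right h, max_eq_left (by linarith)]
    constructor <;> nlinarith

/-- Hoeffding's lemma for one trajectory. Both returns come from the same trajectory and are
dependent, so their ranges are added: the combination lies in an interval of length `(|α| + |β|) /
(1 - γ)`. -/
theorem hasSubgaussianMGF_return (π : Policy S A) (s : S) (a : A) (α β : ℝ) :
    HasSubgaussianMGF (fun τ => α * (M.actionValue M.r π s a - M.discReturn M.r τ) +
        β * (M.actionValue M.c π s a - M.discReturn M.c τ))
      ((‖(|α| + |β|) * (1 / (1 - M.γ))‖₊ / 2) ^ 2) (M.pathLaw π (Measure.dirac (s, a))) := by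
  have hr := M.measurable_discReturn M.r
  have hc := M.measurable_discReturn M.c
  have hir : Integrable (M.discReturn M.r) (M.pathLaw π (Measure.dirac (s, a))) :=
    Integrable.of_mem_Icc _ _ hr.aemeasurable
      (Filter.Eventually.of_forall (M.discReturn_mem M.r_mem))
  have hic : Integrable (M.discReturn M.c) (M.pathLaw π (Measure.dirac (s, a))) :=
    Integrable.of_mem_Icc _ _ hc.aemeasurable
      (Filter.Eventually.of_forall (M.discReturn_mem M.c_mem))
  have h := hasSubgaussianMGF_of_mem_Icc (μ := M.pathLaw π (Measure.dirac (s, a)))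
    (X := fun τ => -(α * M.discReturn M.r τ) + -(β * M.discReturn M.c τ))
    (a := -(max α 0 * (1 / (1 - M.γ))) + -(max β 0 * (1 / (1 - M.γ))))
    (b := max (-α) 0 * (1 / (1 - M.γ)) + max (-β) 0 * (1 / (1 - M.γ)))
    ((hr.const_mul α).neg.add (hc.const_mul β).neg).aemeasurable
    (Filter.Eventually.of_forall fun τ => by
      have h1 := neg_mul_mem_Icc (α := α) (M.discReturn_mem M.r_mem τ)
      have h2 := neg_mul_mem_Icc (α := β) (M.discReturn_mem M.c_mem τ)
      exact ⟨add_le_add h1.1 h2.1, add_le_add h1.2 h2.2⟩)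
  have e1 : ∀ x : ℝ, |x| = max x 0 + max (-x) 0 := fun x => by
    rcases le_total 0 x with h | h
    · rw [abs_of_nonneg h, max_eq_left h, max_eq_right (by linarith), add_zero]
    · rw [abs_of_nonpos h, max_eq_right h, max_eq_left (by linarith), zero_add]
  have e2 : max (-α) 0 * (1 / (1 - M.γ)) + max (-β) 0 * (1 / (1 - M.γ)) -
      (-(max α 0 * (1 / (1 - M.γ))) + -(max β 0 * (1 / (1 - M.γ)))) =
      (|α| + |β|) * (1 / (1 - M.γ)) := by
    rw [e1 α, e1 β]
    ring
  have e3 : ∫ τ, -(α * M.discReturn M.r τ) + -(β * M.discReturn M.c τ)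
      ∂M.pathLaw π (Measure.dirac (s, a)) =
      -(α * M.actionValue M.r π s a) + -(β * M.actionValue M.c π s a) := by
    refine (integral_add (hir.const_mul α).neg (hic.const_mul β).neg).trans ?_
    simp only [Pi.neg_apply]
    rw [integral_neg, integral_neg, integral_const_mul, integral_const_mul]
    rfl
  rw [e2, e3] at h
  refine h.congr (Filter.Eventually.of_forall fun τ => ?_)
  ring

/-- The exponential moments of a linear combination of the estimation errors of one iteration. -/
theorem lintegral_exp_batchLaw_le {m : ℕ} (hm : 0 < m) (π : Policy S A) (α β : S → A → ℝ)
    {σ : ℝ} (hσ : ∑ s, ∑ a, (|α s a| + |β s a|) ≤ σ) (t : ℝ) :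
    ∫⁻ B, ENNReal.ofReal (Real.exp (t * ∑ s, ∑ a,
      (α s a * (M.actionValue M.r π s a - (M.estimate B).1 s a) +
        β s a * (M.actionValue M.c π s a - (M.estimate B).2 s a)))) ∂M.batchLaw m π ≤
      ENNReal.ofReal (Real.exp ((σ * (1 / (1 - M.γ))) ^ 2 / (4 * m) * t ^ 2 / 2)) := by
  have hm' : (0 : ℝ) < m := by exact_mod_cast hm
  have hL : 0 ≤ 1 / (1 - M.γ) := one_div_nonneg.2 M.one_sub_γ_pos.le
  let Y : S × A × Fin m → Trajectory S A → ℝ := fun x τ =>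
    α x.1 x.2.1 / m * (M.actionValue M.r π x.1 x.2.1 - M.discReturn M.r τ) +
      β x.1 x.2.1 / m * (M.actionValue M.c π x.1 x.2.1 - M.discReturn M.c τ)
  have hsub : ∀ x, HasSubgaussianMGF (Y x)
      ((‖(|α x.1 x.2.1 / m| + |β x.1 x.2.1 / m|) * (1 / (1 - M.γ))‖₊ / 2) ^ 2)
      (M.pathLaw π (Measure.dirac (x.1, x.2.1))) := fun x =>
    M.hasSubgaussianMGF_return π x.1 x.2.1 _ _
  have hind : iIndepFun (fun x (B : Batch S A m) => Y x (B x)) (M.batchLaw m π) :=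
    iIndepFun_pi fun x => (hsub x).aemeasurable
  have hsum := HasSubgaussianMGF.sum_of_iIndepFun hind (s := Finset.univ)
    (c := fun x => (‖(|α x.1 x.2.1 / m| + |β x.1 x.2.1 / m|) * (1 / (1 - M.γ))‖₊ / 2) ^ 2)
    fun x _ => by
      change HasSubgaussianMGF (Y x ∘ fun B : Batch S A m => B x) _ _
      refine HasSubgaussianMGF.of_map (Y := fun B : Batch S A m => B x)
        (measurable_pi_apply x).aemeasurable ?_
      have : (M.batchLaw m π).map (fun B => B x) =
          M.pathLaw π (Measure.dirac (x.1, x.2.1)) :=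
        (measurePreserving_eval (fun x : S × A × Fin m =>
          M.pathLaw π (Measure.dirac (x.1, x.2.1))) x).map_eq
      rw [this]
      exact hsub x
  have hsumY : ∀ B : Batch S A m, ∑ x, Y x (B x) = ∑ s, ∑ a,
      (α s a * (M.actionValue M.r π s a - (M.estimate B).1 s a) +
        β s a * (M.actionValue M.c π s a - (M.estimate B).2 s a)) := by
    intro B
    rw [Fintype.sum_prod_type]
    refine Finset.sum_congr rfl fun s _ => ?_
    rw [Fintype.sum_prod_type]
    refine Finset.sum_congr rfl fun a _ => ?_
    simp only [Y, estimate, Finset.sum_add_distrib, ← Finset.mul_sum, Finset.sum_sub_distrib,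
      Finset.sum_const, Finset.card_univ, Fintype.card_fin, nsmul_eq_mul]
    field_simp
  simp only [← hsumY]
  rw [← ofReal_integral_eq_lintegral_ofReal (hsum.integrable_exp_mul t)
    (Filter.Eventually.of_forall fun _ => (Real.exp_pos _).le)]
  refine ENNReal.ofReal_le_ofReal ((hsum.mgf_le t).trans (Real.exp_le_exp.2 ?_))
  -- Variance proxies of independent trajectories add up. The `m` copies, each scaled by `1 / m`,
  -- leave `1 / (4 m)`, and a sum of squares is at most the square of the sum.
  have hcsum : ((∑ x : S × A × Fin m, (‖(|α x.1 x.2.1 / m| + |β x.1 x.2.1 / m|) *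
      (1 / (1 - M.γ))‖₊ / 2) ^ 2 : NNReal) : ℝ) ≤ (σ * (1 / (1 - M.γ))) ^ 2 / (4 * m) := by
    push_cast
    rw [Fintype.sum_prod_type]
    simp only [Fintype.sum_prod_type]
    have e : ∀ s a, (‖(|α s a / m| + |β s a / m|) * (1 / (1 - M.γ))‖ / 2) ^ 2 =
        (|α s a| + |β s a|) ^ 2 * ((1 / (1 - M.γ)) ^ 2 / (4 * m ^ 2)) := by
      intro s a
      rw [Real.norm_eq_abs, div_pow, sq_abs, abs_div, abs_div, abs_of_pos hm']
      field_simp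
      norm_num
    simp only [e, Finset.sum_const, Finset.card_univ, Fintype.card_fin, nsmul_eq_mul]
    have h1 : ∑ s, ∑ a, (|α s a| + |β s a|) ^ 2 ≤ σ ^ 2 := by
      have h2 : ∑ s, ∑ a, (|α s a| + |β s a|) ^ 2 ≤ (∑ s, ∑ a, (|α s a| + |β s a|)) ^ 2 := by
        rw [← Fintype.sum_prod_type' (f := fun s a => (|α s a| + |β s a|) ^ 2),
          ← Fintype.sum_prod_type' (f := fun s a => |α s a| + |β s a|)]
        exact Finset.sum_sq_le_sq_sum_of_nonneg fun x _ => by positivity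
      refine h2.trans (pow_le_pow_left₀ ?_ hσ 2)
      exact Finset.sum_nonneg fun s _ => Finset.sum_nonneg fun a _ => by positivity
    have e3 : ∑ s, ∑ a, (m : ℝ) * ((|α s a| + |β s a|) ^ 2 *
        ((1 / (1 - M.γ)) ^ 2 / (4 * m ^ 2))) =
        (∑ s, ∑ a, (|α s a| + |β s a|) ^ 2) * ((1 / (1 - M.γ)) ^ 2 / (4 * m)) := by
      simp only [Finset.sum_mul]
      refine Finset.sum_congr rfl fun s _ => Finset.sum_congr rfl fun a _ => ?_
      field_simp
    rw [e3, mul_pow, mul_div_assoc]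
    gcongr
  gcongr

theorem measurable_actionValue (f : S → A → ℝ) (s : S) (a : A) :
    Measurable fun π : Policy S A => M.actionValue f π s a := by
  let κ : Kernel (Policy S A) (Trajectory S A) :=
    ⟨fun π => M.pathLaw π (Measure.dirac (s, a)), M.measurable_pathLaw _⟩
  exact (StronglyMeasurable.integral_kernel (κ := κ)
    (M.measurable_discReturn f).stronglyMeasurable).measurable

theorem measurable_noise (πs : Policy S A) (lam : ℝ) {Ω : Type*} [MeasurableSpace Ω]
    {x : Ω → Iterate S A} {q : Ω → Estimate S A} (hpol : Measurable fun ω => (x ω).pol)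
    (hlam : Measurable fun ω => (x ω).lam) (hq : Measurable q) :
    Measurable fun ω => M.noise πs lam (x ω) (q ω) := by
  have hQ : ∀ f s a, Measurable fun ω => M.actionValue f (x ω).pol s a := fun f s a =>
    (M.measurable_actionValue f s a).comp hpol
  have hp : ∀ s a, Measurable fun ω => (x ω).pol s a := fun s a =>
    (measurable_simplex_apply a).comp ((measurable_pi_apply s).comp hpol)
  have hq1 : ∀ s a, Measurable fun ω => (q ω).1 s a := fun s a =>
    (measurable_pi_apply a).comp ((measurable_pi_apply s).comp hq.fst)
  have hq2 : ∀ s a, Measurable fun ω => (q ω).2 s a := fun s a =>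
    (measurable_pi_apply a).comp ((measurable_pi_apply s).comp hq.snd)
  unfold noise
  refine Measurable.add (Measurable.const_mul (Finset.measurable_fun_sum _ fun s _ =>
    Measurable.const_mul (Finset.measurable_fun_sum _ fun a _ => ?_) _) _)
    ((hlam.sub_const _).mul (Finset.measurable_fun_sum _ fun s _ =>
    Measurable.const_mul (Finset.measurable_fun_sum _ fun a _ => ?_) _))
  · exact (measurable_const.sub (hp s a)).mul (((hQ _ s a).sub (hq1 s a)).add
      (hlam.mul ((hQ _ s a).sub (hq2 s a))))
  · exact (hp s a).mul ((hQ _ s a).sub (hq2 s a))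

theorem sum_simplex_abs_sub_le {X : Type*} [Fintype X] (p p' : stdSimplex ℝ X) :
    ∑ x, |p x - p' x| ≤ 2 := by
  calc _ ≤ ∑ x, (p x + p' x) := Finset.sum_le_sum fun x _ => by
        have h1 := stdSimplex.zero_le p x
        have h2 := stdSimplex.zero_le p' x
        exact abs_le.2 ⟨by linarith, by linarith⟩
    _ = 2 := by
        rw [Finset.sum_add_distrib, stdSimplex.sum_eq_one, stdSimplex.sum_eq_one]
        norm_num

/-- The errors enter linearly. As policies differ by at most `2` in `ℓ¹` and occupation measures
have mass `1`, with `L = 1 / (1 - γ)` the coefficients sum to at most `2 L + U (2 L + 1) ≤ 2 (1 + 2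
U) L`. -/
theorem lintegral_exp_noise_le {m : ℕ} (hm : 0 < m) (πs : Policy S A) {lam U : ℝ}
    (hU : 0 ≤ U) (hlam : lam ∈ Set.Icc 0 U) (x : Iterate S A) (hx : x.lam ∈ Set.Icc 0 U) (t : ℝ) :
    ∫⁻ B, ENNReal.ofReal (Real.exp (t * M.noise πs lam x (M.estimate B))) ∂M.batchLaw m x.pol ≤
      ENNReal.ofReal (Real.exp (((1 + 2 * U) * (1 / (1 - M.γ)) ^ 2) ^ 2 / m * t ^ 2 / 2)) := by
  have hγ := M.one_sub_γ_pos
  have hL : 1 ≤ 1 / (1 - M.γ) := by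
    rw [le_div_iff₀ hγ]
    linarith [M.γ_nonneg]
  have hL0 : 0 ≤ 1 / (1 - M.γ) := by linarith
  let α : S → A → ℝ := fun s a => 1 / (1 - M.γ) * M.occupation πs s * (πs s a - x.pol s a)
  let β : S → A → ℝ := fun s a => x.lam * α s a + (x.lam - lam) * M.ρ s * x.pol s a
  have hα : ∑ s, ∑ a, |α s a| ≤ 1 / (1 - M.γ) * 2 := by
    have e : ∀ s, ∑ a, |α s a| =
        1 / (1 - M.γ) * (M.occupation πs s * ∑ a, |πs s a - x.pol s a|) := fun s => by
      simp only [α, abs_mul, abs_of_nonneg hL0, abs_of_nonneg (occupation_nonneg (M := M) πs s),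
        ← Finset.mul_sum, mul_assoc]
    simp only [e, ← Finset.mul_sum]
    refine mul_le_mul_of_nonneg_left ?_ hL0
    calc _ ≤ ∑ s, M.occupation πs s * 2 := Finset.sum_le_sum fun s _ =>
          mul_le_mul_of_nonneg_left (sum_simplex_abs_sub_le _ _) (occupation_nonneg πs s)
      _ = 2 := by rw [← Finset.sum_mul, sum_occupation, one_mul]
  have hβ : ∑ s, ∑ a, |β s a| ≤ U * (1 / (1 - M.γ) * 2) + U := by
    have h1 : ∀ s a, |β s a| ≤ U * |α s a| + U * (M.ρ s * x.pol s a) := by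
      intro s a
      have h2 := stdSimplex.zero_le M.ρ s
      have h3 := stdSimplex.zero_le (x.pol s) a
      refine (abs_add_le _ _).trans (add_le_add ?_ ?_)
      · rw [abs_mul, abs_of_nonneg hx.1]
        exact mul_le_mul_of_nonneg_right hx.2 (abs_nonneg _)
      · rw [mul_assoc, abs_mul, abs_of_nonneg (mul_nonneg h2 h3)]
        refine mul_le_mul_of_nonneg_right ?_ (mul_nonneg h2 h3)
        exact abs_le.2 ⟨by linarith [hx.1, hlam.2], by linarith [hx.2, hlam.1]⟩
    calc _ ≤ ∑ s, ∑ a, (U * |α s a| + U * (M.ρ s * x.pol s a)) :=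
          Finset.sum_le_sum fun s _ => Finset.sum_le_sum fun a _ => h1 s a
      _ = U * ∑ s, ∑ a, |α s a| + U := by
          simp only [Finset.sum_add_distrib, ← Finset.mul_sum, stdSimplex.sum_eq_one, mul_one]
      _ ≤ _ := by gcongr
  have hsum : ∑ s, ∑ a, (|α s a| + |β s a|) ≤ 2 * (1 + 2 * U) * (1 / (1 - M.γ)) := by
    simp only [Finset.sum_add_distrib]
    nlinarith
  have h := M.lintegral_exp_batchLaw_le hm x.pol α β hsum t
  have e1 : ∀ B : Batch S A m, ∑ s, ∑ a,
      (α s a * (M.actionValue M.r x.pol s a - (M.estimate B).1 s a) +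
        β s a * (M.actionValue M.c x.pol s a - (M.estimate B).2 s a)) =
      M.noise πs lam x (M.estimate B) := by
    intro B
    simp only [noise, Finset.mul_sum]
    rw [← Finset.sum_add_distrib]
    refine Finset.sum_congr rfl fun s _ => ?_
    rw [← Finset.sum_add_distrib]
    refine Finset.sum_congr rfl fun a _ => ?_
    simp only [α, β]
    ring
  simp only [e1] at h
  refine h.trans (le_of_eq ?_)
  congr 2
  have : (m : ℝ) ≠ 0 := by exact_mod_cast hm.ne'
  field_simp
  norm_num

/-- The tail of the accumulated estimation errors of a run. -/
theorem runLaw_noise_ge_le {m : ℕ} (hm : 0 < m) (πs π₀ : Policy S A) {lam lam₀ U : ℝ}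
    (hU : 0 ≤ U) (hlam : lam ∈ Set.Icc 0 U) (hlam₀ : lam₀ ∈ Set.Icc 0 U) {T : ℕ} (hT : 0 < T)
    {η : ℝ} (hη : 0 < η) :
    M.runLaw U m T π₀ lam₀ {B | T * η ≤ ∑ t ∈ Finset.range T,
        M.noise πs lam (M.runIterate U T π₀ lam₀ B t) (M.estimate (B t))} ≤
      ENNReal.ofReal (Real.exp (-(T * (m * η ^ 2 /
        (2 * ((1 + 2 * U) * (1 / (1 - M.γ)) ^ 2) ^ 2))))) := by
  have hγ := M.one_sub_γ_pos
  have hm' : (0 : ℝ) < m := by exact_mod_cast hm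
  set v := (1 + 2 * U) * (1 / (1 - M.γ)) ^ 2 with hv
  have hv0 : 0 < v := by positivity
  -- The minimizer of the Chernoff exponent `T (v² t² / (2 m) - t η)`.
  set t := m * η / v ^ 2 with ht
  have ht0 : 0 < t := by positivity
  set C := ENNReal.ofReal (Real.exp (v ^ 2 / m * t ^ 2 / 2)) with hC
  let F : ℕ → (ℕ → Batch S A m) → ℝ := fun n B =>
    t * M.noise πs lam (M.runIterate U T π₀ lam₀ B n) (M.estimate (B n))
  have hq : ∀ i, Measurable fun B : ℕ → Batch S A m => M.estimate (B i) := fun i =>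
    (M.measurable_estimate m).comp (measurable_pi_apply i)
  have hFm : ∀ n, Measurable (F n) := fun n => by
    have h := M.measurable_iterate U T π₀ lam₀
      (q := fun (B : ℕ → Batch S A m) i => M.estimate (B i)) hq n
    exact (M.measurable_noise πs lam h.2.1 h.2.2 (hq n)).const_mul t
  have hrun : ∀ n (B B' : ℕ → Batch S A m), (∀ i < n, B i = B' i) →
      M.runIterate U T π₀ lam₀ B n = M.runIterate U T π₀ lam₀ B' n := fun n B B' h =>
    M.iterate_congr U T π₀ lam₀ fun i hi => by rw [h i hi]
  have hdep : ∀ n, ∀ B B' : ℕ → Batch S A m, (∀ i ≤ n, B i = B' i) → F n B = F n B' := by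
    intro n B B' h
    simp only [F]
    rw [hrun n B B' fun i hi => h i hi.le, h n le_rfl]
  have hmain : ∫⁻ B, ENNReal.ofReal (Real.exp (∑ k ∈ Finset.range T, F k B))
      ∂M.runLaw U m T π₀ lam₀ ≤ C ^ T := by
    have hstep := lintegral_exp_sum_trajMeasure_le (μ₀ := M.batchLaw m π₀)
      (κ := M.runKernel U m T π₀ lam₀) hFm hdep (C := C) ?_ ?_ (T - 1)
    · rwa [Nat.sub_add_cancel hT] at hstep
    · have e : ∀ x : Batch S A m, M.runIterate U T π₀ lam₀ (fun _ => x) 0 =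
          ⟨fun _ _ => 0, π₀, lam₀⟩ := fun x => by
        simp only [runIterate, iterate]
      simp only [F, e]
      exact M.lintegral_exp_noise_le hm πs hU hlam ⟨fun _ _ => 0, π₀, lam₀⟩ hlam₀ t
    · intro n B
      have e : ∀ x : Batch S A m, F (n + 1) (Function.update B (n + 1) x) =
          t * M.noise πs lam (M.runIterate U T π₀ lam₀ B (n + 1)) (M.estimate x) := by
        intro x
        simp only [F]
        rw [hrun (n + 1) _ B fun i hi => Function.update_of_ne (by omega) _ _,
          Function.update_self]
      -- The kernel only sees the history, but iterate `n + 1` uses nothing else, so the batch is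
      -- drawn with the actual policy of that iteration.
      have e2 : M.runKernel U m T π₀ lam₀ n
          (Preorder.frestrictLe (π := fun _ => Batch S A m) n B) =
          M.batchLaw m (M.runIterate U T π₀ lam₀ B (n + 1)).pol := by
        change M.batchLaw m (M.nextPolicy U T π₀ lam₀ n _) = _
        congr 1
        refine congrArg Iterate.pol (M.iterate_congr U T π₀ lam₀ fun i hi => ?_)
        rw [dif_pos (by omega : i ≤ n)]
        rfl
      simp only [e, e2]
      exact M.lintegral_exp_noise_le hm πs hU hlam _
        (M.iterate_lam_mem U T π₀ lam₀ _ hlam₀ (n + 1)) t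
  have hsub : {B : ℕ → Batch S A m | T * η ≤ ∑ k ∈ Finset.range T,
      M.noise πs lam (M.runIterate U T π₀ lam₀ B k) (M.estimate (B k))} ⊆
      {B | ENNReal.ofReal (Real.exp (t * (T * η))) ≤
        ENNReal.ofReal (Real.exp (∑ k ∈ Finset.range T, F k B))} := by
    intro B hB
    refine ENNReal.ofReal_le_ofReal (Real.exp_le_exp.2 ?_)
    simp only [F, ← Finset.mul_sum]
    exact mul_le_mul_of_nonneg_left hB ht0.le
  refine (measure_mono hsub).trans ((meas_ge_le_lintegral_div
    (Finset.measurable_fun_sum _ fun k _ => hFm k).exp.ennreal_ofReal.aemeasurable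
    (by simpa using Real.exp_pos _) ENNReal.ofReal_ne_top).trans
    ((ENNReal.div_le_div_right hmain _).trans (le_of_eq ?_)))
  rw [hC, ← ENNReal.ofReal_pow (Real.exp_pos _).le, ← ENNReal.ofReal_div_of_pos (Real.exp_pos _),
    ← Real.exp_nat_mul, ← Real.exp_sub]
  congr 2
  rw [ht]
  field_simp
  ring

end Concentration

end CMDP

namespace CMDP

variable {S A : Type*} [Fintype S] [Fintype A]

/-! ### From the Lagrangian bound to the two gaps -/

section Bounds

variable [MeasurableSpace S] [DiscreteMeasurableSpace S]
  [MeasurableSpace A] [DiscreteMeasurableSpace A] (M : CMDP S A)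

theorem ζ_mul_U (hζ : 0 < M.ζ) : M.ζ * M.U = 2 * (1 / (1 - M.γ)) := by
  have := M.one_sub_γ_pos
  unfold U
  field_simp

theorem one_le_Psi (hU : 0 ≤ M.U) (T : ℕ) : 1 ≤ M.Psi T := by
  unfold Psi
  have : 0 ≤ 4 * M.U * √(Real.log ((T + 1) * M.U)) := by positivity
  linarith

/-- Bounds on the Lagrangian regret for the two extreme dual variables bound both gaps. -/
theorem gaps_le_of_lagrangian_le (hζ : 0 < M.ζ) {πs : Policy S A}
    (hπs : M.IsOptimal πs) {T : ℕ} (hT : 0 < T) (pol : ℕ → Policy S A) {R η : ℝ} (hR : 0 ≤ R)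
    (hη : 0 ≤ η)
    (h : ∀ lam, lam = 0 ∨ lam = M.U →
      ∑ t ∈ Finset.range T, (M.value M.r πs - M.value M.r (pol t)) +
        lam * ∑ t ∈ Finset.range T, (M.b - M.value M.c (pol t)) ≤
          √T / (1 - M.γ) * R + T * (η / (1 - M.γ))) :
    M.optGap πs T pol ≤ R / ((1 - M.γ) * √T) + η / (1 - M.γ) ∧
      M.constrViolation T pol ≤ M.ζ * R / √T + M.ζ * η := by
  have hγ := M.one_sub_γ_pos
  have hT' : (0 : ℝ) < T := by exact_mod_cast hT
  have hsT : 0 < √(T : ℝ) := Real.sqrt_pos.2 hT'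
  have hL : 0 < 1 / (1 - M.γ) := one_div_pos.2 hγ
  set G := ∑ t ∈ Finset.range T, (M.value M.r πs - M.value M.r (pol t)) with hG
  set v := ∑ t ∈ Finset.range T, (M.b - M.value M.c (pol t)) with hv
  have hscale : 1 / T * (√T / (1 - M.γ) * R + T * (η / (1 - M.γ))) =
      R / ((1 - M.γ) * √T) + η / (1 - M.γ) := by
    field_simp
    linear_combination R * Real.mul_self_sqrt hT'.le
  have h' : ∀ lam, lam = 0 ∨ lam = M.U →
      1 / T * G + lam * (1 / T * v) ≤ R / ((1 - M.γ) * √T) + η / (1 - M.γ) := by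
    intro lam hlam
    have := mul_le_mul_of_nonneg_left (h lam hlam) (one_div_pos.2 hT').le
    rw [hscale] at this
    linarith
  refine ⟨by simpa [optGap, ← hG] using h' 0 (Or.inl rfl), ?_⟩
  rw [constrViolation, ← hv]
  rcases le_or_gt v 0 with h0 | h0
  · rw [max_eq_right h0, mul_zero]
    positivity
  rw [max_eq_left h0.le]
  have hU := h' M.U (Or.inr rfl)
  set G' := 1 / (T : ℝ) * G with hG'
  set v' := 1 / (T : ℝ) * v with hv'
  have hv0 : 0 < v' := by positivity
  have hmem := M.average_mem_values M.r_mem M.c_mem pol hT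
  have e1 : 1 / (T : ℝ) * ∑ t ∈ Finset.range T, M.value M.r (pol t) = M.value M.r πs - G' := by
    rw [hG', hG, Finset.sum_sub_distrib, Finset.sum_const, Finset.card_range, nsmul_eq_mul]
    field_simp
    ring
  have e2 : 1 / (T : ℝ) * ∑ t ∈ Finset.range T, M.value M.c (pol t) = M.b - v' := by
    rw [hv', hv, Finset.sum_sub_distrib, Finset.sum_const, Finset.card_range, nsmul_eq_mul]
    field_simp
    ring
  rw [e1, e2] at hmem
  -- The averaged run may beat `πs`, but by at most `v' / (ζ (1 - γ))`. Of the penalty `ζ U v' = 2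
  -- v' / (1 - γ)` one half compensates for this and the other half bounds the violation.
  have hz := M.ζ_mul_le hπs hmem (by linarith)
  have h1 := mul_le_mul_of_nonneg_left hU hζ.le
  have h2 : M.ζ * (G' + M.U * v') = M.ζ * G' + 2 * (1 / (1 - M.γ)) * v' := by
    rw [← M.ζ_mul_U hζ]
    ring
  have h3 : 1 / (1 - M.γ) * v' ≤ M.ζ * (R / ((1 - M.γ) * √T) + η / (1 - M.γ)) := by linarith
  have h4 := mul_le_mul_of_nonneg_left h3 hγ.le
  have e3 : (1 - M.γ) * (1 / (1 - M.γ) * v') = v' := by field_simp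
  have e4 : (1 - M.γ) * (M.ζ * (R / ((1 - M.γ) * √T) + η / (1 - M.γ))) =
      M.ζ * R / √T + M.ζ * η := by field_simp
  rwa [e3, e4] at h4

/-- For short horizons the trivial bounds on the value functions suffice. -/
theorem gaps_le_of_short (hb : 0 ≤ M.b) (hζ : 0 < M.ζ) (πs : Policy S A) {T : ℕ} (hT : 0 < T)
    (hT9 : T ≤ 9) (pol : ℕ → Policy S A) {R : ℝ} (hR : 3 * (1 + M.U) / (1 - M.γ) ≤ R) :
    M.optGap πs T pol ≤ R / ((1 - M.γ) * √T) ∧ M.constrViolation T pol ≤ M.ζ * R / √T := by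
  have hγ := M.one_sub_γ_pos
  have hT' : (0 : ℝ) < T := by exact_mod_cast hT
  have hsT : 0 < √(T : ℝ) := Real.sqrt_pos.2 hT'
  -- For `T ≤ 9` the factor `3` in `R` absorbs `√T`.
  have hs3 : √(T : ℝ) ≤ 3 := by
    rw [Real.sqrt_le_left (by norm_num)]
    have : (T : ℝ) ≤ 9 := by exact_mod_cast hT9
    linarith
  have hU := M.two_le_U πs hb hζ
  have hL1 : 1 ≤ 1 / (1 - M.γ) := by
    rw [le_div_iff₀ hγ]
    linarith [M.γ_nonneg]
  have hRL : 3 * (1 + M.U) * (1 / (1 - M.γ)) ≤ R := by rwa [mul_one_div]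
  have hsum : ∀ f : ℕ → ℝ, (∀ t, f t ≤ 1 / (1 - M.γ)) →
      1 / (T : ℝ) * ∑ t ∈ Finset.range T, f t ≤ 1 / (1 - M.γ) := by
    intro f hf
    calc _ ≤ 1 / (T : ℝ) * ∑ _t ∈ Finset.range T, 1 / (1 - M.γ) := by
          gcongr with t _
          exact hf t
      _ = _ := by
          rw [Finset.sum_const, Finset.card_range, nsmul_eq_mul]
          field_simp
  constructor
  · refine (hsum _ fun t => ?_).trans ?_
    · have h1 := (M.value_mem M.r_mem πs).2
      have h2 := (M.value_mem M.r_mem (pol t)).1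
      linarith
    · have hR9 : 9 ≤ R := by nlinarith
      rw [div_le_div_iff₀ hγ (by positivity)]
      nlinarith [mul_le_mul_of_nonneg_left (hs3.trans (by linarith : (3 : ℝ) ≤ R)) hγ.le]
  · rw [constrViolation]
    have h1 : 1 / (T : ℝ) * max (∑ t ∈ Finset.range T, (M.b - M.value M.c (pol t))) 0 ≤
        1 / (1 - M.γ) := by
      rcases max_cases (∑ t ∈ Finset.range T, (M.b - M.value M.c (pol t))) 0 with ⟨h, _⟩ | ⟨h, _⟩
      · rw [h]
        refine hsum _ fun t => ?_
        have h1 := M.b_le πs hζ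
        have h2 := (M.value_mem M.c_mem (pol t)).1
        linarith
      · rw [h, mul_zero]
        linarith
    refine h1.trans ?_
    rw [le_div_iff₀ hsT]
    have h2 := M.ζ_mul_U hζ
    have h3 : M.ζ * (3 * (1 + M.U) * (1 / (1 - M.γ))) ≤ M.ζ * R := by gcongr
    have h4 : 0 < M.ζ * (1 / (1 - M.γ)) := by positivity
    have h5 : M.ζ * (3 * (1 + M.U) * (1 / (1 - M.γ))) =
        3 * (M.ζ * (1 / (1 - M.γ))) + 3 * (2 * (1 / (1 - M.γ))) * (1 / (1 - M.γ)) := by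
      rw [← h2]
      ring
    nlinarith

/-- With the sampling error `ε_s`, the accumulated estimation errors of a run of length at least
`4` are too large with probability at most `δ / 2`. -/
theorem runLaw_noise_ge_le_half [Nonempty S] [Nonempty A] {T m : ℕ} (hT : 4 ≤ T) (hm : 0 < m)
    {δ : ℝ} (hδ : δ ∈ Set.Ioo (0 : ℝ) 1) (πs π₀ : Policy S A) {lam lam₀ U : ℝ} (hU : 0 ≤ U)
    (hlam : lam ∈ Set.Icc 0 U) (hlam₀ : lam₀ ∈ Set.Icc 0 U) :
    (M.runLaw U m T π₀ lam₀).real {B | T * (M.epsS m δ * (1 + 2 * U) / (1 - M.γ)) ≤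
      ∑ t ∈ Finset.range T,
        M.noise πs lam (M.runIterate U T π₀ lam₀ B t) (M.estimate (B t))} ≤ δ / 2 := by
  have hγ := M.one_sub_γ_pos
  have hm' : (0 : ℝ) < m := by exact_mod_cast hm
  have hS : (1 : ℝ) ≤ Fintype.card S := by exact_mod_cast Fintype.card_pos
  have hA : (1 : ℝ) ≤ Fintype.card A := by exact_mod_cast Fintype.card_pos
  have hSA : (1 : ℝ) ≤ Fintype.card S * Fintype.card A := by nlinarith
  set κ : ℝ := 2 * Fintype.card S * Fintype.card A / δ with hκ
  have hκ2 : 2 / δ ≤ κ := by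
    rw [hκ]
    gcongr
    · exact hδ.1.le
    · linarith
  have hκ1 : 1 < κ := by
    refine lt_of_lt_of_le ?_ hκ2
    rw [lt_div_iff₀ hδ.1]
    linarith [hδ.2]
  have hℓ : 0 < Real.log κ := Real.log_pos hκ1
  have hη : 0 < M.epsS m δ * (1 + 2 * U) / (1 - M.γ) := by
    rw [epsS, ← hκ]
    positivity
  have h := M.runLaw_noise_ge_le hm πs π₀ hU hlam hlam₀ (by omega : 0 < T) hη
  refine ENNReal.toReal_le_of_le_ofReal (by linarith [hδ.1])
    (h.trans (ENNReal.ofReal_le_ofReal ?_))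
  -- The tail is `κ ^ (-T / 4)`, at most `κ⁻¹ ≤ δ / 2` as soon as `T ≥ 4`.
  have e : (T : ℝ) * (m * (M.epsS m δ * (1 + 2 * U) / (1 - M.γ)) ^ 2 /
      (2 * ((1 + 2 * U) * (1 / (1 - M.γ)) ^ 2) ^ 2)) = T * Real.log κ / 4 := by
    have hsq : √(Real.log κ / (2 * m)) ^ 2 = Real.log κ / (2 * m) :=
      Real.sq_sqrt (by positivity)
    have e1 : (M.epsS m δ * (1 + 2 * U) / (1 - M.γ)) ^ 2 =
        ((1 + 2 * U) * (1 / (1 - M.γ)) ^ 2) ^ 2 * (Real.log κ / (2 * m)) := by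
      rw [← hsq, epsS, ← hκ]
      ring
    rw [e1]
    field_simp
    norm_num
  have hT4 : (4 : ℝ) ≤ T := by exact_mod_cast hT
  calc Real.exp (-((T : ℝ) * (m * (M.epsS m δ * (1 + 2 * U) / (1 - M.γ)) ^ 2 /
        (2 * ((1 + 2 * U) * (1 / (1 - M.γ)) ^ 2) ^ 2)))) ≤ Real.exp (-Real.log κ) := by
        rw [e]
        refine Real.exp_le_exp.2 (neg_le_neg ?_)
        nlinarith
    _ = κ⁻¹ := by rw [Real.exp_neg, Real.exp_log (by linarith)]
    _ ≤ (2 / δ)⁻¹ := inv_anti₀ (div_pos two_pos hδ.1) hκ2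
    _ = δ / 2 := inv_div _ _

end Bounds

end CMDP

end

theorem mainTheorem5 {S A : Type*} [Fintype S] [Fintype A]
    [MeasurableSpace S] [DiscreteMeasurableSpace S]
    [MeasurableSpace A] [DiscreteMeasurableSpace A]
    (M : CMDP S A) (hb : 0 ≤ M.b) (hζ : 0 < M.ζ)
    (πs : Policy S A) (hπs : M.IsOptimal πs)
    (π₀ : Policy S A) (hKL : M.policyKL πs π₀ ≠ ⊤)
    (lam₀ : ℝ) (hlam₀ : lam₀ ∈ Set.Icc 0 M.U)
    (T m : ℕ) (hT : 0 < T) (hm : 0 < m) (δ : ℝ) (hδ : δ ∈ Set.Ioo (0 : ℝ) 1) :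
    1 - δ ≤ (M.runLaw M.U m T π₀ lam₀).real {B |
      M.optGap πs T (fun t => (M.runIterate M.U T π₀ lam₀ B t).pol) ≤
          (3 * (1 + M.U) * √(1 + (M.policyKL πs π₀).toReal) / (1 - M.γ) + M.Psi T) /
              ((1 - M.γ) * √T)
            + M.epsS m δ * (1 + 2 * M.U) / (1 - M.γ) ∧
      M.constrViolation T (fun t => (M.runIterate M.U T π₀ lam₀ B t).pol) ≤
          M.ζ * (3 * (1 + M.U) * √(1 + (M.policyKL πs π₀).toReal) / (1 - M.γ) + M.Psi T) / √T
            + M.ζ * M.epsS m δ * (1 + 2 * M.U)} := by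
  have hγ := M.one_sub_γ_pos
  have hU := M.two_le_U πs hb hζ
  have hΨ := M.one_le_Psi (by linarith) T
  have : Nonempty S := by
    by_contra hS
    rw [not_nonempty_iff] at hS
    simpa using stdSimplex.sum_eq_one M.ρ
  have : Nonempty A := by
    by_contra hA
    rw [not_nonempty_iff] at hA
    simpa using stdSimplex.sum_eq_one (πs (Classical.arbitrary S))
  have hsqrt : 1 ≤ √(1 + (M.policyKL πs π₀).toReal) :=
    Real.one_le_sqrt.2 (by linarith [ENNReal.toReal_nonneg (a := M.policyKL πs π₀)])
  set R := 3 * (1 + M.U) * √(1 + (M.policyKL πs π₀).toReal) / (1 - M.γ) + M.Psi T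
  have hR : 3 * (1 + M.U) / (1 - M.γ) ≤ R := by
    have : 3 * (1 + M.U) / (1 - M.γ) ≤
        3 * (1 + M.U) * √(1 + (M.policyKL πs π₀).toReal) / (1 - M.γ) := by
      refine div_le_div_of_nonneg_right ?_ hγ.le
      exact le_mul_of_one_le_right (by linarith) hsqrt
    linarith
  have hR0 : 0 ≤ R := le_trans (by positivity) hR
  have hη : 0 ≤ M.epsS m δ * (1 + 2 * M.U) := by
    unfold CMDP.epsS
    positivity
  set μ := M.runLaw M.U m T π₀ lam₀
  -- The noise bound needs `T ≥ 4` and the trivial bounds need `T ≤ 9`, so any cut from `3` to `9`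
  -- would do.
  rcases Nat.lt_or_ge 9 T with hT9 | hT9
  · set bad : ℝ → Set (ℕ → Batch S A m) := fun lam =>
      {B | T * (M.epsS m δ * (1 + 2 * M.U) / (1 - M.γ)) ≤ ∑ t ∈ Finset.range T,
        M.noise πs lam (M.runIterate M.U T π₀ lam₀ B t) (M.estimate (B t))} with hbad
    have h0 : μ.real (bad 0) ≤ δ / 2 := M.runLaw_noise_ge_le_half (by omega) hm hδ πs π₀
      (by linarith) ⟨le_rfl, by linarith⟩ hlam₀
    have hU' : μ.real (bad M.U) ≤ δ / 2 := M.runLaw_noise_ge_le_half (by omega) hm hδ πs π₀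
      (by linarith) ⟨by linarith, le_rfl⟩ hlam₀
    set good : Set (ℕ → Batch S A m) := {B |
      M.optGap πs T (fun t => (M.runIterate M.U T π₀ lam₀ B t).pol) ≤
          R / ((1 - M.γ) * √T) + M.epsS m δ * (1 + 2 * M.U) / (1 - M.γ) ∧
      M.constrViolation T (fun t => (M.runIterate M.U T π₀ lam₀ B t).pol) ≤
          M.ζ * R / √T + M.ζ * M.epsS m δ * (1 + 2 * M.U)} with hgood
    -- Subadditivity over this cover avoids any measurability of `good`.
    have hcover : Set.univ ⊆ good ∪ (bad 0 ∪ bad M.U) := by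
      intro B _
      by_cases hB : B ∈ bad 0 ∪ bad M.U
      · exact Or.inr hB
      left
      have hB' : ∀ lam, lam = 0 ∨ lam = M.U → ∑ t ∈ Finset.range T,
          M.noise πs lam (M.runIterate M.U T π₀ lam₀ B t) (M.estimate (B t)) <
          T * (M.epsS m δ * (1 + 2 * M.U) / (1 - M.γ)) := by
        rintro lam (rfl | rfl)
        · exact not_le.1 fun h => hB (Or.inl h)
        · exact not_le.1 fun h => hB (Or.inr h)
      have := M.gaps_le_of_lagrangian_le hζ hπs hT
        (fun t => (M.runIterate M.U T π₀ lam₀ B t).pol) hR0 hη fun lam hlam =>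
          (CMDP.sum_lagrangian_gap_le hπs.1 hKL hT (by linarith) hb (M.b_le πs hζ) hlam₀
            (fun i => M.isBoundedEstimate_estimate hm (B i)) hlam).trans
            (add_le_add le_rfl (hB' lam hlam).le)
      rwa [← mul_assoc] at this
    have h1 : (1 : ℝ) ≤ μ.real good + (μ.real (bad 0) + μ.real (bad M.U)) :=
      calc (1 : ℝ) = μ.real Set.univ := probReal_univ.symm
        _ ≤ μ.real (good ∪ (bad 0 ∪ bad M.U)) := measureReal_mono hcover
        _ ≤ μ.real good + μ.real (bad 0 ∪ bad M.U) := measureReal_union_le _ _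
        _ ≤ _ := by gcongr; exact measureReal_union_le _ _
    linarith
  · have hall : ∀ B : ℕ → Batch S A m,
        M.optGap πs T (fun t => (M.runIterate M.U T π₀ lam₀ B t).pol) ≤
          R / ((1 - M.γ) * √T) + M.epsS m δ * (1 + 2 * M.U) / (1 - M.γ) ∧
        M.constrViolation T (fun t => (M.runIterate M.U T π₀ lam₀ B t).pol) ≤
          M.ζ * R / √T + M.ζ * M.epsS m δ * (1 + 2 * M.U) := by
      intro B
      obtain ⟨h1, h2⟩ := M.gaps_le_of_short hb hζ πs hT hT9
        (fun t => (M.runIterate M.U T π₀ lam₀ B t).pol) hR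
      have h3 : 0 ≤ M.epsS m δ * (1 + 2 * M.U) / (1 - M.γ) := by positivity
      have h4 : 0 ≤ M.ζ * M.epsS m δ * (1 + 2 * M.U) := by
        rw [mul_assoc]
        positivity
      exact ⟨h1.trans (by linarith), h2.trans (by linarith)⟩
    rw [Set.eq_univ_of_forall (s := {B : ℕ → Batch S A m | _ ∧ _}) hall, probReal_univ]
    linarith [hδ.1]
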